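/- **Setting.** Let $\mathbb B$ be the commutative algebra over $\mathbb C$ with basis $e_1,e_2$, where $e_1$ is the unit and $e_2^2=e_1+2ie_2$, with the Euclidean norm. Every $a\in\mathbb B$ is written $a=U_1e_1+U_2\,ie_1+U_3e_2+U_4\,ie_2$ with real $U_l=\mathrm U_l[a]$. Let $D\subset\mathbb C$ be a bounded domain, $\mathcal U$ the open unit disc, $\Gamma$ the unit circle, and $\sigma:\overline{\mathcal U}\to\overline D$ a homeomorphism which maps $\mathcal U$ conformally onto $D$ and $\Gamma$ onto $\partial D$. Put $\sigma_1=\mathrm{Re}\,\sigma$, $\sigma_2=\mathrm{Im}\,\sigma$, $\widetilde\sigma=\sigma_1e_1+\sigma_2e_2$, and let $D_\zeta=\widetilde\sigma(\mathcal U)=\{xe_1+ye_2:x+iy\in D\}$, $\partial D_\zeta=\widetilde\sigma(\Gamma)$. Let $\mathcal X=\{X_1,\dots,X_m\}\subset\Gamma$ ($m\ge1$, distinct points, the preimages of the corner points), $\zeta_j=\widetilde\sigma(X_j)$, $\mathcal R(Z)=\min_j|Z-X_j|$, and $\mathcal R_0=\min_{k\ne j}|X_k-X_j|$ ($\mathcal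 R_0=1$ if $m=1$). On $\Gamma\setminus\mathcal X$ the derivatives $\sigma',\sigma_2',\widetilde\sigma'$ are contour derivatives, $f'(T)=\lim_{S\to T,\,S\in\Gamma}\frac{f(S)-f(T)}{S-T}$; in $\mathcal U$, $\sigma'$ is the usual derivative. For $S\ne Z$ put $d(S,Z)=\frac{\sigma(S)-\sigma(Z)}{S-Z}$, $d_2(S,Z)=\frac{\sigma_2(S)-\sigma_2(Z)}{S-Z}$. **Hypotheses.** Let $\beta_j\in(-1,1]$ and assume the following. a) The contour derivative $\sigma'$ exists, is continuous and does not vanish on $\Gamma\setminus\mathcal X$, and $|\sigma'(Z)|\le c\prod_{j}|Z-X_j|^{\beta_j}$ for all $Z\in\overline{\mathcal U}\setminus\mathcal X$. b) For some $r_0\in(0,\mathcal R_0/4)$ there are nondecreasing, bounded, semiadditive functions $\omega_1,\omega_1^*:(0,\infty)\to(0,\infty)$ with $\int_0^2\frac{\omega_1(\eta)}{\eta}d\eta<\infty$ and $\int_0^\varepsilon\frac{\omega_1^*(\eta)}{\eta}d\eta<c\,\omega_1^*(\varepsilon)$ for $0<\varepsilon<r_0/2$, such that, with $\omega=\omega_1^*$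 if $\mathcal R(Z_0)\le r_0$ and $\omega=\omega_1$ if $\mathcal R(Z_0)>r_0$, $$|\sigma'(Z)-\sigma'(Z_0)|\le c\,\frac{\omega(|Z-Z_0|)}{\omega(\frac12\mathcal R(Z_0))}\prod_{j=1}^m|Z-X_j|^{\beta_j}$$ for all $Z_0\in\Gamma\setminus\mathcal X$ and all $Z\ne Z_0$ on $\Gamma$ or on the segment $[0,Z_0]$ with $|Z-Z_0|\le\frac12\mathcal R(Z_0)$. Moreover, with some $c>0$, for every $j$, $$|d(S,Z)|\ge c\,\bigl(|S-X_j|+|Z-X_j|\bigr)^{\beta_j}$$ for all $Z\in\overline{\mathcal U}\setminus\mathcal X$ with $|Z-X_j|\le r_0$ and all $S\in\Gamma\setminus\mathcal X$ with $|S-X_j|\le2r_0$, $S\neq Z$. c) The functions $\varphi_1,\varphi_3:\partial D_\zeta\setminus\{\zeta_1,\dots,\zeta_m\}\to\mathbb R$ are continuous and $|\varphi_l(\zeta)|\le c\prod_j\|\zeta-\zeta_j\|^{-\alpha_j}$, where $\alpha_j<1$ if $\beta_j\in(-1,0)$ and $\alpha_j<1/(\beta_j+1)$ if $\beta_j\in[0,1]$.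 All constants $c$ are independent of the points and of $\varepsilon$. **Notation.** Let $\varphi=\varphi_1e_1+\varphi_3e_2$ and $$\Phi(\zeta)=\frac1{2\pi i}\int_{\partial D_\zeta}\varphi(\tau)(\tau-\zeta)^{-1}d\tau=\frac1{2\pi i}\int_\Gamma\varphi(\widetilde\sigma(S))\,\bigl(\widetilde\sigma(S)-\zeta\bigr)^{-1}\,\widetilde\sigma'(S)\,dS,\qquad \zeta\in D_\zeta .$$ Put $\widetilde\varphi_l(S)=\varphi_l(\widetilde\sigma(S))$ and, for $S\neq Z$ (with value $0$ for $S=Z$), $$\Omega_1^{f}(S,Z)=f(S)\Bigl(\frac{\sigma'(S)}{d(S,Z)}-1\Bigr),\qquad \Omega_2^{f}(S,Z)=\frac{f(S)}2\Bigl(\frac{\sigma'(S)\,d_2(S,Z)}{d(S,Z)^2}-\frac{\sigma_2'(S)}{d(S,Z)}\Bigr),$$ $$\Omega_*=\Omega_1^{\widetilde\varphi_1}+2i\,\Omega_2^{\widetilde\varphi_1}-2\,\Omega_2^{\widetilde\varphi_3},\qquad \Omega_{**}=\Omega_1^{\widetilde\varphi_3}-2i\,\Omega_2^{\widetilde\varphi_3}-2\,\Omega_2^{\widetilde\varphi_1},$$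 $$\mathcal I[\Omega](Z_0)=\frac1{2\pi i}\lim_{\delta\to0+}\int_{\{S\in\Gamma:\,|S-Z_0|>\delta\}}\frac{\Omega(S,Z_0)}{S-Z_0}\,dS,\qquad C_{\widetilde\varphi_l}=\frac1{4\pi i}\int_\Gamma\frac{\widetilde\varphi_l(S)}{S}\,dS .$$ **Conclusion.** The integrals defining $\Phi(\zeta)$ for $\zeta\in D_\zeta$ and $C_{\widetilde\varphi_1},C_{\widetilde\varphi_3}$ converge absolutely, and for every $Z_0\in\Gamma\setminus\mathcal X$ the principal values $\mathcal I[\Omega_*](Z_0)$ and $\mathcal I[\Omega_{**}](Z_0)$ exist and $$\lim_{Z\to Z_0,\,Z\in\mathcal U}\mathrm U_1\bigl[\Phi(\widetilde\sigma(Z))\bigr]=\tfrac12\widetilde\varphi_1(Z_0)+\mathrm{Re}\,\mathcal I[\Omega_*](Z_0)+C_{\widetilde\varphi_1},$$ $$\lim_{Z\to Z_0,\,Z\in\mathcal U}\mathrm U_3\bigl[\Phi(\widetilde\sigma(Z))\bigr]=\tfrac12\widetilde\varphi_3(Z_0)+\mathrm{Re}\,\mathcal I[\Omega_{**}](Z_0)+C_{\widetilde\varphi_3}.$$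 -/

import Mathlib

open Set Filter Topology MeasureTheory Metric

noncomputable section

/-- The biharmonic algebra `𝔹 = {z₁ e₁ + z₂ e₂ : z₁, z₂ ∈ ℂ}` with the Euclidean norm
`‖z₁ e₁ + z₂ e₂‖ = √(|z₁|² + |z₂|²)`. -/
def Biharm : Type := EuclideanSpace ℂ (Fin 2)

namespace Biharm

instance : NormedAddCommGroup Biharm :=
  inferInstanceAs (NormedAddCommGroup (EuclideanSpace ℂ (Fin 2)))

instance : NormedSpace ℂ Biharm :=
  inferInstanceAs (NormedSpace ℂ (EuclideanSpace ℂ (Fin 2)))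

/-- The element `a e₁ + b e₂`. -/
def mk (a b : ℂ) : Biharm := (!₂[a, b] : EuclideanSpace ℂ (Fin 2))

/-- The coefficient of `e₁`. -/
def c₁ (a : Biharm) : ℂ := (id a : EuclideanSpace ℂ (Fin 2)) 0

/-- The coefficient of `e₂`. -/
def c₂ (a : Biharm) : ℂ := (id a : EuclideanSpace ℂ (Fin 2)) 1

theorem ext_coeff {a b : Biharm} (h₁ : a.c₁ = b.c₁) (h₂ : a.c₂ = b.c₂) : a = b := by
  refine PiLp.ext (fun i => ?_)
  fin_cases i
  · exact h₁
  · exact h₂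

@[simp] theorem c₁_mk (a b : ℂ) : (mk a b).c₁ = a := rfl
@[simp] theorem c₂_mk (a b : ℂ) : (mk a b).c₂ = b := rfl
@[simp] theorem c₁_zero : (0 : Biharm).c₁ = 0 := rfl
@[simp] theorem c₂_zero : (0 : Biharm).c₂ = 0 := rfl
@[simp] theorem c₁_add (a b : Biharm) : (a + b).c₁ = a.c₁ + b.c₁ := rfl
@[simp] theorem c₂_add (a b : Biharm) : (a + b).c₂ = a.c₂ + b.c₂ := rfl
@[simp] theorem c₁_smul (z : ℂ) (a : Biharm) : (z • a).c₁ = z * a.c₁ := rfl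
@[simp] theorem c₂_smul (z : ℂ) (a : Biharm) : (z • a).c₂ = z * a.c₂ := rfl

def e₁ : Biharm := mk 1 0

def e₂ : Biharm := mk 0 1

/-- The bilinear multiplication with `e₁ e₁ = e₁`, `e₁ e₂ = e₂ e₁ = e₂`, `e₂ e₂ = e₁ + 2 i e₂`. -/
instance : Mul Biharm :=
  ⟨fun a b => mk (a.c₁ * b.c₁ + a.c₂ * b.c₂)
    (a.c₁ * b.c₂ + a.c₂ * b.c₁ + 2 * Complex.I * (a.c₂ * b.c₂))⟩

instance : One Biharm := ⟨e₁⟩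

@[simp] theorem c₁_mul (a b : Biharm) : (a * b).c₁ = a.c₁ * b.c₁ + a.c₂ * b.c₂ := rfl
@[simp] theorem c₂_mul (a b : Biharm) :
    (a * b).c₂ = a.c₁ * b.c₂ + a.c₂ * b.c₁ + 2 * Complex.I * (a.c₂ * b.c₂) := rfl
@[simp] theorem c₁_one : (1 : Biharm).c₁ = 1 := rfl
@[simp] theorem c₂_one : (1 : Biharm).c₂ = 0 := rfl

instance : CommRing Biharm :=
  { (inferInstance : AddCommGroup Biharm), (inferInstance : Mul Biharm),
    (inferInstance : One Biharm) with
    left_distrib := fun a b c => by apply ext_coeff <;> simp <;> ring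
    right_distrib := fun a b c => by apply ext_coeff <;> simp <;> ring
    zero_mul := fun a => by apply ext_coeff <;> simp
    mul_zero := fun a => by apply ext_coeff <;> simp
    mul_assoc := fun a b c => by
      apply ext_coeff
      · simp; ring
      · simp; ring
    one_mul := fun a => by apply ext_coeff <;> simp
    mul_one := fun a => by apply ext_coeff <;> simp
    mul_comm := fun a b => by apply ext_coeff <;> simp <;> ring }

theorem e₂_mul_e₂ : e₂ * e₂ = e₁ + (2 * Complex.I) • e₂ := by
  apply ext_coeff <;> simp [e₁, e₂]

/-- The real components of `a = U₁ e₁ + U₂ i e₁ + U₃ e₂ + U₄ i e₂` with numbers 1 and 3. -/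
def U₁ (a : Biharm) : ℝ := a.c₁.re

def U₃ (a : Biharm) : ℝ := a.c₂.re

/-- The congruence `x + i y ↦ x e₁ + y e₂` of `ℂ` with the biharmonic plane. -/
def ofPlane (z : ℂ) : Biharm := mk (z.re : ℂ) (z.im : ℂ)

end Biharm

namespace BiharmCauchy

/-- `σ` is a conformal map of the open unit disc onto the domain `D`, together with its
homeomorphic extension to the closed disc, which carries the unit circle onto `∂D`. -/
structure IsConformalOnto (σ : ℂ → ℂ) (D : Set ℂ) : Prop where
  differentiableOn : DifferentiableOn ℂ σ (ball 0 1)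
  bijOn : BijOn σ (ball 0 1) D
  continuousOn : ContinuousOn σ (closedBall 0 1)
  bijOn_boundary : BijOn σ (sphere 0 1) (frontier D)

/-- The contour derivative at `T` of a function on the unit circle: the limit of
`(f S - f T) / (S - T)` as `S → T` along the circle. -/
def contourDeriv {E : Type*} [NormedAddCommGroup E] [NormedSpace ℂ E] (f : ℂ → E) (T : ℂ) : E :=
  derivWithin f (sphere 0 1) T

/-- `σ'(Z)` for `Z` in the closed disc: the ordinary derivative inside the disc, the contour
derivative on the unit circle. -/
def discDeriv (σ : ℂ → ℂ) (Z : ℂ) : ℂ :=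
  if ‖Z‖ < 1 then deriv σ Z else contourDeriv σ Z

/-- `d(S,Z) = (σ(S) - σ(Z)) / (S - Z)`. -/
def d (σ : ℂ → ℂ) (S Z : ℂ) : ℂ := (σ S - σ Z) / (S - Z)

/-- `σ₂ = Im σ`, as a complex-valued function. -/
def sigma₂ (σ : ℂ → ℂ) (Z : ℂ) : ℂ := ((σ Z).im : ℂ)

/-- `σ̃ = σ₁ e₁ + σ₂ e₂`. -/
def sigmaTilde (σ : ℂ → ℂ) (Z : ℂ) : Biharm := Biharm.ofPlane (σ Z)

section points

variable {m : ℕ}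

/-- `𝓡(Z)`, the least distance from `Z` to the points `X_j`. -/
def distX (X : Fin m → ℂ) (Z : ℂ) : ℝ := ⨅ j, ‖Z - X j‖

/-- `𝓡₀`, the least distance between different points `X_j` (and `1` for a single point). -/
def sepX (X : Fin m → ℂ) : ℝ :=
  if m = 1 then 1
  else ⨅ p : {p : Fin m × Fin m // p.1 ≠ p.2}, ‖X p.1.1 - X p.1.2‖

/-- Nondecreasing, bounded, semiadditive functions `(0,∞) → (0,∞)`. -/
structure IsSemiadditiveModulus (ω : ℝ → ℝ) : Prop where
  pos : ∀ η, 0 < η → 0 < ω η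
  mono : MonotoneOn ω (Ioi 0)
  bdd : ∃ B : ℝ, ∀ η, 0 < η → ω η ≤ B
  subadd : ∀ η₁ η₂, 0 < η₁ → 0 < η₂ → ω (η₁ + η₂) ≤ ω η₁ + ω η₂

/-- `|σ'(Z) - σ'(Z₀)| ≤ c ω(|Z - Z₀|) / ω(𝓡(Z₀)/2) ∏ |Z - X_j|^{β_j}` for all `Z₀` in `A` and all
`Z ≠ Z₀` on the circle or on the radius `[0, Z₀]` with `|Z - Z₀| ≤ 𝓡(Z₀)/2`. -/
def DerivModulusBound (σ : ℂ → ℂ) (X : Fin m → ℂ) (β : Fin m → ℝ) (ω : ℝ → ℝ) (A : Set ℂ) : Prop :=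
  ∃ c : ℝ, ∀ Z₀ ∈ A, ∀ Z ∈ sphere (0 : ℂ) 1 ∪ segment ℝ 0 Z₀, Z ≠ Z₀ →
    ‖Z - Z₀‖ ≤ distX X Z₀ / 2 →
    ‖discDeriv σ Z - discDeriv σ Z₀‖ ≤
      c * (ω ‖Z - Z₀‖ / ω (distX X Z₀ / 2)) * ∏ j, ‖Z - X j‖ ^ β j

/-- The contour derivative of `σ` exists, is continuous and has no zeros on the circle without the
points `X_j`, and `|σ'(Z)| ≤ c ∏ |Z - X_j|^{β_j}` on the closed disc without these points. -/
structure DerivCondition (σ : ℂ → ℂ) (X : Fin m → ℂ) (β : Fin m → ℝ) : Prop where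
  differentiable : ∀ T ∈ sphere (0 : ℂ) 1 \ range X, DifferentiableWithinAt ℂ σ (sphere 0 1) T
  continuousOn : ContinuousOn (contourDeriv σ) (sphere 0 1 \ range X)
  ne_zero : ∀ T ∈ sphere (0 : ℂ) 1 \ range X, contourDeriv σ T ≠ 0
  bound : ∃ c : ℝ, ∀ Z ∈ closedBall (0 : ℂ) 1 \ range X,
    ‖discDeriv σ Z‖ ≤ c * ∏ j, ‖Z - X j‖ ^ β j

/-- The local conditions on `σ'` near and away from the points `X_j`, and the local lower bound
`|d(S,Z)| ≥ c (|S - X_j| + |Z - X_j|)^{β_j}`. -/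
def LocalCondition (σ : ℂ → ℂ) (X : Fin m → ℂ) (β : Fin m → ℝ) : Prop :=
  ∃ r₀ : ℝ, 0 < r₀ ∧ r₀ < sepX X / 4 ∧
    (∃ ω₁ ω₁' : ℝ → ℝ, IsSemiadditiveModulus ω₁ ∧ IsSemiadditiveModulus ω₁' ∧
      IntegrableOn (fun η => ω₁ η / η) (Ioc 0 2) ∧
      (∃ c : ℝ, ∀ ε, 0 < ε → ε < r₀ / 2 →
        IntegrableOn (fun η => ω₁' η / η) (Ioc 0 ε) ∧
          ∫ η in Ioc 0 ε, ω₁' η / η < c * ω₁' ε) ∧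
      DerivModulusBound σ X β ω₁' {Z | Z ∈ sphere (0 : ℂ) 1 \ range X ∧ ∃ j, ‖Z - X j‖ ≤ r₀} ∧
      DerivModulusBound σ X β ω₁ {Z | Z ∈ sphere (0 : ℂ) 1 ∧ ¬ ∃ j, ‖Z - X j‖ ≤ r₀}) ∧
    ∃ c : ℝ, 0 < c ∧ ∀ j, ∀ Z ∈ closedBall (0 : ℂ) 1 \ range X, ‖Z - X j‖ ≤ r₀ →
      ∀ S ∈ sphere (0 : ℂ) 1 \ range X, ‖S - X j‖ ≤ 2 * r₀ → S ≠ Z →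
        c * (‖S - X j‖ + ‖Z - X j‖) ^ β j ≤ ‖d σ S Z‖

/-- The density `f` is continuous on `∂D_ζ` without the corner points `ζ_j = σ̃(X_j)`, and there
`|f(ζ)| ≤ c ∏ ‖ζ - ζ_j‖^{-α_j}`. -/
structure DensityCondition (σ : ℂ → ℂ) (D : Set ℂ) (X : Fin m → ℂ) (α : Fin m → ℝ)
    (f : Biharm → ℝ) : Prop where
  continuousOn : ContinuousOn f
    (Biharm.ofPlane '' frontier D \ range (fun j => sigmaTilde σ (X j)))
  bound : ∃ c : ℝ, ∀ ζ ∈ Biharm.ofPlane '' frontier D \ range (fun j => sigmaTilde σ (X j)),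
    |f ζ| ≤ c * ∏ j, ‖ζ - sigmaTilde σ (X j)‖ ^ (-α j)

end points

/-- The integrand of `∫_{∂D_ζ} φ(τ) (τ - ζ)⁻¹ dτ`, `φ = φ₁ e₁ + φ₃ e₂`, in the parametrization
`τ = σ̃(S)`, `dτ = σ̃'(S) dS`, of `∂D_ζ` by the unit circle. -/
def cauchyIntegrand (σ : ℂ → ℂ) (φ₁ φ₃ : Biharm → ℝ) (ζ : Biharm) (S : ℂ) : Biharm :=
  Biharm.mk (φ₁ (sigmaTilde σ S) : ℂ) (φ₃ (sigmaTilde σ S) : ℂ) *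
    Ring.inverse (sigmaTilde σ S - ζ) * contourDeriv (sigmaTilde σ) S

/-- The biharmonic Cauchy type integral
`Φ(ζ) = (2πi)⁻¹ ∫_{∂D_ζ} φ(τ) (τ - ζ)⁻¹ dτ`, `φ = φ₁ e₁ + φ₃ e₂`. -/
def cauchyTypeIntegral (σ : ℂ → ℂ) (φ₁ φ₃ : Biharm → ℝ) (ζ : Biharm) : Biharm :=
  (1 / (2 * (Real.pi : ℂ) * Complex.I)) • ∮ S in C(0, 1), cauchyIntegrand σ φ₁ φ₃ ζ S

/-- `Ω₁(S,Z) = f(S) (σ'(S) / d(S,Z) - 1)`, extended by `0` to `Z = S`. -/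
def Omega₁ (σ : ℂ → ℂ) (f : ℂ → ℝ) (S Z : ℂ) : ℂ :=
  if S = Z then 0 else (f S : ℂ) * (contourDeriv σ S / d σ S Z - 1)

/-- `Ω₂(S,Z) = f(S)/2 (σ'(S) d₂(S,Z) / d(S,Z)² - σ₂'(S) / d(S,Z))`, where
`d₂(S,Z) = (σ₂(S) - σ₂(Z)) / (S - Z)`, extended by `0` to `Z = S`. -/
def Omega₂ (σ : ℂ → ℂ) (f : ℂ → ℝ) (S Z : ℂ) : ℂ :=
  if S = Z then 0 else
    (f S : ℂ) / 2 * (contourDeriv σ S * d (sigma₂ σ) S Z / d σ S Z ^ 2 -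
      contourDeriv (sigma₂ σ) S / d σ S Z)

/-- `Ω_* = Ω₁[f₁] + 2i Ω₂[f₁] - 2 Ω₂[f₃]`. -/
def OmegaStar (σ : ℂ → ℂ) (f₁ f₃ : ℂ → ℝ) (S Z : ℂ) : ℂ :=
  Omega₁ σ f₁ S Z + 2 * Complex.I * Omega₂ σ f₁ S Z - 2 * Omega₂ σ f₃ S Z

/-- `Ω_** = Ω₁[f₃] - 2i Ω₂[f₃] - 2 Ω₂[f₁]`. -/
def OmegaStarStar (σ : ℂ → ℂ) (f₁ f₃ : ℂ → ℝ) (S Z : ℂ) : ℂ :=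
  Omega₁ σ f₃ S Z - 2 * Complex.I * Omega₂ σ f₃ S Z - 2 * Omega₂ σ f₁ S Z

/-- `f(S)` on the arc `|S - T| > δ` of the circle, `0` elsewhere. -/
def truncated (f : ℂ → ℂ) (T : ℂ) (δ : ℝ) (S : ℂ) : ℂ := if δ < ‖S - T‖ then f S else 0

/-- `(2πi)⁻¹ ∫_Γ Ω(S,T) / (S - T) dS` exists as a Cauchy principal value and equals `J`. -/
def HasPVCauchyIntegral (Ω : ℂ → ℂ → ℂ) (T J : ℂ) : Prop :=
  (∀ δ : ℝ, 0 < δ → CircleIntegrable (truncated (fun S => Ω S T / (S - T)) T δ) 0 1) ∧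
  Tendsto (fun δ : ℝ => 1 / (2 * (Real.pi : ℂ) * Complex.I) *
    ∮ S in C(0, 1), truncated (fun S => Ω S T / (S - T)) T δ S) (𝓝[>] 0) (𝓝 J)

/-- `C_f = (4πi)⁻¹ ∫_Γ f(S) / S dS`. -/
def constC (f : ℂ → ℝ) : ℂ :=
  1 / (4 * (Real.pi : ℂ) * Complex.I) * ∮ S in C(0, 1), (f S : ℂ) / S

end BiharmCauchy

end

/-! The element `ρ = e₂ - i e₁` satisfies `ρ² = 0`, and `x e₁ + y e₂ = z e₁ + y ρ` with `z = x + i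
y`. Hence the inverse is `1/z - (y/z²) ρ`. Written on the circle, the biharmonic Cauchy kernel
becomes `σ'/(σ(S) - σ(Z))` plus `ρ` times `L = σ₂'/(σ(S) - σ(Z)) - σ' (σ₂(S) - σ₂(Z))/(σ(S) -
σ(Z))²`. Put `K = σ'/(σ(S) - σ(Z)) - 1/(S - Z)`. Both components of `Φ` are then a classical Cauchy
integral of one real density over the unit circle plus an integral of densities against `K` and `L`
(`cauchyIntegrand_eq`). The same combinations of `K` and `L` are `Ω_*/(S - Z)` and `Ω_**/(S - Z)`.

The classical Cauchy integral has real part equal to half the Poisson integral plus half the mean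
value. This yields the terms `½ φ̃_l` and `C` (`tendsto_re_cauchy`).

It remains to pass to the limit in the integrals with `K` and `L`. Near a non-corner point `σ'` has
a Dini modulus `w` along the circle and along radii. Going from `Z` to `S` by a radius and an arc
gives `σ(S) - σ(Z) ≈ σ'(T)(S - Z)`, `T` being the radial projection of `Z`, with errors governed by
`w(|θ|)/|θ|`, which is integrable (`exists_chord_estimate`). So `K` is dominated uniformly in `Z`.
For `L` this fails by one explicit term `N`, a multiple of `(1 - |Z|)/(S (S - Z)²)`: the difference
`L - N` is dominated (`norm_kernel_sub_le`), `N` vanishes for `Z` on the circle, and its integral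
tends to zero by comparison with the Poisson kernel (`tendsto_circleIntegral_mul_sq_sub`). Thus the
`K` and `L` integrals have no jump, and at the boundary they converge absolutely, so the principal
values are ordinary integrals.

At the corners the bounds on `σ'`, `d` and the densities only have to give integrability of `φ̃_l`
and of `φ̃_l σ'` (`DensityCondition.pullback`). -/

open Set Filter Topology MeasureTheory Metric

noncomputable section

namespace BiharmCauchy

/-! ### Rotations of the unit circle and a cutoff. -/

/-- The radial projection onto the unit circle. -/
def radialProj (Z : ℂ) : ℂ := Z / (‖Z‖ : ℂ)

theorem norm_radialProj {Z : ℂ} (hZ : Z ≠ 0) : ‖radialProj Z‖ = 1 := by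
  simp [radialProj, hZ]

theorem radialProj_of_norm_eq_one {Z : ℂ} (hZ : ‖Z‖ = 1) : radialProj Z = Z := by
  simp [radialProj, hZ]

theorem continuousAt_radialProj {Z : ℂ} (hZ : Z ≠ 0) : ContinuousAt radialProj Z := by
  unfold radialProj
  refine ContinuousAt.div continuousAt_id ?_ (by simpa using hZ)
  fun_prop

theorem norm_circleMap_sub_one (θ : ℝ) : ‖circleMap 0 1 θ - 1‖ = 2 * |Real.sin (θ / 2)| := by
  have := Complex.norm_exp_I_mul_ofReal_sub_one θ
  rw [mul_comm Complex.I] at this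
  simpa [circleMap] using this

theorem norm_circleMap_sub_one_le (θ : ℝ) : ‖circleMap 0 1 θ - 1‖ ≤ |θ| := by
  rw [norm_circleMap_sub_one]
  have := Real.abs_sin_le_abs (x := θ / 2)
  rw [abs_div, abs_two] at this
  linarith

theorem le_norm_circleMap_sub_one {θ : ℝ} (hθ : |θ| ≤ Real.pi) :
    2 / Real.pi * |θ| ≤ ‖circleMap 0 1 θ - 1‖ := by
  rw [norm_circleMap_sub_one]
  have := Real.mul_abs_le_abs_sin (x := θ / 2) (by rw [abs_div, abs_two]; linarith)
  rw [abs_div, abs_two] at this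
  linarith

theorem norm_mul_circleMap_sub {T : ℂ} (hT : ‖T‖ = 1) (θ : ℝ) :
    ‖T * circleMap 0 1 θ - T‖ = ‖circleMap 0 1 θ - 1‖ := by
  rw [show T * circleMap 0 1 θ - T = T * (circleMap 0 1 θ - 1) by ring, norm_mul, hT, one_mul]

theorem norm_mul_circleMap {T : ℂ} (hT : ‖T‖ = 1) (θ : ℝ) : ‖T * circleMap 0 1 θ‖ = 1 := by
  simp [hT, circleMap]

theorem exists_circleMap_eq {T : ℂ} (hT : ‖T‖ = 1) :
    ∃ t : ℝ, ∀ θ, T * circleMap 0 1 θ = circleMap 0 1 (θ + t) := by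
  have : T ∈ range (circleMap 0 1) := by rw [range_circleMap]; simp [hT]
  obtain ⟨t, rfl⟩ := this
  refine ⟨t, fun θ => ?_⟩
  simp only [circleMap, zero_add, Complex.ofReal_one, one_mul, ← Complex.exp_add]
  push_cast; ring_nf

theorem circleIntegrable_iff_rotate {E : Type*} [NormedAddCommGroup E] {f : ℂ → E} {T : ℂ}
    (hT : ‖T‖ = 1) : CircleIntegrable f 0 1 ↔
      IntervalIntegrable (fun θ => f (T * circleMap 0 1 θ)) volume (-Real.pi) Real.pi := by
  obtain ⟨t, ht⟩ := exists_circleMap_eq hT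
  have hp : Function.Periodic (fun θ => f (circleMap 0 1 θ)) (2 * Real.pi) :=
    fun θ => by simp only [periodic_circleMap 0 1 θ]
  have hp' : Function.Periodic (fun θ => f (circleMap 0 1 (θ + t))) (2 * Real.pi) :=
    fun θ => by
      simp only
      rw [add_right_comm, periodic_circleMap 0 1 (θ + t)]
  simp only [ht]
  unfold CircleIntegrable
  have e1 := IntervalIntegrable.comp_add_right_iff (f := fun θ => f (circleMap 0 1 θ))
    (a := -Real.pi) (b := Real.pi) (c := t)
  constructor
  · intro h
    have := hp.intervalIntegrable₀ (by positivity) h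
    exact e1.2 (this _ _)
  · intro h
    have h' := e1.1 h
    exact hp.intervalIntegrable (t := -Real.pi + t) (by positivity)
      (by convert h' using 1; ring) _ _

theorem integral_circleMap_rotate {E : Type*} [NormedAddCommGroup E] [NormedSpace ℝ E]
    (f : ℂ → E) {T : ℂ} (hT : ‖T‖ = 1) :
    ∫ θ in (0 : ℝ)..2 * Real.pi, f (circleMap 0 1 θ) =
      ∫ θ in (-Real.pi)..Real.pi, f (T * circleMap 0 1 θ) := by
  obtain ⟨t, ht⟩ := exists_circleMap_eq hT
  have hp : Function.Periodic (fun θ => f (circleMap 0 1 θ)) (2 * Real.pi) :=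
    fun θ => by simp only [periodic_circleMap 0 1 θ]
  simp only [ht]
  rw [intervalIntegral.integral_comp_add_right (fun θ => f (circleMap 0 1 θ))]
  have := hp.intervalIntegral_add_eq 0 (-Real.pi + t)
  rw [zero_add] at this
  rw [this]
  congr 1; ring

/-- A continuous cutoff: `1` for `x ≤ r / 4`, `0` for `x ≥ r / 2`. -/
def cutoff (r x : ℝ) : ℝ := max 0 (min 1 (2 - 4 * x / r))

theorem cutoff_nonneg (r x : ℝ) : 0 ≤ cutoff r x := le_max_left _ _

theorem cutoff_le_one (r x : ℝ) : cutoff r x ≤ 1 := max_le zero_le_one (min_le_left _ _)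

theorem cutoff_eq_one {r x : ℝ} (hr : 0 < r) (h : x ≤ r / 4) : cutoff r x = 1 := by
  have : 4 * x / r ≤ 1 := by rw [div_le_one hr]; linarith
  rw [cutoff, min_eq_left (by linarith), max_eq_right zero_le_one]

theorem cutoff_eq_zero {r x : ℝ} (hr : 0 < r) (h : r / 2 ≤ x) : cutoff r x = 0 := by
  have : 2 ≤ 4 * x / r := by rw [le_div_iff₀ hr]; linarith
  exact max_eq_left ((min_le_right _ _).trans (by linarith))

theorem continuous_cutoff (r : ℝ) : Continuous (cutoff r) := by
  unfold cutoff; fun_prop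

theorem aestronglyMeasurable_rotate {H : ℂ → ℂ} {T : ℂ} (hT : ‖T‖ = 1)
    (h : AEStronglyMeasurable (fun θ => H (circleMap 0 1 θ)) volume) :
    AEStronglyMeasurable (fun θ => H (T * circleMap 0 1 θ)) volume := by
  obtain ⟨t, ht⟩ := exists_circleMap_eq hT
  simp only [ht]
  exact h.comp_measurePreserving (measurePreserving_add_right volume t)

theorem ae_circleMap_notMem {B : Set ℂ} (hB : B.Countable) {T : ℂ} (hT : ‖T‖ = 1) :
    ∀ᵐ θ : ℝ, T * circleMap 0 1 θ ∉ B := by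
  obtain ⟨t, ht⟩ := exists_circleMap_eq hT
  simp only [ht]
  have h1 : (circleMap 0 1 ⁻¹' B).Countable := hB.preimage_circleMap 0 one_ne_zero
  have h2 : ((fun θ : ℝ => θ + t) ⁻¹' (circleMap 0 1 ⁻¹' B)).Countable :=
    h1.preimage (add_left_injective t)
  exact h2.ae_notMem volume

theorem ae_circleMap_notMem' {B : Set ℂ} (hB : B.Countable) :
    ∀ᵐ θ : ℝ, circleMap 0 1 θ ∉ B := by
  simpa using ae_circleMap_notMem hB (T := 1) (by simp)

/-! ### Parametric circle integrals with a moving singularity. -/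

/-- Passage to the limit in a parametric integral over the unit circle, when the integrand is
dominated, after a rotation, near the singular point, and dominated away from it. -/
theorem tendsto_circleIntegral_of_near_far {H : ℂ → ℂ → ℂ} {Z₀ : ℂ} (hZ₀ : ‖Z₀‖ = 1)
    {B : Set ℂ} (hB : B.Countable)
    (hmeas : ∀ᶠ Z in 𝓝[closedBall 0 1] Z₀,
      AEStronglyMeasurable (fun θ => H (circleMap 0 1 θ) Z) volume)
    (hfar : ∀ r > 0, ∃ g : ℂ → ℝ, CircleIntegrable g 0 1 ∧ ∀ᶠ Z in 𝓝[closedBall 0 1] Z₀,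
      ∀ S ∈ sphere (0 : ℂ) 1 \ B, r ≤ ‖S - radialProj Z‖ → ‖H S Z‖ ≤ g S)
    (hnear : ∃ r > 0, ∃ g : ℝ → ℝ, IntervalIntegrable g volume (-Real.pi) Real.pi ∧
      ∀ᶠ Z in 𝓝[closedBall 0 1] Z₀, ∀ θ ∈ Icc (-Real.pi) Real.pi, θ ≠ 0 → |θ| ≤ r →
        ‖H (radialProj Z * circleMap 0 1 θ) Z‖ ≤ g θ)
    (hcont : ∀ S₀ ∈ sphere (0 : ℂ) 1 \ B, S₀ ≠ Z₀ →
      Tendsto (fun p : ℂ × ℂ => H p.1 p.2) (𝓝[sphere 0 1] S₀ ×ˢ 𝓝[closedBall 0 1] Z₀)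
        (𝓝 (H S₀ Z₀))) :
    (∀ᶠ Z in 𝓝[closedBall 0 1] Z₀, CircleIntegrable (fun S => H S Z) 0 1) ∧
      Tendsto (fun Z => ∮ S in C(0, 1), H S Z) (𝓝[closedBall 0 1] Z₀)
        (𝓝 (∮ S in C(0, 1), H S Z₀)) := by
  obtain ⟨r, hr, gn, hgn, hgn'⟩ := hnear
  obtain ⟨gf, hgf, hgf'⟩ := hfar (r / 4) (by positivity)
  have hZ₀0 : Z₀ ≠ 0 := by rintro rfl; simp at hZ₀
  set l := 𝓝[closedBall (0 : ℂ) 1] Z₀ with hl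
  have hZ₀mem : Z₀ ∈ closedBall (0 : ℂ) 1 := by simp [hZ₀]
  have hT : ∀ᶠ Z in l, ‖radialProj Z‖ = 1 := by
    have : ∀ᶠ Z in 𝓝 Z₀, Z ≠ 0 := isOpen_ne.mem_nhds hZ₀0
    exact (this.filter_mono nhdsWithin_le_nhds).mono fun Z hZ => norm_radialProj hZ
  have hTlim : Tendsto radialProj l (𝓝 Z₀) := by
    have := (continuousAt_radialProj hZ₀0).tendsto.mono_left
      (nhdsWithin_le_nhds (s := closedBall (0 : ℂ) 1))
    rwa [radialProj_of_norm_eq_one hZ₀] at this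
  -- The near piece is integrated in the angle measured from `radialProj Z`, where the singularity
  -- stays at `θ = 0` and so does the majorant. The far piece keeps the fixed angle, because its
  -- majorant may blow up at the fixed corners. No single coordinate serves both.
  set χ : ℂ → ℂ → ℝ := fun S Z => cutoff r ‖S - radialProj Z‖ with hχ
  set F : ℂ → ℂ → ℂ := fun S Z => (S * Complex.I) * H S Z with hF
  set Fn : ℂ → ℂ → ℂ := fun S Z => (χ S Z : ℂ) * F S Z with hFn
  set Ff : ℂ → ℂ → ℂ := fun S Z => ((1 - χ S Z : ℝ) : ℂ) * F S Z with hFf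
  have hFm : ∀ᶠ Z in l, AEStronglyMeasurable (fun θ => F (circleMap 0 1 θ) Z) volume := by
    filter_upwards [hmeas] with Z hZ
    exact (((continuous_circleMap 0 1).mul continuous_const).aestronglyMeasurable).mul hZ
  have hχc : ∀ Z, Continuous fun S => (χ S Z : ℂ) := fun Z => by
    simp only [hχ]
    exact Complex.continuous_ofReal.comp ((continuous_cutoff r).comp (by fun_prop))
  have hFnm : ∀ᶠ Z in l, AEStronglyMeasurable (fun θ => Fn (circleMap 0 1 θ) Z) volume := by
    filter_upwards [hFm] with Z hZ
    exact ((hχc Z).comp (continuous_circleMap 0 1)).aestronglyMeasurable.mul hZ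
  have hFfm : ∀ᶠ Z in l, AEStronglyMeasurable (fun θ => Ff (circleMap 0 1 θ) Z) volume := by
    filter_upwards [hFm] with Z hZ
    refine AEStronglyMeasurable.mul ?_ hZ
    have : Continuous fun S => ((1 - χ S Z : ℝ) : ℂ) := by
      push_cast; exact continuous_const.sub (hχc Z)
    exact (this.comp (continuous_circleMap 0 1)).aestronglyMeasurable
  have hFnorm : ∀ S Z, ‖S‖ = 1 → ‖F S Z‖ = ‖H S Z‖ := fun S Z hS => by simp [hF, hS]
  have hFnb : ∀ᶠ Z in l, ∀ᵐ θ : ℝ, θ ∈ uIoc (-Real.pi) Real.pi →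
      ‖Fn (radialProj Z * circleMap 0 1 θ) Z‖ ≤ |gn θ| := by
    filter_upwards [hgn', hT] with Z hZ hTZ
    have : ∀ᵐ θ : ℝ, θ ≠ 0 := (countable_singleton (0 : ℝ)).ae_notMem volume
    filter_upwards [this] with θ hθ0 hθ
    rw [uIoc_of_le (by linarith [Real.pi_pos])] at hθ
    have hθ' : |θ| ≤ Real.pi := abs_le.2 ⟨hθ.1.le, hθ.2⟩
    simp only [hFn, norm_mul, hFnorm _ _ (norm_mul_circleMap hTZ θ), Complex.norm_real,
      Real.norm_eq_abs, abs_of_nonneg (cutoff_nonneg _ _), hχ]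
    by_cases hs : r / 2 ≤ ‖radialProj Z * circleMap 0 1 θ - radialProj Z‖
    · rw [cutoff_eq_zero hr hs]; simp
    -- On the support of the cutoff the chord is below `r / 2`, and `2 / π ≥ 1 / 2` turns this into
    -- `|θ| ≤ r`.
    · have h1 : |θ| ≤ r := by
        rw [norm_mul_circleMap_sub hTZ] at hs
        have h2 := le_norm_circleMap_sub_one hθ'
        have h3 : 2 / Real.pi * |θ| ≤ r / 2 := by linarith
        have h4 : (1 : ℝ) / 2 ≤ 2 / Real.pi := by
          rw [div_le_div_iff₀ (by norm_num) Real.pi_pos]; linarith [Real.pi_le_four]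
        nlinarith [abs_nonneg θ]
      calc _ ≤ 1 * ‖H (radialProj Z * circleMap 0 1 θ) Z‖ :=
            mul_le_mul_of_nonneg_right (cutoff_le_one _ _) (norm_nonneg _)
        _ ≤ gn θ := by rw [one_mul]; exact hZ θ ⟨hθ.1.le, hθ.2⟩ hθ0 h1
        _ ≤ |gn θ| := le_abs_self _
  have hFfb : ∀ᶠ Z in l, ∀ᵐ θ : ℝ, θ ∈ uIoc (0 : ℝ) (2 * Real.pi) →
      ‖Ff (circleMap 0 1 θ) Z‖ ≤ |gf (circleMap 0 1 θ)| := by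
    filter_upwards [hgf'] with Z hZ
    filter_upwards [ae_circleMap_notMem' hB] with θ hθB _
    have hn : ‖circleMap 0 1 θ‖ = 1 := by simp
    have h1χ : 0 ≤ 1 - χ (circleMap 0 1 θ) Z := by
      have := cutoff_le_one r ‖circleMap 0 1 θ - radialProj Z‖
      simp only [hχ]; linarith
    simp only [hFf, norm_mul, hFnorm _ _ hn, Complex.norm_real, Real.norm_eq_abs,
      abs_of_nonneg h1χ]
    by_cases hs : r / 4 ≤ ‖circleMap 0 1 θ - radialProj Z‖
    · calc _ ≤ 1 * ‖H (circleMap 0 1 θ) Z‖ := by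
            refine mul_le_mul_of_nonneg_right ?_ (norm_nonneg _)
            have := cutoff_nonneg r ‖circleMap 0 1 θ - radialProj Z‖
            simp only [hχ]; linarith
        _ ≤ gf (circleMap 0 1 θ) := by
            rw [one_mul]; exact hZ _ ⟨by simp, hθB⟩ hs
        _ ≤ _ := le_abs_self _
    · have : χ (circleMap 0 1 θ) Z = 1 := cutoff_eq_one hr (le_of_not_ge hs)
      rw [this]; simp
  have hgf1 : IntervalIntegrable (fun θ => |gf (circleMap 0 1 θ)|) volume 0 (2 * Real.pi) :=
    hgf.abs
  have hgn1 : IntervalIntegrable (fun θ => |gn θ|) volume (-Real.pi) Real.pi := hgn.abs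
  have hFni : ∀ᶠ Z in l, CircleIntegrable (fun S => Fn S Z) 0 1 := by
    filter_upwards [hFnb, hFnm, hT] with Z hb hm hTZ
    rw [circleIntegrable_iff_rotate hTZ]
    refine hgn1.mono_fun (aestronglyMeasurable_rotate hTZ (H := fun S => Fn S Z) hm).restrict ?_
    rw [EventuallyLE, ae_restrict_iff' measurableSet_uIoc]
    filter_upwards [hb] with θ hθ hθ'
    simpa using hθ hθ'
  have hFfi : ∀ᶠ Z in l, CircleIntegrable (fun S => Ff S Z) 0 1 := by
    filter_upwards [hFfb, hFfm] with Z hb hm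
    refine hgf1.mono_fun hm.restrict ?_
    rw [EventuallyLE, ae_restrict_iff' measurableSet_uIoc]
    filter_upwards [hb] with θ hθ hθ'
    simpa using hθ hθ'
  have hsum : ∀ S Z, F S Z = Fn S Z + Ff S Z := fun S Z => by
    simp only [hFn, hFf]; push_cast; ring
  have hint : ∀ᶠ Z in l, CircleIntegrable (fun S => H S Z) 0 1 := by
    filter_upwards [hFni, hFfi] with Z h1 h2
    have h3 : CircleIntegrable (fun S => F S Z) 0 1 := by
      simp only [hsum]; exact h1.add h2
    rw [circleIntegrable_iff]
    refine IntervalIntegrable.congr ?_ h3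
    intro θ _
    simp [hF, circleMap]
  refine ⟨hint, ?_⟩
  have hsplit : ∀ᶠ Z in l, (∮ S in C(0, 1), H S Z) =
      (∫ θ in (-Real.pi)..Real.pi, Fn (radialProj Z * circleMap 0 1 θ) Z) +
        ∫ θ in (0 : ℝ)..2 * Real.pi, Ff (circleMap 0 1 θ) Z := by
    filter_upwards [hFni, hFfi, hT] with Z h1 h2 hTZ
    rw [← integral_circleMap_rotate (fun S => Fn S Z) hTZ,
      ← intervalIntegral.integral_add h1 h2]
    simp only [circleIntegral, deriv_circleMap, smul_eq_mul, ← hsum, hF]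
  -- The limit filter lives on the closed disc, so every eventual identity also holds at `Z₀`
  -- itself.
  have hsplit₀ := hsplit.self_of_nhdsWithin hZ₀mem
  rw [hsplit₀, radialProj_of_norm_eq_one hZ₀]
  refine Tendsto.congr' (hsplit.mono fun Z h => h.symm) ?_
  have hFc : ∀ S₀ ∈ sphere (0 : ℂ) 1 \ B, S₀ ≠ Z₀ →
      Tendsto (fun p : ℂ × ℂ => F p.1 p.2) (𝓝[sphere 0 1] S₀ ×ˢ l) (𝓝 (F S₀ Z₀)) := by
    intro S₀ hS₀ hne
    have h1 : Tendsto (fun p : ℂ × ℂ => p.1 * Complex.I) (𝓝[sphere 0 1] S₀ ×ˢ l)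
        (𝓝 (S₀ * Complex.I)) :=
      ((tendsto_id'.2 nhdsWithin_le_nhds).comp tendsto_fst).mul_const _
    exact h1.mul (hcont S₀ hS₀ hne)
  have hχcc : ∀ S₀, Tendsto (fun p : ℂ × ℂ => χ p.1 p.2) (𝓝[sphere 0 1] S₀ ×ˢ l)
      (𝓝 (χ S₀ Z₀)) := by
    intro S₀
    have h1 : Tendsto (fun p : ℂ × ℂ => p.1) (𝓝[sphere 0 1] S₀ ×ˢ l) (𝓝 S₀) :=
      (tendsto_id'.2 nhdsWithin_le_nhds).comp tendsto_fst
    have h2 : Tendsto (fun p : ℂ × ℂ => radialProj p.2) (𝓝[sphere 0 1] S₀ ×ˢ l)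
        (𝓝 (radialProj Z₀)) := by
      rw [radialProj_of_norm_eq_one hZ₀]; exact hTlim.comp tendsto_snd
    exact ((continuous_cutoff r).tendsto _).comp (h1.sub h2).norm
  have hFnc : ∀ S₀ ∈ sphere (0 : ℂ) 1 \ B, S₀ ≠ Z₀ →
      Tendsto (fun p : ℂ × ℂ => Fn p.1 p.2) (𝓝[sphere 0 1] S₀ ×ˢ l) (𝓝 (Fn S₀ Z₀)) :=
    fun S₀ hS₀ hne => ((Complex.continuous_ofReal.tendsto _).comp (hχcc S₀)).mul (hFc S₀ hS₀ hne)
  have hFfc : ∀ S₀ ∈ sphere (0 : ℂ) 1 \ B, S₀ ≠ Z₀ →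
      Tendsto (fun p : ℂ × ℂ => Ff p.1 p.2) (𝓝[sphere 0 1] S₀ ×ˢ l) (𝓝 (Ff S₀ Z₀)) :=
    fun S₀ hS₀ hne =>
      ((Complex.continuous_ofReal.tendsto _).comp (tendsto_const_nhds.sub (hχcc S₀))).mul
        (hFc S₀ hS₀ hne)
  have hB' : (B ∪ {Z₀}).Countable := hB.union (countable_singleton _)
  clear_value Fn Ff
  refine Tendsto.add ?_ ?_
  · refine intervalIntegral.tendsto_integral_filter_of_dominated_convergence (fun θ => |gn θ|)
      ?_ hFnb hgn1 ?_
    · filter_upwards [hFnm, hT] with Z hm hTZ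
      exact (aestronglyMeasurable_rotate hTZ (H := fun S => Fn S Z) hm).restrict
    · filter_upwards [ae_circleMap_notMem hB' hZ₀] with θ hθ _
      simp only [mem_union, mem_singleton_iff, not_or] at hθ
      have h1 := hFnc (Z₀ * circleMap 0 1 θ) ⟨by simp [hZ₀], hθ.1⟩ hθ.2
      have h2 : Tendsto (fun Z => radialProj Z * circleMap 0 1 θ) l
          (𝓝[sphere 0 1] (Z₀ * circleMap 0 1 θ)) := by
        refine tendsto_nhdsWithin_iff.2 ⟨hTlim.mul_const _, ?_⟩
        filter_upwards [hT] with Z hTZ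
        simp [hTZ]
      exact h1.comp (h2.prodMk tendsto_id)
  · refine intervalIntegral.tendsto_integral_filter_of_dominated_convergence
      (fun θ => |gf (circleMap 0 1 θ)|) ?_ hFfb hgf1 ?_
    · exact hFfm.mono fun Z h => h.restrict
    · filter_upwards [ae_circleMap_notMem' hB'] with θ hθ _
      simp only [mem_union, mem_singleton_iff, not_or] at hθ
      have h1 := hFfc (circleMap 0 1 θ) ⟨by simp, hθ.1⟩ hθ.2
      have h2 : Tendsto (fun _ : ℂ => circleMap 0 1 θ) l (𝓝[sphere 0 1] (circleMap 0 1 θ)) :=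
        tendsto_nhdsWithin_iff.2 ⟨tendsto_const_nhds, Eventually.of_forall fun _ => by simp⟩
      exact h1.comp (h2.prodMk tendsto_id)

/-! ### Poisson integrals and boundary values on the disc. -/

theorem poissonKernel_zero_nonneg {S Z : ℂ} (hS : ‖S‖ = 1) (hZ : ‖Z‖ < 1) :
    0 ≤ poissonKernel 0 Z S := by
  rw [poissonKernel_def]
  simp only [sub_zero, hS]
  have := norm_nonneg Z
  apply div_nonneg _ (sq_nonneg _)
  nlinarith

theorem continuousOn_poissonKernel {Z : ℂ} (hZ : ‖Z‖ < 1) :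
    ContinuousOn (poissonKernel 0 Z) (sphere 0 1) := by
  rw [poissonKernel_eq_re_herglotzRieszKernel]
  have := continuousOn_herglotzRieszKernel_sphere (c := 0) (R := 1) (w := Z) (by simpa using hZ)
  rw [abs_one] at this
  exact Complex.continuous_re.comp_continuousOn this

theorem circleAverage_poissonKernel {Z : ℂ} (hZ : ‖Z‖ < 1) :
    Real.circleAverage (poissonKernel 0 Z) 0 1 = 1 := by
  have h := DiffContOnCl.circleAverage_poissonKernel_smul (f := fun _ : ℂ => (1 : ℂ)) (c := 0)
    (R := 1) (w := Z) diffContOnCl_const (by simpa using hZ)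
  have h2 : CircleIntegrable (poissonKernel 0 Z) 0 1 :=
    (continuousOn_poissonKernel hZ).circleIntegrable zero_le_one
  have h3 := Complex.ofRealCLM.circleAverage_comp_comm h2
  have h4 : (poissonKernel 0 Z • fun _ : ℂ => (1 : ℂ)) = Complex.ofRealCLM ∘ poissonKernel 0 Z := by
    ext S; simp
  rw [h4, h3] at h
  simpa using h

theorem circleAverage_rotate {E : Type*} [NormedAddCommGroup E] [NormedSpace ℝ E]
    (f : ℂ → E) {T : ℂ} (hT : ‖T‖ = 1) : Real.circleAverage f 0 1 =
      (2 * Real.pi)⁻¹ • ∫ θ in Ioc (-Real.pi) Real.pi, f (T * circleMap 0 1 θ) := by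
  rw [Real.circleAverage_def, integral_circleMap_rotate f hT,
    intervalIntegral.integral_of_le (by linarith [Real.pi_pos])]

/-- The Poisson integral of an integrable function converges to the function at each point of
continuity. -/
theorem tendsto_circleAverage_poissonKernel_smul {E : Type*} [NormedAddCommGroup E]
    [NormedSpace ℝ E] [CompleteSpace E] {g : ℂ → E} (hg : CircleIntegrable g 0 1) {Z₀ : ℂ}
    (hZ₀ : ‖Z₀‖ = 1) (hc : ContinuousWithinAt g (sphere 0 1) Z₀) :
    Tendsto (fun Z => Real.circleAverage (poissonKernel 0 Z • g) 0 1) (𝓝[ball 0 1] Z₀)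
      (𝓝 (g Z₀)) := by
  have hpi := Real.pi_pos
  set l := 𝓝[ball (0 : ℂ) 1] Z₀
  have hmem : ∀ᶠ Z in l, ‖Z‖ < 1 :=
    (eventually_mem_nhdsWithin).mono fun Z hZ => by simpa using hZ
  have key : Tendsto (fun Z => ∫ θ in Ioc (-Real.pi) Real.pi,
      ((2 * Real.pi)⁻¹ * poissonKernel 0 Z (Z₀ * circleMap 0 1 θ)) • g (Z₀ * circleMap 0 1 θ)) l
      (𝓝 (g Z₀)) := by
    refine tendsto_setIntegral_peak_smul_of_integrableOn_of_tendsto (x₀ := (0 : ℝ))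
      measurableSet_Ioc measurableSet_Ioc subset_rfl self_mem_nhdsWithin (by simp) ?_ ?_ ?_ ?_ ?_ ?_
    · filter_upwards [hmem] with Z hZ θ _
      exact mul_nonneg (by positivity)
        (poissonKernel_zero_nonneg (norm_mul_circleMap hZ₀ θ) hZ)
    · intro u hu h0
      obtain ⟨δ, hδ, hδu⟩ := Metric.isOpen_iff.1 hu 0 h0
      -- A lower bound for chords of angle at least `δ`; half of it survives when `Z₀` is replaced
      -- by a nearby `Z`.
      set c := 2 / Real.pi * δ with hc
      have hc0 : 0 < c := by positivity
      rw [Metric.tendstoUniformlyOn_iff]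
      intro ε hε
      have h1 : Tendsto (fun Z : ℂ => (2 * Real.pi)⁻¹ * ((1 - ‖Z‖ ^ 2) / (c / 2) ^ 2)) l (𝓝 0) := by
        have : Continuous fun Z : ℂ => (2 * Real.pi)⁻¹ * ((1 - ‖Z‖ ^ 2) / (c / 2) ^ 2) := by
          fun_prop
        have h := (this.tendsto Z₀).mono_left (nhdsWithin_le_nhds (s := ball (0 : ℂ) 1))
        simpa [hZ₀] using h
      have h2 : ∀ᶠ Z in l, ‖Z - Z₀‖ < c / 2 := by
        have : ∀ᶠ Z in 𝓝 Z₀, ‖Z - Z₀‖ < c / 2 := by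
          filter_upwards [Metric.ball_mem_nhds Z₀ (half_pos hc0)] with Z hZ
          simpa [dist_eq_norm] using hZ
        exact this.filter_mono nhdsWithin_le_nhds
      filter_upwards [h1.eventually_lt_const hε, h2, hmem] with Z hZ1 hZ2 hZ3 θ hθ
      have hn := norm_mul_circleMap hZ₀ θ
      have hθδ : δ ≤ |θ| := by
        by_contra hlt
        exact hθ.2 (hδu (by simpa using hlt))
      have h3 := le_norm_circleMap_sub_one (abs_le.2 ⟨hθ.1.1.le, hθ.1.2⟩)
      rw [← norm_mul_circleMap_sub hZ₀] at h3
      have h4 : c ≤ 2 / Real.pi * |θ| := mul_le_mul_of_nonneg_left hθδ (by positivity)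
      have h5 : c / 2 ≤ ‖Z₀ * circleMap 0 1 θ - Z‖ := by
        have := norm_sub_le_norm_sub_add_norm_sub (Z₀ * circleMap 0 1 θ) Z Z₀
        linarith
      have h6 := poissonKernel_zero_nonneg hn hZ3
      simp only [Pi.zero_apply, dist_zero_left, Real.norm_eq_abs]
      rw [abs_of_nonneg (by positivity)]
      refine lt_of_le_of_lt ?_ hZ1
      rw [poissonKernel_def]
      simp only [sub_zero, hn, one_pow]
      have h7 : 0 ≤ 1 - ‖Z‖ ^ 2 := by nlinarith [norm_nonneg Z]
      gcongr
    · refine tendsto_const_nhds.congr' ?_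
      filter_upwards [hmem] with Z hZ
      have := circleAverage_poissonKernel hZ
      rw [circleAverage_rotate _ hZ₀, smul_eq_mul] at this
      rw [integral_const_mul, this]
    · filter_upwards [hmem] with Z hZ
      have h2 : CircleIntegrable (poissonKernel 0 Z) 0 1 :=
        (continuousOn_poissonKernel hZ).circleIntegrable zero_le_one
      rw [circleIntegrable_iff_rotate hZ₀,
        intervalIntegrable_iff_integrableOn_Ioc_of_le (by linarith)] at h2
      exact h2.aestronglyMeasurable.const_mul _
    · rwa [circleIntegrable_iff_rotate hZ₀,
        intervalIntegrable_iff_integrableOn_Ioc_of_le (by linarith)] at hg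
    · have h1 : Tendsto (fun θ : ℝ => Z₀ * circleMap 0 1 θ) (𝓝[Ioc (-Real.pi) Real.pi] 0)
          (𝓝[sphere 0 1] Z₀) := by
        refine tendsto_nhdsWithin_iff.2 ⟨?_, Eventually.of_forall fun θ => by simp [hZ₀]⟩
        have : Continuous fun θ : ℝ => Z₀ * circleMap 0 1 θ := by fun_prop
        have h := (this.tendsto 0).mono_left (nhdsWithin_le_nhds (s := Ioc (-Real.pi) Real.pi))
        simpa [circleMap] using h
      exact hc.tendsto.comp h1
  refine key.congr fun Z => ?_
  rw [circleAverage_rotate _ hZ₀, ← integral_smul]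
  simp only [mul_smul, Pi.smul_apply']

theorem circleIntegrable_ofReal {g : ℂ → ℝ} {c : ℂ} {R : ℝ} (hg : CircleIntegrable g c R) :
    CircleIntegrable (fun S => (g S : ℂ)) c R := by
  simp only [CircleIntegrable, intervalIntegrable_iff] at hg ⊢
  exact Complex.ofRealCLM.integrable_comp hg

theorem one_div_two_pi_I_mul_circleIntegral (f : ℂ → ℂ) :
    1 / (2 * (Real.pi : ℂ) * Complex.I) * ∮ S in C(0, 1), f S =
      Real.circleAverage (fun S => S * f S) 0 1 := by
  rw [Real.circleAverage_eq_circleIntegral one_ne_zero, smul_eq_mul, one_div]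
  congr 1
  refine circleIntegral.integral_congr zero_le_one fun S hS => ?_
  have : S ≠ 0 := by rintro rfl; simp at hS
  simp [this]

theorem constC_eq_circleAverage {ψ : ℂ → ℝ} (hψ : CircleIntegrable ψ 0 1) :
    constC ψ = ((1 / 2 * Real.circleAverage ψ 0 1 : ℝ) : ℂ) := by
  have h1 := one_div_two_pi_I_mul_circleIntegral (fun S => (ψ S : ℂ) / S)
  have h2 : Real.circleAverage (fun S => S * ((ψ S : ℂ) / S)) 0 1 =
      Real.circleAverage (Complex.ofRealCLM ∘ ψ) 0 1 := by
    refine Real.circleAverage_congr_sphere fun S hS => ?_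
    have : S ≠ 0 := by rintro rfl; simp at hS
    simp; field_simp
  rw [h2, Complex.ofRealCLM.circleAverage_comp_comm hψ] at h1
  rw [constC]
  push_cast
  rw [Complex.ofRealCLM_apply] at h1
  rw [← h1]
  ring

/-- Boundary values of the real part of a Cauchy type integral with a real density over the unit
circle. -/
theorem tendsto_re_cauchy {ψ : ℂ → ℝ} (hψ : CircleIntegrable ψ 0 1) {Z₀ : ℂ}
    (hZ₀ : ‖Z₀‖ = 1) (hc : ContinuousWithinAt ψ (sphere 0 1) Z₀) :
    Tendsto (fun Z => (1 / (2 * (Real.pi : ℂ) * Complex.I) *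
        ∮ S in C(0, 1), (ψ S : ℂ) * (1 / (S - Z))).re) (𝓝[ball 0 1] Z₀)
      (𝓝 (1 / 2 * ψ Z₀ + (constC ψ).re)) := by
  have h1 := ((tendsto_circleAverage_poissonKernel_smul hψ hZ₀ hc).const_mul (1 / 2)).add_const
    (constC ψ).re
  refine h1.congr' ?_
  filter_upwards [self_mem_nhdsWithin] with Z hZ
  have hZ' : ‖Z‖ < 1 := by simpa using hZ
  rw [one_div_two_pi_I_mul_circleIntegral, constC_eq_circleAverage hψ, Complex.ofReal_re]
  have hh : CircleIntegrable (fun ζ ↦ herglotzRieszKernel 0 Z ζ • (ψ ζ : ℂ)) 0 1 :=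
    (circleIntegrable_ofReal hψ).continuousOn_smul (continuousOn_herglotzRieszKernel_sphere hZ)
  -- `S/(S - Z) = ½ (S + Z)/(S - Z) + ½`: the first half has the Poisson kernel as real part, the
  -- second gives `constC`.
  have h3 : Real.circleAverage (fun S => S * ((ψ S : ℂ) * (1 / (S - Z)))) 0 1 =
      Real.circleAverage (fun S => (1 / 2 : ℂ) • (herglotzRieszKernel 0 Z S • (ψ S : ℂ)) +
        (1 / 2 : ℂ) • (ψ S : ℂ)) 0 1 := by
    refine Real.circleAverage_congr_sphere fun S hS => ?_
    have : S - Z ≠ 0 := by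
      rw [sub_ne_zero]; rintro rfl; simp at hS; linarith
    simp only [herglotzRieszKernel_def, sub_zero, smul_eq_mul]
    field_simp; ring
  rw [h3, Real.circleAverage_fun_add (f₁ := fun S => (1 / 2 : ℂ) • (herglotzRieszKernel 0 Z S • (ψ S : ℂ)))
      (f₂ := fun S => (1 / 2 : ℂ) • (ψ S : ℂ)) hh.const_smul (circleIntegrable_ofReal hψ).const_smul,
    Real.circleAverage_fun_smul, Real.circleAverage_fun_smul]
  have h4 := re_circleAverage_herglotzRieszKernel_smul hψ hZ
  rw [← poissonKernel_eq_re_herglotzRieszKernel] at h4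
  have h5 := Complex.ofRealCLM.circleAverage_comp_comm hψ
  simp only [Function.comp_def, Complex.ofRealCLM_apply] at h5
  rw [h5, ← h4]
  simp [Complex.add_re, Complex.mul_re]

/-- The kernel has integral zero, so `g Z₀` may be subtracted from `g`. Since `1 - |Z| ≤ 1 - |Z|²`,
its modulus is at most the Poisson kernel, and the Poisson integral of `|g - g Z₀|` tends to zero.
Continuity of `g` at `Z₀` is enough; no Dini condition on the density is needed. -/
theorem tendsto_circleIntegral_mul_sq_sub {g : ℂ → ℂ} (hg : CircleIntegrable g 0 1) {Z₀ : ℂ}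
    (hZ₀ : ‖Z₀‖ = 1) (hc : ContinuousWithinAt g (sphere 0 1) Z₀) :
    Tendsto (fun Z => ∮ S in C(0, 1), g S * (((1 - ‖Z‖ : ℝ) : ℂ) / (S - Z) ^ 2)) (𝓝[ball 0 1] Z₀)
      (𝓝 0) := by
  have hgi : CircleIntegrable (fun S => g S - g Z₀) 0 1 := hg.sub (circleIntegrable_const _ _ _)
  have hgn : CircleIntegrable (fun S => ‖g S - g Z₀‖) 0 1 := IntervalIntegrable.norm hgi
  have h1 := (tendsto_circleAverage_poissonKernel_smul hgn hZ₀
    ((hc.sub continuousWithinAt_const).norm)).const_mul (2 * Real.pi)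
  simp only [sub_self, norm_zero, mul_zero] at h1
  refine squeeze_zero_norm' ?_ h1
  filter_upwards [self_mem_nhdsWithin] with Z hZ
  have hZ' : ‖Z‖ < 1 := by simpa using hZ
  have hne : ∀ S ∈ sphere (0 : ℂ) 1, S - Z ≠ 0 := fun S hS => by
    rw [sub_ne_zero]; rintro rfl; simp at hS; linarith
  have hk : ContinuousOn (fun S : ℂ => ((1 - ‖Z‖ : ℝ) : ℂ) / (S - Z) ^ 2) (sphere 0 1) :=
    continuousOn_const.div (by fun_prop) fun S hS => pow_ne_zero _ (hne S hS)
  have hk' : ContinuousOn (fun S : ℂ => ((1 - ‖Z‖ : ℝ) : ℂ) / (S - Z) ^ 2) (sphere 0 |1|) := by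
    rwa [abs_one]
  have e0 : (∮ S in C(0, 1), g Z₀ * (((1 - ‖Z‖ : ℝ) : ℂ) / (S - Z) ^ 2)) = 0 := by
    rw [circleIntegral.integral_const_mul]
    have : ∀ S : ℂ, ((1 - ‖Z‖ : ℝ) : ℂ) / (S - Z) ^ 2 = ((1 - ‖Z‖ : ℝ) : ℂ) * (S - Z) ^ (-2 : ℤ) :=
      fun S => by rw [zpow_neg]; rfl
    simp only [this]
    rw [circleIntegral.integral_const_mul, circleIntegral.integral_sub_zpow_of_ne (by norm_num)]
    simp
  have e1 : (∮ S in C(0, 1), g S * (((1 - ‖Z‖ : ℝ) : ℂ) / (S - Z) ^ 2)) =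
      ∮ S in C(0, 1), (g S - g Z₀) * (((1 - ‖Z‖ : ℝ) : ℂ) / (S - Z) ^ 2) := by
    have := circleIntegral.integral_sub (hg.mul_continuousOn hk')
      ((circleIntegrable_const (g Z₀) _ _).mul_continuousOn hk')
    simp only [Pi.mul_apply] at this
    rw [e0, sub_zero] at this
    rw [← this]
    simp only [sub_mul]
  rw [e1, circleIntegral, Real.circleAverage_def, smul_eq_mul, mul_inv_cancel_left₀ (by positivity)]
  refine intervalIntegral.norm_integral_le_of_norm_le (by positivity) ?_ ?_
  · refine Eventually.of_forall fun θ _ => ?_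
    have hn : ‖circleMap 0 1 θ‖ = 1 := by simp
    simp only [deriv_circleMap, smul_eq_mul, norm_mul, hn, norm_div, norm_pow, Complex.norm_real,
      Complex.norm_I, Pi.smul_apply', poissonKernel_def, sub_zero, one_pow, one_mul, mul_one]
    rw [mul_comm]
    refine mul_le_mul_of_nonneg_right ?_ (norm_nonneg _)
    refine div_le_div_of_nonneg_right ?_ (sq_nonneg _)
    rw [Real.norm_eq_abs, abs_of_nonneg (by linarith)]
    nlinarith [norm_nonneg Z]
  · have hp : ContinuousOn (poissonKernel 0 Z) (sphere 0 |1|) := by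
      rw [abs_one]; exact continuousOn_poissonKernel hZ'
    exact hgn.continuousOn_smul hp

/-! ### Integrability of power weights on the circle. -/

theorem intervalIntegrable_comp_abs {g : ℝ → ℝ} {a : ℝ} (ha : 0 ≤ a)
    (h : IntegrableOn g (Ioc 0 a)) : IntervalIntegrable (fun θ => g |θ|) volume (-a) a := by
  have h1 : IntervalIntegrable (fun θ => g |θ|) volume 0 a := by
    rw [intervalIntegrable_iff_integrableOn_Ioc_of_le ha]
    refine h.congr_fun (fun θ hθ => ?_) measurableSet_Ioc
    simp only [abs_of_pos hθ.1]
  have h2 : IntervalIntegrable (fun θ => g |θ|) volume (-a) 0 := by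
    rw [IntervalIntegrable.iff_comp_neg]
    simpa using h1.symm
  exact h2.trans h1

theorem aestronglyMeasurable_comp_circleMap {E : Type*} [NormedAddCommGroup E] {f : ℂ → E}
    {B : Set ℂ} (hB : B.Finite) (hf : ContinuousOn f (sphere 0 1 \ B)) :
    AEStronglyMeasurable (fun θ => f (circleMap 0 1 θ)) volume := by
  set U : Set ℝ := circleMap 0 1 ⁻¹' Bᶜ
  have hU : IsOpen U := hB.isClosed.isOpen_compl.preimage (continuous_circleMap 0 1)
  have h1 : ContinuousOn (fun θ => f (circleMap 0 1 θ)) U :=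
    hf.comp (continuous_circleMap 0 1).continuousOn fun θ hθ => ⟨by simp, hθ⟩
  have h2 := h1.aestronglyMeasurable hU.measurableSet (μ := volume)
  rwa [Measure.restrict_eq_self_of_ae_mem] at h2
  exact ae_circleMap_notMem' hB.countable

theorem circleIntegrable_of_continuousOn_of_le {E : Type*} [NormedAddCommGroup E] {f : ℂ → E}
    {B : Set ℂ} (hB : B.Finite) (hf : ContinuousOn f (sphere 0 1 \ B)) {g : ℂ → ℝ}
    (hg : CircleIntegrable g 0 1) (hfg : ∀ S ∈ sphere (0 : ℂ) 1 \ B, ‖f S‖ ≤ g S) :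
    CircleIntegrable f 0 1 := by
  refine IntervalIntegrable.mono_fun hg (aestronglyMeasurable_comp_circleMap hB hf).restrict ?_
  refine (ae_restrict_of_ae ?_)
  filter_upwards [ae_circleMap_notMem' hB.countable] with θ hθ
  exact (hfg _ ⟨by simp, hθ⟩).trans (le_abs_self _)

/-- After rotating `X` to angle zero the chord is comparable to `|θ|`. The majorant is a sum so that
one term serves negative exponents and the other nonnegative ones. -/
theorem circleIntegrable_norm_sub_rpow {X : ℂ} (hX : ‖X‖ = 1) {γ : ℝ} (hγ : -1 < γ) :
    CircleIntegrable (fun S => ‖S - X‖ ^ γ) 0 1 := by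
  have hpi := Real.pi_pos
  rw [circleIntegrable_iff_rotate hX]
  have h1 : IntervalIntegrable (fun θ : ℝ => (2 / Real.pi) ^ γ * |θ| ^ γ + 4 ^ γ) volume
      (-Real.pi) Real.pi := by
    refine ((intervalIntegrable_comp_abs (g := fun x => x ^ γ) hpi.le ?_).const_mul _).add
      intervalIntegrable_const
    have := intervalIntegral.intervalIntegrable_rpow' (a := 0) (b := Real.pi) hγ
    rwa [intervalIntegrable_iff_integrableOn_Ioc_of_le hpi.le] at this
  refine h1.mono_fun ?_ ?_
  · refine AEStronglyMeasurable.restrict ?_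
    refine Measurable.aestronglyMeasurable ?_
    have : Continuous fun θ : ℝ => ‖X * circleMap 0 1 θ - X‖ := by fun_prop
    exact this.measurable.pow_const _
  · rw [EventuallyLE, ae_restrict_iff' measurableSet_uIoc]
    have : ∀ᵐ θ : ℝ, θ ≠ 0 := (countable_singleton (0 : ℝ)).ae_notMem volume
    filter_upwards [this] with θ hθ0 hθ
    rw [uIoc_of_le (by linarith)] at hθ
    rw [Real.norm_eq_abs, Real.norm_eq_abs, abs_of_nonneg (by positivity),
      abs_of_nonneg (by positivity), norm_mul_circleMap_sub hX]
    have h2 := le_norm_circleMap_sub_one (abs_le.2 ⟨hθ.1.le, hθ.2⟩)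
    have h3 : 0 < |θ| := abs_pos.2 hθ0
    rcases le_or_gt 0 γ with h | h
    · have h4 : ‖circleMap 0 1 θ - 1‖ ≤ 4 := by
        refine (norm_sub_le _ _).trans ?_
        simp; norm_num
      have := Real.rpow_le_rpow (norm_nonneg _) h4 h
      have : 0 ≤ (2 / Real.pi) ^ γ * |θ| ^ γ := by positivity
      linarith
    · rw [← Real.mul_rpow (by positivity) (by positivity)]
      have := Real.rpow_le_rpow_of_nonpos (by positivity) h2 h.le
      have : (0 : ℝ) ≤ 4 ^ γ := by positivity
      linarith

theorem circleIntegrable_const_mul {g : ℂ → ℝ} {c : ℂ} {R : ℝ} (hg : CircleIntegrable g c R)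
    (K : ℝ) : CircleIntegrable (fun S => K * g S) c R :=
  IntervalIntegrable.const_mul hg K

section products

variable {m : ℕ}

theorem exists_separation {X : Fin m → ℂ} (hX : Function.Injective X) :
    ∃ s > 0, ∀ j k, j ≠ k → s ≤ ‖X j - X k‖ := by
  have : ∀ᶠ s : ℝ in 𝓝[>] 0, ∀ j k, j ≠ k → s ≤ ‖X j - X k‖ := by
    rw [eventually_all]; intro j
    rw [eventually_all]; intro k
    by_cases h : j = k
    · simp [h]
    · have : 0 < ‖X j - X k‖ := by rw [norm_pos_iff, sub_ne_zero]; exact hX.ne h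
      filter_upwards [Ioo_mem_nhdsGT this] with s hs _ using hs.2.le
  obtain ⟨s, h1, h2⟩ := (this.and self_mem_nhdsWithin).exists
  exact ⟨s, h2, h1⟩

theorem rpow_le_of_mem_Icc {s x γ : ℝ} (hs : 0 < s) (hx : s ≤ x) (hx2 : x ≤ 2) :
    x ^ γ ≤ s ^ γ + 2 ^ γ := by
  rcases le_or_gt 0 γ with h | h
  · have := Real.rpow_le_rpow (hs.le.trans hx) hx2 h
    have : 0 ≤ s ^ γ := by positivity
    linarith
  · have := Real.rpow_le_rpow_of_nonpos hs hx h.le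
    have : (0 : ℝ) ≤ 2 ^ γ := by positivity
    linarith

/-- Only the factor of the nearest `X j` can degenerate: every other point is at distance at least
half the separation. This reduces product weights to single power weights. -/
theorem exists_prod_le_sum (hm : 0 < m) {X : Fin m → ℂ} (hX : Function.Injective X)
    (hXΓ : ∀ j, ‖X j‖ = 1) (γ : Fin m → ℝ) :
    ∃ M : ℝ, ∀ S, ‖S‖ = 1 → ∏ j, ‖S - X j‖ ^ γ j ≤ M * ∑ j, ‖S - X j‖ ^ γ j := by
  classical
  obtain ⟨s, hs, hsep⟩ := exists_separation hX
  -- The summand `1` makes every `a j ≥ 1`, so a product with one factor removed is at most the full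
  -- product.
  set a : Fin m → ℝ := fun j => (s / 2) ^ γ j + 2 ^ γ j + 1 with ha
  have ha1 : ∀ j, 1 ≤ a j := fun j => by
    have : 0 ≤ (s / 2) ^ γ j := by positivity
    have : (0 : ℝ) ≤ 2 ^ γ j := by positivity
    simp only [ha]; linarith
  refine ⟨∏ j, a j, fun S hS => ?_⟩
  have : Nonempty (Fin m) := ⟨⟨0, hm⟩⟩
  obtain ⟨j, hj⟩ := Finite.exists_min fun j => ‖S - X j‖
  have h1 : ∀ k, k ≠ j → ‖S - X k‖ ^ γ k ≤ a k := by
    intro k hk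
    have e1 := hsep k j hk
    have e2 : ‖X k - X j‖ ≤ ‖S - X k‖ + ‖S - X j‖ := by
      rw [norm_sub_rev S (X k)]; exact norm_sub_le_norm_sub_add_norm_sub _ _ _
    have e3 := hj k
    have e4 : ‖S - X k‖ ≤ 2 := (norm_sub_le _ _).trans (by rw [hS, hXΓ]; norm_num)
    have := rpow_le_of_mem_Icc (s := s / 2) (γ := γ k) (by positivity)
      (by linarith : s / 2 ≤ ‖S - X k‖) e4
    simp only [ha]; linarith
  rw [← Finset.mul_prod_erase _ _ (Finset.mem_univ j), mul_comm]
  have h2 : ∏ k ∈ Finset.univ.erase j, ‖S - X k‖ ^ γ k ≤ ∏ k ∈ Finset.univ.erase j, a k :=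
    Finset.prod_le_prod (fun k _ => by positivity) fun k hk => h1 k (Finset.ne_of_mem_erase hk)
  have h3 : ∏ k ∈ Finset.univ.erase j, a k ≤ ∏ k, a k :=
    Finset.prod_le_prod_of_subset_of_one_le (Finset.erase_subset _ _)
      (fun k _ => by linarith [ha1 k]) fun k _ _ => ha1 k
  have h4 : ‖S - X j‖ ^ γ j ≤ ∑ k, ‖S - X k‖ ^ γ k :=
    Finset.single_le_sum (f := fun k => ‖S - X k‖ ^ γ k) (fun k _ => by positivity)
      (Finset.mem_univ j)
  exact mul_le_mul (h2.trans h3) h4 (by positivity)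
    (Finset.prod_nonneg fun k _ => by linarith [ha1 k])

theorem circleIntegrable_prod_rpow (hm : 0 < m) {X : Fin m → ℂ} (hX : Function.Injective X)
    (hXΓ : ∀ j, ‖X j‖ = 1) {γ : Fin m → ℝ} (hγ : ∀ j, -1 < γ j) :
    CircleIntegrable (fun S => ∏ j, ‖S - X j‖ ^ γ j) 0 1 := by
  obtain ⟨M, hM⟩ := exists_prod_le_sum hm hX hXΓ γ
  have h1 : CircleIntegrable (fun S => M * ∑ j, ‖S - X j‖ ^ γ j) 0 1 := by
    have : CircleIntegrable (∑ j, fun S => ‖S - X j‖ ^ γ j) 0 1 :=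
      CircleIntegrable.sum Finset.univ fun j _ => circleIntegrable_norm_sub_rpow (hXΓ j) (hγ j)
    have h2 := IntervalIntegrable.const_mul this M
    simpa [CircleIntegrable, Finset.sum_apply] using h2
  refine circleIntegrable_of_continuousOn_of_le (B := range X) (finite_range X) ?_ h1 ?_
  · refine continuousOn_finsetProd _ fun j _ => ?_
    refine ContinuousOn.rpow_const (by fun_prop) fun S hS => Or.inl ?_
    rw [norm_ne_zero_iff, sub_ne_zero]
    rintro rfl; exact hS.2 ⟨j, rfl⟩
  · intro S hS
    rw [Real.norm_eq_abs, abs_of_nonneg (Finset.prod_nonneg fun j _ => by positivity)]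
    exact hM S (by simpa using hS.1)

end products

/-! ### The biharmonic plane as an isometric copy of `ℂ`. -/

theorem norm_ofPlane (z : ℂ) : ‖Biharm.ofPlane z‖ = ‖z‖ := by
  have h : ‖Biharm.ofPlane z‖ = ‖(!₂[(z.re : ℂ), (z.im : ℂ)] : EuclideanSpace ℂ (Fin 2))‖ := rfl
  rw [h, EuclideanSpace.norm_eq, Complex.norm_eq_sqrt_sq_add_sq]
  simp [Complex.norm_real]

theorem ofPlane_sub (z w : ℂ) :
    Biharm.ofPlane (z - w) = Biharm.ofPlane z - Biharm.ofPlane w := by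
  rw [eq_sub_iff_add_eq]
  apply Biharm.ext_coeff <;> simp [Biharm.ofPlane]

theorem norm_ofPlane_sub (z w : ℂ) : ‖Biharm.ofPlane z - Biharm.ofPlane w‖ = ‖z - w‖ := by
  rw [← ofPlane_sub, norm_ofPlane]

theorem isometry_ofPlane : Isometry Biharm.ofPlane :=
  Isometry.of_dist_eq fun z w => by rw [dist_eq_norm, dist_eq_norm, norm_ofPlane_sub]

/-! ### The conformal map near the corners and the pulled-back densities. -/

section conformal

variable {σ : ℂ → ℂ} {D : Set ℂ}

/-- The open set `D` is disjoint from its frontier, so interior and boundary points cannot share a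
value. -/
theorem IsConformalOnto.injOn_closedBall (hσ : IsConformalOnto σ D) (hD : IsOpen D) :
    InjOn σ (closedBall 0 1) := by
  have hcase : ∀ Z ∈ closedBall (0 : ℂ) 1, Z ∈ ball (0 : ℂ) 1 ∨ Z ∈ sphere (0 : ℂ) 1 := by
    intro Z hZ
    rw [← ball_union_sphere] at hZ
    exact hZ
  have hdis : ∀ z, z ∈ D → z ∉ frontier D := fun z hz hz' => by
    rw [hD.frontier_eq] at hz'
    exact hz'.2 hz
  intro S hS Z hZ h
  rcases hcase S hS with h1 | h1 <;> rcases hcase Z hZ with h2 | h2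
  · exact hσ.bijOn.injOn h1 h2 h
  · exact absurd (hσ.bijOn_boundary.mapsTo h2) (hdis _ (h ▸ hσ.bijOn.mapsTo h1))
  · exact absurd (hσ.bijOn_boundary.mapsTo h1) (hdis _ (h ▸ hσ.bijOn.mapsTo h2))
  · exact hσ.bijOn_boundary.injOn h1 h2 h

theorem IsConformalOnto.exists_le_norm_sub (hσ : IsConformalOnto σ D) (hD : IsOpen D)
    {r : ℝ} (hr : 0 < r) : ∃ c > 0, ∀ S ∈ closedBall (0 : ℂ) 1, ∀ Z ∈ closedBall (0 : ℂ) 1,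
      r ≤ ‖S - Z‖ → c ≤ ‖σ S - σ Z‖ := by
  set K : Set (ℂ × ℂ) := (closedBall 0 1 ×ˢ closedBall 0 1) ∩ {p | r ≤ ‖p.1 - p.2‖}
  have hK : IsCompact K :=
    ((isCompact_closedBall 0 1).prod (isCompact_closedBall 0 1)).inter_right
      (isClosed_le continuous_const (by fun_prop))
  have hc : ContinuousOn (fun p : ℂ × ℂ => ‖σ p.1 - σ p.2‖) K := by
    refine ContinuousOn.norm (ContinuousOn.sub ?_ ?_)
    · exact hσ.continuousOn.comp continuous_fst.continuousOn fun p hp => hp.1.1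
    · exact hσ.continuousOn.comp continuous_snd.continuousOn fun p hp => hp.1.2
  have hpos : ∀ p ∈ K, 0 < ‖σ p.1 - σ p.2‖ := fun p hp => by
    rw [norm_pos_iff, sub_ne_zero]
    intro h
    have h1 := hσ.injOn_closedBall hD hp.1.1 hp.1.2 h
    have h2 := hp.2
    simp only [mem_ofPred_eq, h1, sub_self, norm_zero] at h2
    linarith
  obtain ⟨c, hc0, hc'⟩ := hK.exists_forall_le' hc hpos
  exact ⟨c, hc0, fun S hS Z hZ h => hc' (S, Z) ⟨⟨hS, hZ⟩, h⟩⟩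

variable {m : ℕ} {X : Fin m → ℂ} {β : Fin m → ℝ}

/-- This converts distances to `ζ_j` into distances to `X_j` in the density bound. The lower bound
on `d` excludes the corner as second argument, so it is applied along the radius ending at `X j` and
passed to the limit; far from `X j`, compactness suffices. -/
theorem exists_corner_lower_bound (hσ : IsConformalOnto σ D) (hD : IsOpen D)
    (hXΓ : ∀ j, ‖X j‖ = 1) (hβ : ∀ j, -1 < β j) (hB : LocalCondition σ X β) (j : Fin m) :
    ∃ c > 0, ∀ S ∈ sphere (0 : ℂ) 1 \ range X,
      c * ‖S - X j‖ ^ (1 + β j) ≤ ‖σ S - σ (X j)‖ := by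
  obtain ⟨r, hr, -, -, c, hc, hcd⟩ := hB
  obtain ⟨c', hc', hcd'⟩ := hσ.exists_le_norm_sub hD (r := 2 * r) (by positivity)
  have hXm : X j ∈ closedBall (0 : ℂ) 1 := by simp [hXΓ]
  refine ⟨min c (c' / 2 ^ (1 + β j)), by positivity, fun S hS => ?_⟩
  have hSn : ‖S‖ = 1 := by simpa using hS.1
  have hSm : S ∈ closedBall (0 : ℂ) 1 := by simp [hSn]
  have hx : 0 < ‖S - X j‖ := by
    rw [norm_pos_iff, sub_ne_zero]; rintro rfl; exact hS.2 ⟨j, rfl⟩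
  have hx2 : ‖S - X j‖ ≤ 2 := (norm_sub_le _ _).trans (by rw [hSn, hXΓ]; norm_num)
  rcases le_or_gt ‖S - X j‖ (2 * r) with h | h
  · set Z : ℝ → ℂ := fun t => (1 - t : ℝ) * X j with hZ
    have hZt : Tendsto Z (𝓝[>] 0) (𝓝 (X j)) := by
      have : Continuous Z := by fun_prop
      have := (this.tendsto 0).mono_left (nhdsWithin_le_nhds (s := Ioi 0))
      simpa [hZ] using this
    have hev : ∀ᶠ t in 𝓝[>] (0 : ℝ), Z t ∈ ball (0 : ℂ) 1 ∧ ‖Z t - X j‖ ≤ r := by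
      filter_upwards [Ioo_mem_nhdsGT (show (0 : ℝ) < min r 1 by positivity)] with t ht
      have h1 : t < 1 := ht.2.trans_le (min_le_right _ _)
      have h2 : t < r := ht.2.trans_le (min_le_left _ _)
      constructor
      · simp only [hZ, mem_ball_zero_iff, norm_mul, hXΓ, Complex.norm_real, Real.norm_eq_abs]
        rw [abs_of_pos (by linarith)]; linarith [ht.1]
      · rw [show Z t - X j = ((-t : ℝ) : ℂ) * X j by simp only [hZ]; push_cast; ring, norm_mul,
          hXΓ, Complex.norm_real, Real.norm_eq_abs, abs_neg, abs_of_pos ht.1]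
        linarith
    have hle : ∀ᶠ t in 𝓝[>] (0 : ℝ),
        c * (‖S - X j‖ + ‖Z t - X j‖) ^ β j ≤ ‖σ S - σ (Z t)‖ / ‖S - Z t‖ := by
      filter_upwards [hev] with t ht
      have hZn : ‖Z t‖ < 1 := by simpa using ht.1
      have := hcd j (Z t) ⟨by simp [hZn.le], ?_⟩ ht.2 S hS h ?_
      · rwa [d, norm_div] at this
      · rintro ⟨k, hk⟩; have := hXΓ k; rw [hk] at this; linarith
      · rintro rfl; linarith
    have l1 : Tendsto (fun t => c * (‖S - X j‖ + ‖Z t - X j‖) ^ β j) (𝓝[>] 0)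
        (𝓝 (c * (‖S - X j‖ + ‖X j - X j‖) ^ β j)) := by
      refine Tendsto.const_mul _ (Tendsto.rpow_const ?_ (Or.inl ?_))
      · exact tendsto_const_nhds.add (hZt.sub_const _).norm
      · simp only [sub_self, norm_zero, add_zero]; exact hx.ne'
    have hσt : Tendsto (fun t => σ (Z t)) (𝓝[>] 0) (𝓝 (σ (X j))) :=
      (hσ.continuousOn (X j) hXm).tendsto.comp
        (tendsto_nhdsWithin_iff.2 ⟨hZt, hev.mono fun t ht => ball_subset_closedBall ht.1⟩)
    have l2 : Tendsto (fun t => ‖σ S - σ (Z t)‖ / ‖S - Z t‖) (𝓝[>] 0)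
        (𝓝 (‖σ S - σ (X j)‖ / ‖S - X j‖)) :=
      (tendsto_const_nhds.sub hσt).norm.div (tendsto_const_nhds.sub hZt).norm hx.ne'
    have hfin := le_of_tendsto_of_tendsto l1 l2 hle
    simp only [sub_self, norm_zero, add_zero] at hfin
    rw [le_div_iff₀ hx, mul_assoc, ← Real.rpow_add_one hx.ne', add_comm (β j)] at hfin
    exact (mul_le_mul_of_nonneg_right (min_le_left _ _) (by positivity)).trans hfin
  · have h1 := hcd' S hSm (X j) hXm h.le
    have h2 := Real.rpow_le_rpow hx.le hx2 (by linarith [hβ j] : 0 ≤ 1 + β j)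
    calc _ ≤ c' / 2 ^ (1 + β j) * 2 ^ (1 + β j) :=
          mul_le_mul (min_le_right _ _) h2 (by positivity) (by positivity)
      _ = c' := div_mul_cancel₀ _ (by positivity)
      _ ≤ _ := h1

theorem IsConformalOnto.exists_norm_sub_le (hσ : IsConformalOnto σ D) :
    ∃ M > 0, ∀ S ∈ closedBall (0 : ℂ) 1, ∀ Z ∈ closedBall (0 : ℂ) 1, ‖σ S - σ Z‖ ≤ M := by
  obtain ⟨C, hC⟩ := (isCompact_closedBall (0 : ℂ) 1).exists_bound_of_continuousOn hσ.continuousOn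
  refine ⟨2 * |C| + 1, by positivity, fun S hS Z hZ => ?_⟩
  have h1 := (hC S hS).trans (le_abs_self C)
  have h2 := (hC Z hZ).trans (le_abs_self C)
  linarith [norm_sub_le (σ S) (σ Z)]

/-- For `α j < 0` the left side is merely bounded, since nothing here bounds `|σ(S) - σ(X_j)|` above
by a power; this is why `max (α j) 0` appears. -/
theorem exists_corner_rpow_bound (hσ : IsConformalOnto σ D) (hD : IsOpen D)
    (hXΓ : ∀ j, ‖X j‖ = 1) (hβ : ∀ j, -1 < β j) (hB : LocalCondition σ X β) (α : Fin m → ℝ)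
    (j : Fin m) : ∃ C > 0, ∀ S ∈ sphere (0 : ℂ) 1 \ range X,
      ‖σ S - σ (X j)‖ ^ (-α j) ≤ C * ‖S - X j‖ ^ (-(max (α j) 0) * (1 + β j)) := by
  obtain ⟨c, hc, hlow⟩ := exists_corner_lower_bound hσ hD hXΓ hβ hB j
  obtain ⟨M, hM, hup⟩ := hσ.exists_norm_sub_le
  rcases le_or_gt 0 (α j) with h | h
  · refine ⟨c ^ (-α j), by positivity, fun S hS => ?_⟩
    have hx : 0 < ‖S - X j‖ := by
      rw [norm_pos_iff, sub_ne_zero]; rintro rfl; exact hS.2 ⟨j, rfl⟩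
    rw [max_eq_left h, mul_comm (-α j), Real.rpow_mul hx.le, ← Real.mul_rpow hc.le (by positivity)]
    exact Real.rpow_le_rpow_of_nonpos (by positivity) (hlow S hS) (by linarith)
  · refine ⟨M ^ (-α j), by positivity, fun S hS => ?_⟩
    rw [max_eq_right h.le, neg_zero, zero_mul, Real.rpow_zero, mul_one]
    refine Real.rpow_le_rpow (norm_nonneg _) (hup _ ?_ _ ?_) (by linarith)
    · exact sphere_subset_closedBall hS.1
    · simp [hXΓ]

/-- The pullback to the circle of an admissible density is continuous off the corner points, and it
is integrable, also against `|σ'|`. -/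
theorem DensityCondition.pullback (hσ : IsConformalOnto σ D) (hD : IsOpen D) (hm : 0 < m)
    (hX : Function.Injective X) (hXΓ : ∀ j, ‖X j‖ = 1) (hβ : ∀ j, -1 < β j)
    (hA : DerivCondition σ X β) (hB : LocalCondition σ X β) {α : Fin m → ℝ}
    (hα_neg : ∀ j, β j < 0 → α j < 1) (hα_nonneg : ∀ j, 0 ≤ β j → α j < 1 / (β j + 1))
    {φ : Biharm → ℝ} (hφ : DensityCondition σ D X α φ) :
    ContinuousOn (fun S => φ (sigmaTilde σ S)) (sphere 0 1 \ range X) ∧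
      CircleIntegrable (fun S => φ (sigmaTilde σ S)) 0 1 ∧
      CircleIntegrable (fun S => |φ (sigmaTilde σ S)| * ‖contourDeriv σ S‖) 0 1 := by
  have hmap : ∀ S ∈ sphere (0 : ℂ) 1 \ range X, sigmaTilde σ S ∈
      Biharm.ofPlane '' frontier D \ range (fun j => sigmaTilde σ (X j)) := by
    intro S hS
    refine ⟨⟨σ S, hσ.bijOn_boundary.mapsTo hS.1, rfl⟩, ?_⟩
    rintro ⟨j, hj⟩
    have h1 : σ (X j) = σ S := isometry_ofPlane.injective hj
    have h2 := hσ.bijOn_boundary.injOn (by simp [hXΓ]) hS.1 h1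
    exact hS.2 ⟨j, h2⟩
  have hcont : ContinuousOn (fun S => φ (sigmaTilde σ S)) (sphere 0 1 \ range X) := by
    refine hφ.continuousOn.comp ?_ hmap
    exact isometry_ofPlane.continuous.comp_continuousOn
      (hσ.continuousOn.mono (sdiff_subset.trans sphere_subset_closedBall))
  choose C hC0 hC using exists_corner_rpow_bound hσ hD hXΓ hβ hB α
  obtain ⟨c, hc⟩ := hφ.bound
  obtain ⟨c', hc'⟩ := hA.bound
  set γ : Fin m → ℝ := fun j => -(max (α j) 0) * (1 + β j) with hγ
  set K := |c| * ∏ j, C j with hK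
  have hK0 : 0 ≤ K := mul_nonneg (abs_nonneg _) (Finset.prod_nonneg fun j _ => (hC0 j).le)
  have hb : ∀ S ∈ sphere (0 : ℂ) 1 \ range X,
      |φ (sigmaTilde σ S)| ≤ K * ∏ j, ‖S - X j‖ ^ γ j := by
    intro S hS
    refine (hc _ (hmap S hS)).trans ?_
    rw [hK, mul_assoc, ← Finset.prod_mul_distrib]
    refine mul_le_mul (le_abs_self c) ?_ (Finset.prod_nonneg fun j _ => by positivity)
      (abs_nonneg c)
    refine Finset.prod_le_prod (fun j _ => by positivity) fun j _ => ?_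
    have := hC j S hS
    rwa [← norm_ofPlane_sub] at this
  have hα1 : ∀ j, max (α j) 0 < 1 := fun j => by
    refine max_lt ?_ one_pos
    rcases lt_or_ge (β j) 0 with h | h
    · exact hα_neg j h
    · refine (hα_nonneg j h).trans_le ?_
      rw [div_le_one (by linarith)]; linarith
  -- Integrability of the density itself. For `β j ≥ 0` this is exactly where `α j < 1 / (β j + 1)`
  -- enters.
  have hγ1 : ∀ j, -1 < γ j := fun j => by
    have h0 := hβ j
    have h1 := hα1 j
    have h2 : 0 ≤ max (α j) 0 := le_max_right _ _
    suffices max (α j) 0 * (1 + β j) < 1 by simp only [hγ]; linarith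
    rcases lt_or_ge (β j) 0 with h | h
    · nlinarith
    · have : max (α j) 0 < 1 / (β j + 1) := max_lt (hα_nonneg j h) (by positivity)
      rwa [lt_div_iff₀ (by linarith), add_comm] at this
  -- Integrability against `|σ'|`: `γ j + β j + 1 = (1 + β j)(1 - max (α j) 0)`.
  have hγ2 : ∀ j, -1 < γ j + β j := fun j => by
    have h0 := hβ j
    have h1 := hα1 j
    simp only [hγ]
    nlinarith [mul_pos (show 0 < 1 + β j by linarith) (show 0 < 1 - max (α j) 0 by linarith)]
  refine ⟨hcont, ?_, ?_⟩
  · refine circleIntegrable_of_continuousOn_of_le (finite_range X) hcont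
      (circleIntegrable_const_mul (circleIntegrable_prod_rpow hm hX hXΓ hγ1) K) hb
  · refine circleIntegrable_of_continuousOn_of_le (finite_range X) ?_
      (circleIntegrable_const_mul (circleIntegrable_prod_rpow hm hX hXΓ hγ2) (K * |c'|)) ?_
    · exact hcont.norm.mul hA.continuousOn.norm
    · intro S hS
      have hSn : ‖S‖ = 1 := by simpa using hS.1
      have h1 := hc' S ⟨sphere_subset_closedBall hS.1, hS.2⟩
      rw [discDeriv, if_neg (by linarith)] at h1
      have h2 : ∏ j, ‖S - X j‖ ^ (γ j + β j) =
          (∏ j, ‖S - X j‖ ^ γ j) * ∏ j, ‖S - X j‖ ^ β j := by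
        rw [← Finset.prod_mul_distrib]
        refine Finset.prod_congr rfl fun j _ => Real.rpow_add ?_ _ _
        rw [norm_pos_iff, sub_ne_zero]; rintro rfl; exact hS.2 ⟨j, rfl⟩
      have h3 : 0 ≤ ∏ j, ‖S - X j‖ ^ β j := Finset.prod_nonneg fun j _ => by positivity
      have h4 : 0 ≤ ∏ j, ‖S - X j‖ ^ γ j := Finset.prod_nonneg fun j _ => by positivity
      rw [Real.norm_eq_abs, abs_of_nonneg (by positivity), h2]
      calc _ ≤ (K * ∏ j, ‖S - X j‖ ^ γ j) * (|c'| * ∏ j, ‖S - X j‖ ^ β j) :=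
            mul_le_mul (hb S hS) (h1.trans (mul_le_mul_of_nonneg_right (le_abs_self _) h3))
              (norm_nonneg _) (by positivity)
        _ = _ := by ring

end conformal

/-! ### Contour derivatives of `σ₂` and `σ̃`. -/

section contour

variable {σ : ℂ → ℂ} {m : ℕ} {X : Fin m → ℂ} {β : Fin m → ℝ}

/-- Over the one-dimensional field `ℂ` it is enough that `T` is an accumulation point of the circle,
which is connected and nontrivial. -/
theorem uniqueDiffWithinAt_sphere {T : ℂ} (hT : T ∈ sphere (0 : ℂ) 1) :
    UniqueDiffWithinAt ℂ (sphere (0 : ℂ) 1) T := by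
  rw [uniqueDiffWithinAt_iff_accPt]
  have h1 : IsPreconnected (sphere (0 : ℂ) 1) :=
    isPreconnected_sphere (by simp [Complex.rank_real_complex]) 0 1
  have h2 : (sphere (0 : ℂ) 1).Nontrivial :=
    ⟨1, by simp, -1, by simp, by norm_num [Complex.ext_iff]⟩
  exact h1.preperfect_of_nontrivial h2 T hT

/-- On the circle conjugation is inversion, so `conj (S - T)/(S - T) = -1/(S T)`; this factor tends
to `-1/T²`. -/
theorem hasDerivWithinAt_conj_sphere {f' T : ℂ} (hT : T ∈ sphere (0 : ℂ) 1)
    (h : HasDerivWithinAt σ f' (sphere 0 1) T) :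
    HasDerivWithinAt (fun S => starRingEnd ℂ (σ S)) (-(starRingEnd ℂ f') / T ^ 2)
      (sphere 0 1) T := by
  have hT0 : T ≠ 0 := by rintro rfl; simp at hT
  rw [hasDerivWithinAt_iff_tendsto_slope] at h ⊢
  have h1 : Tendsto (fun S : ℂ => -(starRingEnd ℂ (slope σ T S)) / (S * T))
      (𝓝[sphere 0 1 \ {T}] T) (𝓝 (-(starRingEnd ℂ f') / (T * T))) := by
    refine Tendsto.div ?_ ?_ (mul_ne_zero hT0 hT0)
    · exact ((Complex.continuous_conj.tendsto _).comp h).neg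
    · exact (tendsto_id'.2 nhdsWithin_le_nhds).mul_const _
  rw [sq]
  refine h1.congr' ?_
  filter_upwards [self_mem_nhdsWithin] with S hS
  have hne : S - T ≠ 0 := sub_ne_zero.2 hS.2
  have hS0 : S ≠ 0 := by rintro rfl; simp at hS
  have e1 : ∀ U : ℂ, U ∈ sphere (0 : ℂ) 1 → starRingEnd ℂ U = U⁻¹ := fun U hU => by
    rw [Complex.inv_def, Complex.normSq_eq_norm_sq]
    simp only [mem_sphere_zero_iff_norm] at hU
    simp [hU]
  simp only [slope_def_module, smul_eq_mul, map_mul, map_inv₀, map_sub, e1 S hS.1, e1 T hT]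
  have hne' : T - S ≠ 0 := by rw [← neg_sub]; exact neg_ne_zero.2 hne
  have e2 : S⁻¹ - T⁻¹ = (T - S) / (S * T) := by field_simp
  rw [e2, inv_div]
  rw [show (S - T)⁻¹ = -(T - S)⁻¹ by rw [← neg_sub T S, inv_neg]]
  field_simp

theorem hasDerivWithinAt_sigma₂ {f' T : ℂ} (hT : T ∈ sphere (0 : ℂ) 1)
    (h : HasDerivWithinAt σ f' (sphere 0 1) T) :
    HasDerivWithinAt (sigma₂ σ) ((f' + starRingEnd ℂ f' / T ^ 2) / (2 * Complex.I))
      (sphere 0 1) T := by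
  have h1 := (h.sub (hasDerivWithinAt_conj_sphere hT h)).div_const (2 * Complex.I)
  have e : sigma₂ σ = fun S => (σ S - starRingEnd ℂ (σ S)) / (2 * Complex.I) := by
    ext S
    rw [Complex.sub_conj]
    simp only [sigma₂]
    push_cast
    field_simp
  rw [e]
  exact h1.congr_deriv (by ring)

theorem contourDeriv_sigma₂ (hA : DerivCondition σ X β) {T : ℂ}
    (hT : T ∈ sphere (0 : ℂ) 1 \ range X) : contourDeriv (sigma₂ σ) T =
      (contourDeriv σ T + starRingEnd ℂ (contourDeriv σ T) / T ^ 2) / (2 * Complex.I) :=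
  (hasDerivWithinAt_sigma₂ hT.1 (hA.differentiable T hT).hasDerivWithinAt).derivWithin
    (uniqueDiffWithinAt_sphere hT.1)

/-- Differentiates `σ̃ = σ e₁ + σ₂ (e₂ - i e₁)`, the splitting along the nilpotent element. -/
theorem contourDeriv_sigmaTilde (hA : DerivCondition σ X β) {T : ℂ}
    (hT : T ∈ sphere (0 : ℂ) 1 \ range X) : contourDeriv (sigmaTilde σ) T =
      Biharm.mk (contourDeriv σ T - Complex.I * contourDeriv (sigma₂ σ) T)
        (contourDeriv (sigma₂ σ) T) := by
  have h1 : HasDerivWithinAt σ (contourDeriv σ T) (sphere 0 1) T :=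
    (hA.differentiable T hT).hasDerivWithinAt
  have h2 := hasDerivWithinAt_sigma₂ hT.1 h1
  rw [← contourDeriv_sigma₂ hA hT] at h2
  have h3 := (h1.smul_const (Biharm.mk 1 0)).add (h2.smul_const (Biharm.mk (-Complex.I) 1))
  have e : sigmaTilde σ =
      (fun S => σ S • Biharm.mk 1 0) + fun S => sigma₂ σ S • Biharm.mk (-Complex.I) 1 := by
    funext S
    simp only [Pi.add_apply]
    apply Biharm.ext_coeff
    · simp only [sigmaTilde, Biharm.ofPlane, sigma₂, Biharm.c₁_mk, Biharm.c₁_add, Biharm.c₁_smul]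
      nth_rewrite 2 [← Complex.re_add_im (σ S)]
      ring
    · simp only [sigmaTilde, Biharm.ofPlane, sigma₂, Biharm.c₂_mk, Biharm.c₂_add, Biharm.c₂_smul]
      ring
  rw [contourDeriv, e, h3.derivWithin (uniqueDiffWithinAt_sphere hT.1)]
  apply Biharm.ext_coeff <;> simp [contourDeriv]
  ring

end contour

/-! ### Dini moduli of continuity for `σ'` away from the corners. -/

section modulus

theorem IsSemiadditiveModulus.le_nat_mul {ω : ℝ → ℝ} (h : IsSemiadditiveModulus ω) {s : ℝ}
    (hs : 0 < s) (n : ℕ) : ω ((n + 1) * s) ≤ (n + 1) * ω s := by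
  induction n with
  | zero => simp
  | succ n ih =>
    have := h.subadd ((n + 1) * s) s (by positivity) hs
    push_cast
    rw [show ((n : ℝ) + 1 + 1) * s = (n + 1) * s + s by ring]
    linarith

/-- Semiadditivity makes `ω(η)/η` decreasing up to the factor 2: with `n = ⌊y/s⌋` one has `y < (n +
1) s ≤ 2y`. -/
theorem IsSemiadditiveModulus.mul_le {ω : ℝ → ℝ} (h : IsSemiadditiveModulus ω) {s y : ℝ}
    (hs : 0 < s) (hy : s ≤ y) : ω y * s ≤ 2 * (ω s * y) := by
  set n := ⌊y / s⌋₊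
  have h1 : y / s < n + 1 := Nat.lt_floor_add_one _
  have h2 : (n : ℝ) ≤ y / s := Nat.floor_le (div_nonneg (hs.le.trans hy) hs.le)
  rw [div_lt_iff₀ hs] at h1
  rw [le_div_iff₀ hs] at h2
  have h0 : 0 < ((n : ℝ) + 1) * s := by positivity
  have h3 := h.mono (mem_Ioi.2 (by linarith)) (mem_Ioi.2 h0) h1.le
  have h4 := h3.trans (h.le_nat_mul hs n)
  have h5 := h.pos s hs
  nlinarith

variable {σ : ℂ → ℂ} {m : ℕ} {X : Fin m → ℂ} {β : Fin m → ℝ}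

/-- A modulus of continuity with the Dini property. -/
structure IsDiniModulus (w : ℝ → ℝ) (ρ : ℝ) : Prop where
  nonneg : ∀ η, 0 < η → 0 ≤ w η
  mono : MonotoneOn w (Ioi 0)
  mul_le : ∀ s y, 0 < s → s ≤ y → w y * s ≤ 2 * (w s * y)
  integrableOn : IntegrableOn (fun η => w η / η) (Ioc 0 ρ)

theorem IsSemiadditiveModulus.isDiniModulus {ω : ℝ → ℝ} (h : IsSemiadditiveModulus ω) {ρ : ℝ}
    (hi : IntegrableOn (fun η => ω η / η) (Ioc 0 ρ)) : IsDiniModulus ω ρ :=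
  ⟨fun η hη => (h.pos η hη).le, h.mono, fun _ _ hs hy => h.mul_le hs hy, hi⟩

theorem IsDiniModulus.const_mul {w : ℝ → ℝ} {ρ K : ℝ} (h : IsDiniModulus w ρ) (hK : 0 ≤ K) :
    IsDiniModulus (fun η => K * w η) ρ where
  nonneg η hη := mul_nonneg hK (h.nonneg η hη)
  mono a ha b hb hab := mul_le_mul_of_nonneg_left (h.mono ha hb hab) hK
  mul_le s y hs hy := by
    have := mul_le_mul_of_nonneg_left (h.mul_le s y hs hy) hK
    linarith
  integrableOn := by
    simp only [mul_div_assoc]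
    exact h.integrableOn.const_mul K

theorem IsDiniModulus.add {w₁ w₂ : ℝ → ℝ} {ρ : ℝ} (h₁ : IsDiniModulus w₁ ρ)
    (h₂ : IsDiniModulus w₂ ρ) : IsDiniModulus (fun η => w₁ η + w₂ η) ρ where
  nonneg η hη := add_nonneg (h₁.nonneg η hη) (h₂.nonneg η hη)
  mono a ha b hb hab := add_le_add (h₁.mono ha hb hab) (h₂.mono ha hb hab)
  mul_le s y hs hy := by
    have := h₁.mul_le s y hs hy
    have := h₂.mul_le s y hs hy
    linarith
  integrableOn := by
    simp only [add_div]
    exact h₁.integrableOn.add h₂.integrableOn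

/-- Almost monotonicity of `w(η)/η` gives `w(y)/2 ≤ ∫₀^y w(η)/η dη`, and the integral tends to zero
with `y`. -/
theorem IsDiniModulus.tendsto_zero {w : ℝ → ℝ} {ρ : ℝ} (h : IsDiniModulus w ρ) (hρ : 0 < ρ) :
    Tendsto w (𝓝[>] 0) (𝓝 0) := by
  have hi : IntervalIntegrable (fun η => w η / η) volume 0 ρ := by
    rw [intervalIntegrable_iff_integrableOn_Ioc_of_le hρ.le]; exact h.integrableOn
  have h1 : Tendsto (fun y => ∫ η in (0 : ℝ)..y, w η / η) (𝓝[>] 0) (𝓝 0) := by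
    have hc := intervalIntegral.continuousOn_primitive_interval' hi (left_mem_uIcc)
    have := hc 0 left_mem_uIcc
    rw [ContinuousWithinAt, intervalIntegral.integral_same, uIcc_of_le hρ.le] at this
    refine this.mono_left ?_
    rw [← nhdsWithin_Ioc_eq_nhdsGT hρ]
    exact nhdsWithin_mono _ Ioc_subset_Icc_self
  have h2 := h1.const_mul 2
  rw [mul_zero] at h2
  refine squeeze_zero' ?_ ?_ h2
  · filter_upwards [self_mem_nhdsWithin] with y hy using h.nonneg y hy
  · filter_upwards [Ioc_mem_nhdsGT hρ] with y hy
    have h3 : ∫ η in (0 : ℝ)..y, w y / (2 * y) ≤ ∫ η in (0 : ℝ)..y, w η / η := by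
      rw [intervalIntegral.integral_of_le hy.1.le, intervalIntegral.integral_of_le hy.1.le]
      refine setIntegral_mono_on (by simp) (h.integrableOn.mono_set
        (Ioc_subset_Ioc_right hy.2)) measurableSet_Ioc fun η hη => ?_
      have h4 := h.mul_le η y hη.1 hη.2
      have h5 : 0 < 2 * y := by linarith [hy.1]
      rw [div_le_div_iff₀ h5 hη.1]
      linarith
    rw [intervalIntegral.integral_const, sub_zero, smul_eq_mul] at h3
    have h6 : y * (w y / (2 * y)) = w y / 2 := by
      have := hy.1.ne'; field_simp
    linarith

theorem distX_le (X : Fin m → ℂ) (Z : ℂ) (j : Fin m) : distX X Z ≤ ‖Z - X j‖ :=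
  ciInf_le (finite_range _).bddBelow j

theorem exists_distX_eq (hm : 0 < m) (X : Fin m → ℂ) (Z : ℂ) : ∃ j, ‖Z - X j‖ = distX X Z := by
  have : Nonempty (Fin m) := ⟨⟨0, hm⟩⟩
  exact exists_eq_ciInf_of_finite

/-- Near a non-corner point the weight and the denominator `ω(𝓡/2)` are frozen into a constant: `T`
stays at least `3δ/4` and `Z` at least `δ/2` from every corner. -/
theorem le_mul_of_derivModulusBound {ω : ℝ → ℝ} {A : Set ℂ} (hm : 0 < m)
    (hXΓ : ∀ j, ‖X j‖ = 1) (hω : IsSemiadditiveModulus ω) (h : DerivModulusBound σ X β ω A)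
    {Z₀ : ℂ} {δ : ℝ} (hδ : 0 < δ) (hδ' : ∀ j, δ ≤ ‖Z₀ - X j‖) :
    ∃ K ≥ 0, ∀ T ∈ A, ‖T‖ = 1 → ‖T - Z₀‖ ≤ δ / 4 → ∀ Z ∈ sphere (0 : ℂ) 1 ∪ segment ℝ 0 T,
      Z ≠ T → ‖Z - T‖ ≤ δ / 4 → ‖discDeriv σ Z - discDeriv σ T‖ ≤ K * ω ‖Z - T‖ := by
  obtain ⟨c, hc⟩ := h
  set P := ∏ j, ((δ / 2) ^ β j + 2 ^ β j) with hP
  have hP0 : 0 ≤ P := Finset.prod_nonneg fun j _ => by positivity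
  have hω4 := hω.pos (δ / 4) (by positivity)
  refine ⟨|c| / ω (δ / 4) * P, by positivity, fun T hTA hT hTZ Z hZ hne hZT => ?_⟩
  have hTX : ∀ j, 3 / 4 * δ ≤ ‖T - X j‖ := fun j => by
    have h1 := norm_sub_le_norm_sub_add_norm_sub Z₀ T (X j)
    rw [norm_sub_rev Z₀ T] at h1
    linarith [hδ' j]
  have hd : δ / 4 ≤ distX X T / 2 := by
    obtain ⟨j, hj⟩ := exists_distX_eq hm X T
    have := hTX j
    linarith
  have hZn : ‖Z‖ ≤ 1 := by
    rcases hZ with h | h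
    · simp only [mem_sphere_zero_iff_norm] at h; exact h.le
    · have := (convex_closedBall (0 : ℂ) 1).segment_subset (by simp) (by simp [hT]) h
      simpa using this
  have hpos : 0 < ‖Z - T‖ := norm_pos_iff.2 (sub_ne_zero.2 hne)
  have hprod : ∏ j, ‖Z - X j‖ ^ β j ≤ P := by
    refine Finset.prod_le_prod (fun j _ => by positivity) fun j _ => ?_
    refine rpow_le_of_mem_Icc (by positivity) ?_ ?_
    · have h1 := norm_sub_le_norm_sub_add_norm_sub T Z (X j)
      rw [norm_sub_rev T Z] at h1
      linarith [hTX j]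
    · refine (norm_sub_le _ _).trans ?_
      rw [hXΓ]; linarith
  have hωd : ω (δ / 4) ≤ ω (distX X T / 2) :=
    hω.mono (mem_Ioi.2 (by positivity)) (mem_Ioi.2 (by linarith)) hd
  have hωp := hω.pos _ hpos
  refine (hc T hTA Z hZ hne (hZT.trans hd)).trans ?_
  have hQ : 0 ≤ ∏ j, ‖Z - X j‖ ^ β j := Finset.prod_nonneg fun j _ => by positivity
  have e1 : ω ‖Z - T‖ / ω (distX X T / 2) ≤ ω ‖Z - T‖ / ω (δ / 4) :=
    div_le_div_of_nonneg_left hωp.le hω4 hωd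
  have e2 : 0 ≤ ω ‖Z - T‖ / ω (distX X T / 2) := div_nonneg hωp.le (hω4.le.trans hωd)
  calc _ ≤ |c| * (ω ‖Z - T‖ / ω (δ / 4)) * P := by
        refine mul_le_mul ?_ hprod hQ (by positivity)
        exact mul_le_mul (le_abs_self c) e1 e2 (abs_nonneg c)
    _ = _ := by ring

/-- Near a point of the circle that is not a corner, `σ'` has a common Dini modulus of continuity
along the circle and along the radii. -/
theorem exists_local_modulus (hm : 0 < m) (hXΓ : ∀ j, ‖X j‖ = 1) (hB : LocalCondition σ X β)
    {Z₀ : ℂ} (hZ₀ : Z₀ ∈ sphere (0 : ℂ) 1 \ range X) :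
    ∃ ρ > 0, ∃ w : ℝ → ℝ, IsDiniModulus w ρ ∧ ∀ T ∈ sphere (0 : ℂ) 1, ‖T - Z₀‖ ≤ ρ →
      T ∉ range X ∧ ∀ Z ∈ sphere (0 : ℂ) 1 ∪ segment ℝ 0 T, Z ≠ T → ‖Z - T‖ ≤ ρ →
        ‖discDeriv σ Z - contourDeriv σ T‖ ≤ w ‖Z - T‖ := by
  obtain ⟨r, hr, -, ⟨ω₁, ω₂, h₁, h₂, hi₁, ⟨_, hi₂⟩, hb₂, hb₁⟩, -⟩ := hB
  set δ := distX X Z₀ with hδ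
  have hδ0 : 0 < δ := by
    obtain ⟨j, hj⟩ := exists_distX_eq hm X Z₀
    rw [hδ, ← hj, norm_pos_iff, sub_ne_zero]
    rintro rfl; exact hZ₀.2 ⟨j, rfl⟩
  have hδX : ∀ j, δ ≤ ‖Z₀ - X j‖ := distX_le X Z₀
  obtain ⟨K₁, hK₁, hK₁'⟩ := le_mul_of_derivModulusBound hm hXΓ h₁ hb₁ hδ0 hδX
  obtain ⟨K₂, hK₂, hK₂'⟩ := le_mul_of_derivModulusBound hm hXΓ h₂ hb₂ hδ0 hδX
  -- `δ / 4` is needed for the frozen bound, `r / 4` stays below `r₀ / 2` in the Dini condition on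
  -- `ω₁'`, and `1` stays inside `(0, 2]` for `ω₁`.
  set ρ := min (δ / 4) (min (r / 4) 1) with hρ
  have hρ0 : 0 < ρ := by positivity
  have hρ1 : ρ ≤ δ / 4 := min_le_left _ _
  have hρ2 : ρ ≤ r / 4 := (min_le_right _ _).trans (min_le_left _ _)
  have hρ3 : ρ ≤ 1 := (min_le_right _ _).trans (min_le_right _ _)
  have hd₁ : IsDiniModulus (fun η => K₁ * ω₁ η) ρ :=
    (h₁.isDiniModulus (hi₁.mono_set (Ioc_subset_Ioc_right (by linarith)))).const_mul hK₁
  have hd₂ : IsDiniModulus (fun η => K₂ * ω₂ η) ρ :=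
    (h₂.isDiniModulus (hi₂ ρ hρ0 (by linarith)).1).const_mul hK₂
  -- The sum of both moduli is used because nearby `T` can fall on either side of the threshold
  -- `r₀`.
  refine ⟨ρ, hρ0, _, hd₁.add hd₂, fun T hT hTZ => ?_⟩
  have hTn : ‖T‖ = 1 := by simpa using hT
  have hTX : T ∉ range X := by
    rintro ⟨j, rfl⟩
    have := hδX j
    rw [norm_sub_rev] at this
    linarith
  refine ⟨hTX, fun Z hZ hne hZT => ?_⟩
  have hpos : 0 < ‖Z - T‖ := norm_pos_iff.2 (sub_ne_zero.2 hne)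
  have e1 := hd₁.nonneg _ hpos
  have e2 := hd₂.nonneg _ hpos
  have e3 : contourDeriv σ T = discDeriv σ T := by rw [discDeriv, if_neg (by linarith)]
  rw [e3]
  by_cases h : ∃ j, ‖T - X j‖ ≤ r
  · have := hK₂' T ⟨⟨hT, hTX⟩, h⟩ hTn (hTZ.trans hρ1) Z hZ hne (hZT.trans hρ1)
    linarith
  · have := hK₁' T ⟨hT, h⟩ hTn (hTZ.trans hρ1) Z hZ hne (hZT.trans hρ1)
    linarith

end modulus

/-! ### Pointwise kernel estimates against a linear model. -/

theorem norm_div_sub_inv_le {a p q w : ℂ} {G : ℝ} (hp : p ≠ 0) (hw : w ≠ 0)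
    (ha : ‖a - p‖ ≤ G * ‖w‖) (hq : ‖q - p * w‖ ≤ G * ‖w‖ ^ 2) (hl : ‖p‖ * ‖w‖ / 2 ≤ ‖q‖) :
    ‖a / q - 1 / w‖ ≤ 4 * G / ‖p‖ := by
  have hp' : 0 < ‖p‖ := norm_pos_iff.2 hp
  have hw' : 0 < ‖w‖ := norm_pos_iff.2 hw
  have hq' : 0 < ‖q‖ := lt_of_lt_of_le (by positivity) hl
  have hq0 : q ≠ 0 := norm_pos_iff.1 hq'
  have e : a / q - 1 / w = ((a - p) * w - (q - p * w)) / (q * w) := by field_simp; ring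
  rw [e, norm_div, norm_mul, div_le_div_iff₀ (by positivity) hp']
  have h1 : ‖(a - p) * w - (q - p * w)‖ ≤ 2 * (G * ‖w‖ ^ 2) := by
    refine (norm_sub_le _ _).trans ?_
    rw [norm_mul]
    nlinarith [mul_le_mul_of_nonneg_right ha hw'.le]
  have hG : 0 ≤ G := by
    by_contra h
    have := (norm_nonneg _).trans ha
    nlinarith
  calc _ ≤ 2 * (G * ‖w‖ ^ 2) * ‖p‖ := mul_le_mul_of_nonneg_right h1 hp'.le
    _ = 4 * G * (‖p‖ * ‖w‖ / 2 * ‖w‖) := by ring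
    _ ≤ 4 * G * (‖q‖ * ‖w‖) := by gcongr

theorem norm_conj_div_sub_le {q v : ℂ} (hq : q ≠ 0) (hv : v ≠ 0) :
    ‖starRingEnd ℂ q / q - starRingEnd ℂ v / v‖ ≤ 2 * ‖q - v‖ / ‖q‖ := by
  have e : starRingEnd ℂ q / q - starRingEnd ℂ v / v =
      (starRingEnd ℂ (q - v) * v - (q - v) * starRingEnd ℂ v) / (q * v) := by
    rw [map_sub]; field_simp; ring
  have hq' : 0 < ‖q‖ := norm_pos_iff.2 hq
  have hv' : 0 < ‖v‖ := norm_pos_iff.2 hv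
  rw [e, norm_div, norm_mul, div_le_div_iff₀ (by positivity) hq']
  have h1 : ‖starRingEnd ℂ (q - v) * v - (q - v) * starRingEnd ℂ v‖ ≤ 2 * ‖q - v‖ * ‖v‖ := by
    refine (norm_sub_le _ _).trans ?_
    rw [norm_mul, norm_mul, Complex.norm_conj, Complex.norm_conj]
    linarith
  calc _ ≤ 2 * ‖q - v‖ * ‖v‖ * ‖q‖ := mul_le_mul_of_nonneg_right h1 hq'.le
    _ = _ := by ring

/-- Here `a = σ'(S)`, `p = σ'(T)`, `q = σ(S) - σ(Z)`, `w = S - Z`, `Z = rT`. The kernel `L` equals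
`(1/2i)(conj a/(S² q) + a conj q/q²)`. Replacing `a` by `p` and `q` by `p w` costs three errors of
size `4G/|p|`; the linear model is the subtracted term `N` plus a bounded remainder. -/
theorem norm_kernel_sub_le {a p q S T : ℂ} {r G : ℝ} (hp : p ≠ 0) (hS : ‖S‖ = 1) (hT : ‖T‖ = 1)
    (hr0 : 0 ≤ r) (hr1 : r ≤ 1) (hw : S - r * T ≠ 0) (ha : ‖a - p‖ ≤ G * ‖S - r * T‖)
    (hq : ‖q - p * (S - r * T)‖ ≤ G * ‖S - r * T‖ ^ 2) (hl : ‖p‖ * ‖S - r * T‖ / 2 ≤ ‖q‖) :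
    ‖(a + starRingEnd ℂ a / S ^ 2) / (2 * Complex.I) / q -
        a * ((q - starRingEnd ℂ q) / (2 * Complex.I)) / q ^ 2 -
      starRingEnd ℂ p / (Complex.I * p) * ((1 - r : ℝ) / (S * (S - r * T) ^ 2))‖ ≤
      6 * G / ‖p‖ + 2 := by
  have hS0 : S ≠ 0 := by rintro rfl; simp at hS
  have hT0 : T ≠ 0 := by rintro rfl; simp at hT
  have hcS : starRingEnd ℂ S = S⁻¹ := by
    rw [Complex.inv_def, Complex.normSq_eq_norm_sq]; simp [hS]
  have hcT : starRingEnd ℂ T = T⁻¹ := by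
    rw [Complex.inv_def, Complex.normSq_eq_norm_sq]; simp [hT]
  set w := S - r * T with hwdef
  have hp' : 0 < ‖p‖ := norm_pos_iff.2 hp
  have hw' : 0 < ‖w‖ := norm_pos_iff.2 hw
  have hq' : 0 < ‖q‖ := lt_of_lt_of_le (by positivity) hl
  have hq0 : q ≠ 0 := norm_pos_iff.1 hq'
  have hcp : starRingEnd ℂ p ≠ 0 := by simpa using hp
  have hI := Complex.I_ne_zero
  have hcw : starRingEnd ℂ w = S⁻¹ - r * T⁻¹ := by
    rw [hwdef, map_sub, map_mul, hcS, hcT, Complex.conj_ofReal]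
  have e : (a + starRingEnd ℂ a / S ^ 2) / (2 * Complex.I) / q -
        a * ((q - starRingEnd ℂ q) / (2 * Complex.I)) / q ^ 2 -
      starRingEnd ℂ p / (Complex.I * p) * ((1 - r : ℝ) / (S * w ^ 2)) =
      1 / (2 * Complex.I) * (starRingEnd ℂ p / (S ^ 2 * p) *
          (starRingEnd ℂ a / starRingEnd ℂ p * p / q - 1 / w) +
        starRingEnd ℂ q / q * (a / q - 1 / w) +
        1 / w * (starRingEnd ℂ q / q - starRingEnd ℂ (p * w) / (p * w)) -
        starRingEnd ℂ p / p * (r * (S - T) ^ 2 / (T * S ^ 2 * w ^ 2))) := by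
    -- The linear model: for `r = 1` the two poles `1/w` cancel up to a bounded term, and for `r <
    -- 1` they leave the term with `1 - r`.
    have h1 : starRingEnd ℂ (p * w) / (p * w) * (1 / w) + starRingEnd ℂ p / (S ^ 2 * p) * (1 / w) =
        starRingEnd ℂ p / p * (2 * (1 - r : ℝ) / (S * w ^ 2) -
          r * (S - T) ^ 2 / (T * S ^ 2 * w ^ 2)) := by
      rw [map_mul, hcw]
      field_simp
      rw [hwdef]; push_cast
      ring
    have h2 : (a + starRingEnd ℂ a / S ^ 2) / (2 * Complex.I) / q -
        a * ((q - starRingEnd ℂ q) / (2 * Complex.I)) / q ^ 2 = 1 / (2 * Complex.I) *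
          (starRingEnd ℂ a / (S ^ 2 * q) + starRingEnd ℂ q / q * (a / q)) := by
      field_simp; ring
    have h3 : starRingEnd ℂ p / (S ^ 2 * p) * (starRingEnd ℂ a / starRingEnd ℂ p * p / q) =
        starRingEnd ℂ a / (S ^ 2 * q) := by
      field_simp
    have h4 : starRingEnd ℂ p / (Complex.I * p) * ((1 - r : ℝ) / (S * w ^ 2)) =
        1 / (2 * Complex.I) * (starRingEnd ℂ p / p * (2 * (1 - r : ℝ) / (S * w ^ 2))) := by
      field_simp
    rw [h2, h4, mul_sub (starRingEnd ℂ p / (S ^ 2 * p)), h3]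
    linear_combination (1 / (2 * Complex.I)) * h1
  rw [e]
  have b1 : ‖a / q - 1 / w‖ ≤ 4 * G / ‖p‖ := norm_div_sub_inv_le hp hw ha hq hl
  -- Rescaling `conj a` by the unimodular `p / conj p` puts it at the same distance from `p` as `a`,
  -- so the unconjugated lemma applies.
  have b2 : ‖starRingEnd ℂ a / starRingEnd ℂ p * p / q - 1 / w‖ ≤ 4 * G / ‖p‖ := by
    refine norm_div_sub_inv_le hp hw ?_ hq hl
    have : starRingEnd ℂ a / starRingEnd ℂ p * p - p =
        starRingEnd ℂ (a - p) * (p / starRingEnd ℂ p) := by rw [map_sub]; field_simp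
    rw [this, norm_mul, norm_div, Complex.norm_conj, Complex.norm_conj, div_self hp'.ne', mul_one]
    exact ha
  have b3 : ‖1 / w * (starRingEnd ℂ q / q - starRingEnd ℂ (p * w) / (p * w))‖ ≤ 4 * G / ‖p‖ := by
    rw [norm_mul, norm_div, norm_one]
    have h1 := norm_conj_div_sub_le hq0 (mul_ne_zero hp hw)
    have h2 : 2 * ‖q - p * w‖ / ‖q‖ ≤ 4 * G * ‖w‖ / ‖p‖ := by
      rw [div_le_div_iff₀ hq' hp']
      have hG : 0 ≤ G := by
        by_contra h
        have := (norm_nonneg _).trans ha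
        nlinarith
      calc _ ≤ 2 * (G * ‖w‖ ^ 2) * ‖p‖ := by gcongr
        _ = 4 * G * ‖w‖ * (‖p‖ * ‖w‖ / 2) := by ring
        _ ≤ 4 * G * ‖w‖ * ‖q‖ := by gcongr
    calc _ ≤ 1 / ‖w‖ * (4 * G * ‖w‖ / ‖p‖) :=
          mul_le_mul_of_nonneg_left (h1.trans h2) (by positivity)
      _ = _ := by field_simp
  have b4 : ‖starRingEnd ℂ p / p * (r * (S - T) ^ 2 / (T * S ^ 2 * w ^ 2))‖ ≤ 4 := by
    have h0 : ‖S - T‖ ≤ 2 * ‖w‖ := by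
      have h1 : ‖S - T‖ ≤ ‖w‖ + (1 - r) := by
        have : S - T = w - ((1 - r : ℝ) : ℂ) * T := by rw [hwdef]; push_cast; ring
        rw [this]
        refine (norm_sub_le _ _).trans ?_
        rw [norm_mul, hT, Complex.norm_real, Real.norm_eq_abs, abs_of_nonneg (by linarith), mul_one]
      have h2 : 1 - r ≤ ‖w‖ := by
        have := norm_sub_norm_le S (r * T)
        rw [norm_mul, hS, hT, Complex.norm_real, Real.norm_eq_abs, abs_of_nonneg hr0, mul_one]
          at this
        exact this
      linarith
    rw [norm_mul, norm_div, norm_div, norm_mul, norm_mul, norm_mul, norm_pow, norm_pow, norm_pow,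
      Complex.norm_conj, div_self hp'.ne', hS, hT, Complex.norm_real, Real.norm_eq_abs,
      abs_of_nonneg hr0, one_mul, one_pow, one_mul, one_mul, div_le_iff₀ (by positivity)]
    have := norm_nonneg (S - T)
    nlinarith
  have u1 : ‖starRingEnd ℂ p / (S ^ 2 * p)‖ = 1 := by
    rw [norm_div, norm_mul, norm_pow, hS, Complex.norm_conj, one_pow, one_mul, div_self hp'.ne']
  have u2 : ‖starRingEnd ℂ q / q‖ = 1 := by
    rw [norm_div, Complex.norm_conj, div_self hq'.ne']
  have u3 : ‖1 / (2 * Complex.I)‖ = 1 / 2 := by simp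
  rw [norm_mul, u3]
  have t1 : ‖starRingEnd ℂ p / (S ^ 2 * p) *
      (starRingEnd ℂ a / starRingEnd ℂ p * p / q - 1 / w)‖ ≤ 4 * G / ‖p‖ := by
    rw [norm_mul, u1, one_mul]; exact b2
  have t2 : ‖starRingEnd ℂ q / q * (a / q - 1 / w)‖ ≤ 4 * G / ‖p‖ := by
    rw [norm_mul, u2, one_mul]; exact b1
  have t := (norm_sub_le _ _).trans (add_le_add (norm_add₃_le.trans
    (add_le_add (add_le_add t1 t2) b3)) b4)
  calc _ ≤ 1 / 2 * (4 * G / ‖p‖ + 4 * G / ‖p‖ + 4 * G / ‖p‖ + 4) := by gcongr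
    _ = _ := by ring

/-! ### First-order expansion of `σ` near a boundary point. -/

section chord

variable {σ : ℂ → ℂ} {D : Set ℂ} {m : ℕ} {X : Fin m → ℂ} {β : Fin m → ℝ}

theorem norm_arc_sub_le (hA : DerivCondition σ X β) {T : ℂ} (hT : ‖T‖ = 1) {θ C : ℝ} {p : ℂ}
    (hX : ∀ s, |s| ≤ |θ| → T * circleMap 0 1 s ∉ range X)
    (hC : ∀ s, |s| ≤ |θ| → ‖contourDeriv σ (T * circleMap 0 1 s) - p‖ ≤ C) :
    ‖σ (T * circleMap 0 1 θ) - σ T - p * (T * circleMap 0 1 θ - T)‖ ≤ C * |θ| := by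
  set f : ℝ → ℂ := fun s => σ (T * circleMap 0 1 s) - p * (T * circleMap 0 1 s) with hf
  set f' : ℝ → ℂ := fun s =>
    (T * (circleMap 0 1 s * Complex.I)) • (contourDeriv σ (T * circleMap 0 1 s) - p) with hf'
  have hs : ∀ s ∈ uIcc 0 θ, |s| ≤ |θ| := fun s h => by simpa using abs_sub_left_of_mem_uIcc h
  have hcirc : ∀ s, HasDerivAt (fun s => T * circleMap 0 1 s) (T * (circleMap 0 1 s * Complex.I)) s :=
    fun s => (hasDerivAt_circleMap 0 1 s).const_mul T
  have hd : ∀ s ∈ uIcc 0 θ, HasDerivWithinAt f (f' s) (uIcc 0 θ) s := by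
    intro s h
    have h1 : HasDerivWithinAt σ (contourDeriv σ (T * circleMap 0 1 s)) (sphere 0 1)
        (T * circleMap 0 1 s) :=
      (hA.differentiable _ ⟨by simp [hT], hX s (hs s h)⟩).hasDerivWithinAt
    have h2 := h1.scomp s ((hcirc s).hasDerivWithinAt (s := uIcc 0 θ)) (fun u _ => by simp [hT])
    have h3 := h2.sub (((hcirc s).hasDerivWithinAt (s := uIcc 0 θ)).const_mul p)
    refine h3.congr_deriv ?_
    simp only [hf', smul_eq_mul]; ring
  have hb : ∀ s ∈ uIcc 0 θ, ‖f' s‖ ≤ C := by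
    intro s h
    have := hC s (hs s h)
    simpa [hf', hT] using this
  have := (convex_uIcc 0 θ).norm_image_sub_le_of_norm_hasDerivWithin_le hd hb left_mem_uIcc
    right_mem_uIcc
  simp only [hf, sub_zero, Real.norm_eq_abs] at this
  have h0 : circleMap 0 1 0 = 1 := by simp [circleMap]
  rw [h0, mul_one] at this
  refine le_trans (le_of_eq ?_) this
  congr 1; ring

/-- A mean value inequality with derivatives only on `[r, 1)`: at the endpoint on the circle mere
continuity of `σ` is available. -/
theorem norm_radial_sub_le (hσ : IsConformalOnto σ D) {T : ℂ} (hT : ‖T‖ = 1) {r C : ℝ} {p : ℂ}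
    (hr0 : 0 ≤ r) (hr1 : r ≤ 1) (hC : ∀ s, r ≤ s → s < 1 → ‖deriv σ (s * T) - p‖ ≤ C) :
    ‖σ T - σ (r * T) - p * (T - r * T)‖ ≤ C * (1 - r) := by
  set f : ℝ → ℂ := fun s => σ (s * T) - p * (s * T) with hf
  set f' : ℝ → ℂ := fun s => T • (deriv σ (s * T) - p) with hf'
  have hlin : ∀ s : ℝ, HasDerivAt (fun s : ℝ => (s : ℂ) * T) T s := fun s => by
    simpa using (Complex.ofRealCLM.hasDerivAt (x := s)).mul_const T
  have hn : ∀ s : ℝ, 0 ≤ s → ‖(s : ℂ) * T‖ = s := fun s h => by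
    rw [norm_mul, hT, Complex.norm_real, Real.norm_eq_abs, abs_of_nonneg h, mul_one]
  have hcont : ContinuousOn f (Icc r 1) := by
    refine ContinuousOn.sub ?_ (by fun_prop)
    refine hσ.continuousOn.comp (by fun_prop) fun s hs => ?_
    simp only [mem_closedBall_zero_iff]
    rw [hn s (hr0.trans hs.1)]; exact hs.2
  have hd : ∀ s ∈ Ico r 1, HasDerivWithinAt f (f' s) (Ici s) s := by
    intro s hs
    have hmem : (s : ℂ) * T ∈ ball (0 : ℂ) 1 := by
      rw [mem_ball_zero_iff, hn s (hr0.trans hs.1)]; exact hs.2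
    have h1 : HasDerivAt σ (deriv σ (s * T)) (s * T) :=
      (hσ.differentiableOn.differentiableAt (isOpen_ball.mem_nhds hmem)).hasDerivAt
    have h2 := h1.scomp s (hlin s)
    have h3 := (h2.sub ((hlin s).const_mul p)).hasDerivWithinAt (s := Ici s)
    refine h3.congr_deriv ?_
    simp only [hf', smul_eq_mul]; ring
  have hb : ∀ s ∈ Ico r 1, ‖f' s‖ ≤ C := by
    intro s hs
    have := hC s hs.1 hs.2
    simpa [hf', hT] using this
  have := norm_image_sub_le_of_norm_deriv_right_le_segment hcont hd hb 1 (right_mem_Icc.2 hr1)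
  simp only [hf, Complex.ofReal_one, one_mul] at this
  refine le_trans (le_of_eq ?_) this
  congr 1; ring

theorem norm_mul_radialProj (Z : ℂ) : (‖Z‖ : ℂ) * radialProj Z = Z := by
  by_cases h : Z = 0
  · simp [h, radialProj]
  · have : (‖Z‖ : ℂ) ≠ 0 := by simpa using h
    rw [radialProj]; field_simp

-- Uniform in `Z`: the majorant depends only on the angle from the radial projection `T`. The path
-- from `Z` to `S` is the radius to `T` followed by an arc, matching the directions in which the
-- modulus of `σ'` is known.
set_option maxHeartbeats 1000000 in
theorem exists_chord_estimate (hσ : IsConformalOnto σ D) (hm : 0 < m) (hXΓ : ∀ j, ‖X j‖ = 1)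
    (hA : DerivCondition σ X β) (hB : LocalCondition σ X β) {Z₀ : ℂ}
    (hZ₀ : Z₀ ∈ sphere (0 : ℂ) 1 \ range X) :
    ∃ ρ > 0, ∃ c > 0, ∃ g : ℝ → ℝ, IntervalIntegrable g volume (-Real.pi) Real.pi ∧
      ∀ Z ∈ closedBall (0 : ℂ) 1, ‖Z - Z₀‖ ≤ ρ → Z ≠ 0 ∧ c ≤ ‖contourDeriv σ (radialProj Z)‖ ∧
        ∀ θ ∈ Icc (-Real.pi) Real.pi, θ ≠ 0 → |θ| ≤ ρ → ∀ S, S = radialProj Z * circleMap 0 1 θ →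
          S ∉ range X ∧ S - Z ≠ 0 ∧ 0 ≤ g θ ∧
          ‖contourDeriv σ S - contourDeriv σ (radialProj Z)‖ ≤ g θ * ‖S - Z‖ ∧
          ‖σ S - σ Z - contourDeriv σ (radialProj Z) * (S - Z)‖ ≤ g θ * ‖S - Z‖ ^ 2 ∧
          ‖contourDeriv σ (radialProj Z)‖ * ‖S - Z‖ / 2 ≤ ‖σ S - σ Z‖ := by
  obtain ⟨ρ₀, hρ₀, w, hw, hloc⟩ := exists_local_modulus hm hXΓ hB hZ₀
  have hZ₀n : ‖Z₀‖ = 1 := by simpa using hZ₀.1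
  set c := ‖contourDeriv σ Z₀‖ / 2 with hc
  have hc0 : 0 < c := by
    have := norm_pos_iff.2 (hA.ne_zero Z₀ hZ₀)
    positivity
  obtain ⟨ρ₁, hρ₁, hlow⟩ : ∃ ρ₁ > 0, ∀ T ∈ sphere (0 : ℂ) 1 \ range X, ‖T - Z₀‖ < ρ₁ →
      c ≤ ‖contourDeriv σ T‖ := by
    have h1 := (hA.continuousOn Z₀ hZ₀).norm.eventually_const_lt
      (show c < ‖contourDeriv σ Z₀‖ by linarith)
    obtain ⟨ε, hε, h2⟩ := Metric.mem_nhdsWithin_iff.1 h1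
    exact ⟨ε, hε, fun T hT h => le_of_lt (h2 ⟨by simpa [dist_eq_norm] using h, hT⟩)⟩
  -- The arc costs at most `4N · c/10` and the radius `N · c/10`, with `N = |S - Z|`; the total
  -- `cN/2` leaves half of `|p| N`.
  obtain ⟨ρ₂, hρ₂, hsmall⟩ : ∃ ρ₂ > 0, ∀ η ∈ Ioo 0 ρ₂, w η < c / 10 := by
    have h1 := (hw.tendsto_zero hρ₀).eventually_lt_const (show 0 < c / 10 by positivity)
    obtain ⟨u, hu, h2⟩ := mem_nhdsGT_iff_exists_Ioo_subset.1 h1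
    exact ⟨u, hu, fun η hη => h2 hη⟩
  set ρ := min (ρ₀ / 3) (min (ρ₁ / 3) (min (ρ₂ / 2) (1 / 2))) with hρ
  have hρ0 : 0 < ρ := by positivity
  have r0 : ρ ≤ ρ₀ / 3 := min_le_left _ _
  have r1 : ρ ≤ ρ₁ / 3 := (min_le_right _ _).trans (min_le_left _ _)
  have r2 : ρ ≤ ρ₂ / 2 := (min_le_right _ _).trans ((min_le_right _ _).trans (min_le_left _ _))
  have r3 : ρ ≤ 1 / 2 := (min_le_right _ _).trans ((min_le_right _ _).trans (min_le_right _ _))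
  set h : ℝ → ℝ := (Ioc 0 ρ₀).indicator fun η => w η / η with hh
  refine ⟨ρ, hρ0, c, hc0, fun θ => 30 * h |θ|, ?_, ?_⟩
  · refine (intervalIntegrable_comp_abs Real.pi_pos.le ?_).const_mul 30
    exact (hw.integrableOn.integrable_indicator measurableSet_Ioc).integrableOn
  intro Z hZ hZZ
  have hZn : ‖Z‖ ≤ 1 := by simpa using hZ
  set y := 1 - ‖Z‖ with hy
  have hy0 : 0 ≤ y := by linarith
  have hyρ : y ≤ ρ := by
    have := norm_sub_norm_le Z₀ Z
    rw [norm_sub_rev, hZ₀n] at this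
    linarith
  have hZ0 : Z ≠ 0 := by
    rintro rfl
    rw [hy, norm_zero] at hyρ; linarith
  have hT := norm_radialProj hZ0
  have hTZeq := norm_mul_radialProj Z
  set T := radialProj Z
  have hTZ : ‖T - Z‖ = y := by
    rw [show T - Z = ((1 - ‖Z‖ : ℝ) : ℂ) * T by nth_rewrite 1 [← hTZeq]; push_cast; ring,
      norm_mul, hT, Complex.norm_real, Real.norm_eq_abs, abs_of_nonneg (by linarith), mul_one]
  have hTZ₀ : ‖T - Z₀‖ ≤ 2 * ρ := by
    have := norm_sub_le_norm_sub_add_norm_sub T Z Z₀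
    linarith
  have hTs : T ∈ sphere (0 : ℂ) 1 := by simpa using hT
  obtain ⟨hTX, hTmod⟩ := hloc T hTs (by linarith)
  have hpc : c ≤ ‖contourDeriv σ T‖ := hlow T ⟨hTs, hTX⟩ (by linarith)
  refine ⟨hZ0, hpc, fun θ hθ hθ0 hθρ S hS => ?_⟩
  set p := contourDeriv σ T with hp
  have hθpos : 0 < |θ| := abs_pos.2 hθ0
  have hx : ∀ s, ‖T * circleMap 0 1 s - T‖ ≤ |s| := fun s => by
    rw [norm_mul_circleMap_sub hT]; exact norm_circleMap_sub_one_le s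
  have hSX : ∀ s, |s| ≤ |θ| → T * circleMap 0 1 s ∉ range X := fun s hs => by
    refine (hloc _ (by simp [hT]) ?_).1
    have := norm_sub_le_norm_sub_add_norm_sub (T * circleMap 0 1 s) T Z₀
    linarith [hx s]
  have hderiv : ∀ s, |s| ≤ |θ| → ‖contourDeriv σ (T * circleMap 0 1 s) - p‖ ≤ w |θ| := by
    intro s hs
    by_cases hne : T * circleMap 0 1 s = T
    · rw [hne, hp, sub_self, norm_zero]; exact hw.nonneg _ hθpos
    · have h1 := hTmod (T * circleMap 0 1 s) (Or.inl (by simp [hT])) hne (by linarith [hx s])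
      rw [discDeriv, if_neg (by simp [hT])] at h1
      have h2 : 0 < ‖T * circleMap 0 1 s - T‖ := norm_pos_iff.2 (sub_ne_zero.2 hne)
      exact h1.trans (hw.mono h2 hθpos ((hx s).trans hs))
  have harc := norm_arc_sub_le hA hT hSX hderiv
  have hSX' := hSX θ le_rfl
  have hSd := hderiv θ le_rfl
  have hSn : ‖S‖ = 1 := by rw [hS, norm_mul_circleMap hT]
  have hxS := le_norm_circleMap_sub_one (abs_le.2 hθ)
  rw [← norm_mul_circleMap_sub hT] at hxS
  rw [← hS] at harc hSX' hSd hxS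
  have hrad : ‖σ T - σ Z - p * (T - Z)‖ ≤ w y * y := by
    have := norm_radial_sub_le (C := w y) (p := p) hσ hT (norm_nonneg Z) hZn fun s hs hs1 => by
      have hs0 : 0 ≤ s := (norm_nonneg Z).trans hs
      have hsn : ‖(s : ℂ) * T‖ = s := by
        rw [norm_mul, hT, Complex.norm_real, Real.norm_eq_abs, abs_of_nonneg hs0, mul_one]
      have hd : ‖(s : ℂ) * T - T‖ = 1 - s := by
        rw [show (s : ℂ) * T - T = ((-(1 - s) : ℝ) : ℂ) * T by push_cast; ring, norm_mul, hT,
          Complex.norm_real, Real.norm_eq_abs, abs_neg, abs_of_nonneg (by linarith), mul_one]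
      have hne : (s : ℂ) * T ≠ T := by
        intro h'; rw [h', sub_self, norm_zero] at hd; linarith
      have h1 := hTmod (s * T) (Or.inr ⟨1 - s, s, by linarith, hs0, by ring, by simp⟩) hne
        (by rw [hd]; linarith)
      rw [discDeriv, if_pos (by rw [hsn]; exact hs1), hd] at h1
      exact h1.trans (hw.mono (mem_Ioi.2 (by linarith)) (mem_Ioi.2 (by linarith)) (by linarith))
    rwa [hTZeq] at this
  set N := ‖S - Z‖ with hN
  have hyN : y ≤ N := by
    have := norm_sub_norm_le S Z
    rwa [hSn] at this
  -- `(2/π)|θ| ≤ |S - T| ≤ N + y ≤ 2N`, and `2/π ≥ 1/2`.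
  have hθN : |θ| ≤ 4 * N := by
    have h1 : ‖S - T‖ ≤ N + y := by
      have := norm_sub_le_norm_sub_add_norm_sub S Z T
      rwa [norm_sub_rev Z T, hTZ] at this
    have h4 : (1 : ℝ) / 2 ≤ 2 / Real.pi := by
      rw [div_le_div_iff₀ (by norm_num) Real.pi_pos]; linarith [Real.pi_le_four]
    nlinarith
  have hNpos : 0 < N := by linarith
  set g := w |θ| / |θ| with hg
  have hg0 : 0 ≤ g := div_nonneg (hw.nonneg _ hθpos) hθpos.le
  have hgw : w |θ| = g * |θ| := by rw [hg, div_mul_cancel₀ _ hθpos.ne']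
  have hgh : h |θ| = g := indicator_of_mem (show |θ| ∈ Ioc 0 ρ₀ from ⟨hθpos, by linarith⟩) _
  have hq : ‖σ S - σ Z - p * (S - Z)‖ ≤ w |θ| * |θ| + w y * y := by
    rw [show σ S - σ Z - p * (S - Z) = (σ S - σ T - p * (S - T)) + (σ T - σ Z - p * (T - Z)) by ring]
    exact (norm_add_le _ _).trans (add_le_add harc hrad)
  -- The radial error must be bounded through the angle. For `y ≤ |θ|` monotonicity of `w` suffices;
  -- for `y ≥ |θ|` the almost monotone quotient gives `w y ≤ 2 g y`.
  have hwy : w y * y ≤ 4 * g * N ^ 2 := by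
    rcases hy0.eq_or_lt with h' | h'
    · rw [← h']; simp; positivity
    · rcases le_total y |θ| with h1 | h1
      · have h2 := hw.mono h' hθpos h1
        have e1 : w y ≤ g * (4 * N) :=
          h2.trans (hgw.le.trans (mul_le_mul_of_nonneg_left hθN hg0))
        calc w y * y ≤ g * (4 * N) * N := mul_le_mul e1 hyN hy0 (by positivity)
          _ = _ := by ring
      · have h2 := hw.mul_le |θ| y hθpos h1
        rw [hgw] at h2
        have h3 : w y ≤ 2 * g * y := by
          refine le_of_mul_le_mul_right ?_ hθpos
          linarith
        calc w y * y ≤ 2 * g * y * y := mul_le_mul_of_nonneg_right h3 hy0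
          _ ≤ 2 * g * N * N := by gcongr
          _ ≤ 4 * g * N ^ 2 := by linarith [mul_nonneg hg0 (sq_nonneg N)]
  have hwθ : w |θ| * |θ| ≤ 16 * g * N ^ 2 := by
    rw [hgw]
    calc g * |θ| * |θ| ≤ g * (4 * N) * (4 * N) := by gcongr
      _ = _ := by ring
  refine ⟨hSX', ?_, ?_, ?_, ?_, ?_⟩
  · exact norm_pos_iff.1 hNpos
  · beta_reduce; rw [hgh]; positivity
  · beta_reduce; rw [hgh]
    refine hSd.trans ?_
    rw [hgw]
    have e1 := mul_le_mul_of_nonneg_left hθN hg0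
    have e2 := mul_nonneg hg0 hNpos.le
    linarith
  · beta_reduce; rw [hgh]
    have := mul_nonneg hg0 (sq_nonneg N)
    linarith
  · have s1 : w |θ| * |θ| ≤ c / 10 * (4 * N) :=
      mul_le_mul (hsmall _ ⟨hθpos, by linarith⟩).le hθN hθpos.le (by positivity)
    have s2 : w y * y ≤ c / 10 * N := by
      rcases hy0.eq_or_lt with h' | h'
      · rw [← h']; simp; positivity
      · exact mul_le_mul (hsmall _ ⟨h', by linarith⟩).le hyN hy0 (by positivity)
    have s3 : ‖p * (S - Z)‖ ≤ ‖σ S - σ Z‖ + ‖σ S - σ Z - p * (S - Z)‖ := by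
      have := norm_sub_le (σ S - σ Z) (σ S - σ Z - p * (S - Z))
      rwa [sub_sub_cancel] at this
    rw [norm_mul] at s3
    have s4 : c * N ≤ ‖p‖ * N := mul_le_mul_of_nonneg_right hpc hNpos.le
    linarith

end chord

/-! ### The kernels `K`, `L`, `N`: bounds off the diagonal and joint continuity. -/

/-- The holomorphic part of the difference of the Cauchy kernels of the domain and the disc. -/
def kerK (σ : ℂ → ℂ) (S Z : ℂ) : ℂ := contourDeriv σ S / (σ S - σ Z) - 1 / (S - Z)

/-- The nilpotent part of the biharmonic Cauchy kernel. -/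
def kerL (σ : ℂ → ℂ) (S Z : ℂ) : ℂ :=
  contourDeriv (sigma₂ σ) S / (σ S - σ Z) -
    contourDeriv σ S * (sigma₂ σ S - sigma₂ σ Z) / (σ S - σ Z) ^ 2

/-- The singular part of `kerL` for `Z` inside the disc; it vanishes for `Z` on the circle. -/
def kerN (σ : ℂ → ℂ) (S Z : ℂ) : ℂ :=
  starRingEnd ℂ (contourDeriv σ (radialProj Z)) / (Complex.I * contourDeriv σ (radialProj Z)) *
    ((1 - ‖Z‖ : ℝ) / (S * (S - Z) ^ 2))

section kernels

variable {σ : ℂ → ℂ} {D : Set ℂ} {m : ℕ} {X : Fin m → ℂ} {β : Fin m → ℝ}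

theorem nhdsWithin_sphere_sdiff {S : ℂ} (hS : S ∈ sphere (0 : ℂ) 1 \ range X) :
    𝓝[sphere (0 : ℂ) 1 \ range X] S = 𝓝[sphere 0 1] S := by
  rw [sdiff_eq, nhdsWithin_inter_of_mem']
  exact nhdsWithin_le_nhds ((finite_range X).isClosed.isOpen_compl.mem_nhds hS.2)

theorem continuousOn_contourDeriv_sigma₂ (hA : DerivCondition σ X β) :
    ContinuousOn (contourDeriv (sigma₂ σ)) (sphere 0 1 \ range X) := by
  have h : ContinuousOn (fun T => (contourDeriv σ T + starRingEnd ℂ (contourDeriv σ T) / T ^ 2) /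
      (2 * Complex.I)) (sphere 0 1 \ range X) := by
    refine (hA.continuousOn.add (ContinuousOn.div ?_ (by fun_prop) ?_)).div_const _
    · exact Complex.continuous_conj.comp_continuousOn hA.continuousOn
    · rintro T hT h0
      have : T = 0 := by simpa using h0
      rw [this] at hT
      simp at hT
  exact h.congr fun T hT => contourDeriv_sigma₂ hA hT

theorem norm_contourDeriv_sigma₂_le (hA : DerivCondition σ X β) {S : ℂ}
    (hS : S ∈ sphere (0 : ℂ) 1 \ range X) :
    ‖contourDeriv (sigma₂ σ) S‖ ≤ ‖contourDeriv σ S‖ := by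
  have hSn : ‖S‖ = 1 := by simpa using hS.1
  rw [contourDeriv_sigma₂ hA hS, norm_div, norm_mul, Complex.norm_I, mul_one, Complex.norm_ofNat,
    div_le_iff₀ (by norm_num)]
  refine (norm_add_le _ _).trans ?_
  rw [norm_div, norm_pow, hSn, Complex.norm_conj, one_pow, div_one]
  linarith

theorem norm_sigma₂_sub_le (S Z : ℂ) : ‖sigma₂ σ S - sigma₂ σ Z‖ ≤ ‖σ S - σ Z‖ := by
  have : sigma₂ σ S - sigma₂ σ Z = ((σ S - σ Z).im : ℂ) := by simp [sigma₂]
  rw [this, Complex.norm_real]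
  exact Complex.abs_im_le_norm _

theorem sub_ne_zero_of_ne (hσ : IsConformalOnto σ D) (hD : IsOpen D) {S Z : ℂ}
    (hS : S ∈ closedBall (0 : ℂ) 1) (hZ : Z ∈ closedBall (0 : ℂ) 1) (h : S ≠ Z) :
    σ S - σ Z ≠ 0 :=
  sub_ne_zero.2 fun h' => h (hσ.injOn_closedBall hD hS hZ h')

theorem exists_kernel_bound (hσ : IsConformalOnto σ D) (hD : IsOpen D)
    (hA : DerivCondition σ X β) {r : ℝ} (hr : 0 < r) :
    ∃ C, ∀ Z ∈ closedBall (0 : ℂ) 1, ∀ S ∈ sphere (0 : ℂ) 1 \ range X, r ≤ ‖S - Z‖ →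
      ‖kerK σ S Z‖ ≤ C * (1 + ‖contourDeriv σ S‖) ∧
      ‖kerL σ S Z‖ ≤ C * (1 + ‖contourDeriv σ S‖) := by
  obtain ⟨c, hc, hlow⟩ := hσ.exists_le_norm_sub hD hr
  refine ⟨1 / r + 2 / c, fun Z hZ S hS hSZ => ?_⟩
  have hq := hlow S (sphere_subset_closedBall hS.1) Z hZ hSZ
  have hq0 : 0 < ‖σ S - σ Z‖ := hc.trans_le hq
  set A := ‖contourDeriv σ S‖
  have hA0 : 0 ≤ A := norm_nonneg _
  have e1 : A / ‖σ S - σ Z‖ ≤ A / c := div_le_div_of_nonneg_left hA0 hc hq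
  have e3 : (1 / r + 2 / c) * (1 + A) = 1 / r + 2 * (A / c) + (A / r + 2 / c) := by ring
  have e4 : 0 ≤ A / r + 2 / c := by positivity
  have e5 : 0 ≤ A / c := by positivity
  have e6 : 0 ≤ 1 / r := by positivity
  constructor
  · refine (norm_sub_le _ _).trans ?_
    rw [norm_div, norm_div, norm_one]
    have e2 : 1 / ‖S - Z‖ ≤ 1 / r := one_div_le_one_div_of_le hr hSZ
    linarith
  · refine (norm_sub_le _ _).trans ?_
    rw [norm_div, norm_div, norm_mul, norm_pow]
    have e2 : ‖contourDeriv (sigma₂ σ) S‖ / ‖σ S - σ Z‖ ≤ A / ‖σ S - σ Z‖ :=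
      div_le_div_of_nonneg_right (norm_contourDeriv_sigma₂_le hA hS) hq0.le
    have e7 : A * ‖sigma₂ σ S - sigma₂ σ Z‖ / ‖σ S - σ Z‖ ^ 2 ≤ A / ‖σ S - σ Z‖ := by
      calc _ ≤ A * ‖σ S - σ Z‖ / ‖σ S - σ Z‖ ^ 2 := by
            gcongr; exact norm_sigma₂_sub_le S Z
        _ = _ := by field_simp
    linarith

section limits

variable {S₀ Z₁ : ℂ}

theorem tendsto_comp_fst {f : ℂ → ℂ} (hf : ContinuousOn f (sphere 0 1 \ range X))
    (hS₀ : S₀ ∈ sphere (0 : ℂ) 1 \ range X) :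
    Tendsto (fun p : ℂ × ℂ => f p.1) (𝓝[sphere 0 1] S₀ ×ˢ 𝓝[closedBall 0 1] Z₁) (𝓝 (f S₀)) := by
  have := hf S₀ hS₀
  rw [ContinuousWithinAt, nhdsWithin_sphere_sdiff hS₀] at this
  exact this.comp tendsto_fst

theorem tendsto_comp_snd {f : ℂ → ℂ} (hf : ContinuousOn f (closedBall 0 1))
    (hZ₁ : Z₁ ∈ closedBall (0 : ℂ) 1) :
    Tendsto (fun p : ℂ × ℂ => f p.2) (𝓝[sphere 0 1] S₀ ×ˢ 𝓝[closedBall 0 1] Z₁) (𝓝 (f Z₁)) :=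
  (hf Z₁ hZ₁).tendsto.comp tendsto_snd

theorem tendsto_fst_sub_snd :
    Tendsto (fun p : ℂ × ℂ => p.1 - p.2) (𝓝[sphere 0 1] S₀ ×ˢ 𝓝[closedBall 0 1] Z₁)
      (𝓝 (S₀ - Z₁)) :=
  ((tendsto_id'.2 nhdsWithin_le_nhds).comp tendsto_fst).sub
    ((tendsto_id'.2 nhdsWithin_le_nhds).comp tendsto_snd)

theorem continuousOn_sigma₂ (hσ : IsConformalOnto σ D) :
    ContinuousOn (sigma₂ σ) (closedBall 0 1) :=
  (Complex.continuous_ofReal.comp Complex.continuous_im).comp_continuousOn hσ.continuousOn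

theorem sphere_sdiff_subset : sphere (0 : ℂ) 1 \ range X ⊆ closedBall 0 1 :=
  sdiff_subset.trans sphere_subset_closedBall

theorem tendsto_kerK (hσ : IsConformalOnto σ D) (hD : IsOpen D) (hA : DerivCondition σ X β)
    (hS₀ : S₀ ∈ sphere (0 : ℂ) 1 \ range X) (hZ₁ : Z₁ ∈ closedBall (0 : ℂ) 1) (hne : S₀ ≠ Z₁) :
    Tendsto (fun p : ℂ × ℂ => kerK σ p.1 p.2) (𝓝[sphere 0 1] S₀ ×ˢ 𝓝[closedBall 0 1] Z₁)
      (𝓝 (kerK σ S₀ Z₁)) := by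
  have hq := (tendsto_comp_fst (hσ.continuousOn.mono sphere_sdiff_subset) hS₀).sub
    (tendsto_comp_snd (S₀ := S₀) hσ.continuousOn hZ₁)
  exact ((tendsto_comp_fst hA.continuousOn hS₀).div hq
    (sub_ne_zero_of_ne hσ hD (sphere_subset_closedBall hS₀.1) hZ₁ hne)).sub
    (tendsto_const_nhds.div tendsto_fst_sub_snd (sub_ne_zero.2 hne))

theorem tendsto_kerL (hσ : IsConformalOnto σ D) (hD : IsOpen D) (hA : DerivCondition σ X β)
    (hS₀ : S₀ ∈ sphere (0 : ℂ) 1 \ range X) (hZ₁ : Z₁ ∈ closedBall (0 : ℂ) 1) (hne : S₀ ≠ Z₁) :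
    Tendsto (fun p : ℂ × ℂ => kerL σ p.1 p.2) (𝓝[sphere 0 1] S₀ ×ˢ 𝓝[closedBall 0 1] Z₁)
      (𝓝 (kerL σ S₀ Z₁)) := by
  have hq := (tendsto_comp_fst (hσ.continuousOn.mono sphere_sdiff_subset) hS₀).sub
    (tendsto_comp_snd (S₀ := S₀) hσ.continuousOn hZ₁)
  have hq₂ := (tendsto_comp_fst ((continuousOn_sigma₂ hσ).mono sphere_sdiff_subset) hS₀).sub
    (tendsto_comp_snd (S₀ := S₀) (continuousOn_sigma₂ hσ) hZ₁)
  have hne' := sub_ne_zero_of_ne hσ hD (sphere_subset_closedBall hS₀.1) hZ₁ hne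
  exact ((tendsto_comp_fst (continuousOn_contourDeriv_sigma₂ hA) hS₀).div hq hne').sub
    (((tendsto_comp_fst hA.continuousOn hS₀).mul hq₂).div (hq.pow 2) (pow_ne_zero 2 hne'))

theorem tendsto_contourDeriv_radialProj (hA : DerivCondition σ X β)
    (hZ₁ : Z₁ ∈ sphere (0 : ℂ) 1 \ range X) :
    Tendsto (fun Z => contourDeriv σ (radialProj Z)) (𝓝 Z₁) (𝓝 (contourDeriv σ Z₁)) := by
  have hn : ‖Z₁‖ = 1 := by simpa using hZ₁.1
  have h0 : Z₁ ≠ 0 := by rintro rfl; simp at hn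
  have h1 := hA.continuousOn Z₁ hZ₁
  rw [ContinuousWithinAt, nhdsWithin_sphere_sdiff hZ₁] at h1
  refine h1.comp (tendsto_nhdsWithin_iff.2 ⟨?_, ?_⟩)
  · have := (continuousAt_radialProj h0).tendsto
    rwa [radialProj_of_norm_eq_one hn] at this
  · filter_upwards [isOpen_ne.mem_nhds h0] with Z hZ
    simpa using norm_radialProj hZ

theorem tendsto_kerN (hA : DerivCondition σ X β)
    (hS₀ : S₀ ∈ sphere (0 : ℂ) 1 \ range X) (hZ₁ : Z₁ ∈ sphere (0 : ℂ) 1 \ range X)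
    (hne : S₀ ≠ Z₁) :
    Tendsto (fun p : ℂ × ℂ => kerN σ p.1 p.2) (𝓝[sphere 0 1] S₀ ×ˢ 𝓝[closedBall 0 1] Z₁)
      (𝓝 (kerN σ S₀ Z₁)) := by
  have hn : ‖Z₁‖ = 1 := by simpa using hZ₁.1
  have hS0 : S₀ ≠ 0 := by rintro rfl; simp at hS₀
  have hp : Tendsto (fun p : ℂ × ℂ => contourDeriv σ (radialProj p.2))
      (𝓝[sphere 0 1] S₀ ×ˢ 𝓝[closedBall 0 1] Z₁) (𝓝 (contourDeriv σ (radialProj Z₁))) := by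
    rw [radialProj_of_norm_eq_one hn]
    exact ((tendsto_contourDeriv_radialProj hA hZ₁).mono_left nhdsWithin_le_nhds).comp tendsto_snd
  have hp0 : contourDeriv σ (radialProj Z₁) ≠ 0 := by
    rw [radialProj_of_norm_eq_one hn]; exact hA.ne_zero Z₁ hZ₁
  have h1 : Tendsto (fun p : ℂ × ℂ => p.1) (𝓝[sphere 0 1] S₀ ×ˢ 𝓝[closedBall 0 1] Z₁) (𝓝 S₀) :=
    (tendsto_id'.2 nhdsWithin_le_nhds).comp tendsto_fst
  have h2 : Tendsto (fun p : ℂ × ℂ => p.2) (𝓝[sphere 0 1] S₀ ×ˢ 𝓝[closedBall 0 1] Z₁) (𝓝 Z₁) :=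
    (tendsto_id'.2 nhdsWithin_le_nhds).comp tendsto_snd
  refine Tendsto.mul (Tendsto.div ?_ (hp.const_mul _) (mul_ne_zero Complex.I_ne_zero hp0))
    (Tendsto.div ?_ (h1.mul ((h1.sub h2).pow 2))
      (mul_ne_zero hS0 (pow_ne_zero 2 (sub_ne_zero.2 hne))))
  · exact (Complex.continuous_conj.tendsto _).comp hp
  · exact (Complex.continuous_ofReal.tendsto _).comp (tendsto_const_nhds.sub h2.norm)

theorem continuousOn_slice {k : ℂ → ℂ → ℂ} {s : Set ℂ} {Z : ℂ} (hs : s ⊆ sphere 0 1)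
    (hZ : Z ∈ closedBall (0 : ℂ) 1)
    (h : ∀ S ∈ s, Tendsto (fun p : ℂ × ℂ => k p.1 p.2)
      (𝓝[sphere 0 1] S ×ˢ 𝓝[closedBall 0 1] Z) (𝓝 (k S Z))) :
    ContinuousOn (fun S => k S Z) s := by
  intro S hS
  have h1 : Tendsto (fun S => (S, Z)) (𝓝[s] S) (𝓝[sphere 0 1] S ×ˢ 𝓝[closedBall 0 1] Z) :=
    (tendsto_id'.2 (nhdsWithin_mono _ hs)).prodMk
      (tendsto_nhdsWithin_iff.2 ⟨tendsto_const_nhds, Eventually.of_forall fun _ => hZ⟩)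
  exact (h S hS).comp h1

end limits

theorem circleIntegrable_mul_of_le (hX : (range X).Finite) {f : ℂ → ℝ}
    (hf : ContinuousOn f (sphere 0 1 \ range X)) (hfi : CircleIntegrable f 0 1)
    (hfσ : CircleIntegrable (fun S => |f S| * ‖contourDeriv σ S‖) 0 1) {k : ℂ → ℂ} {C : ℝ}
    (hk : ContinuousOn k (sphere 0 1 \ range X))
    (hkC : ∀ S ∈ sphere (0 : ℂ) 1 \ range X, ‖k S‖ ≤ C * (1 + ‖contourDeriv σ S‖)) :
    CircleIntegrable (fun S => (f S : ℂ) * k S) 0 1 := by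
  refine circleIntegrable_of_continuousOn_of_le hX
    ((Complex.continuous_ofReal.comp_continuousOn hf).mul hk)
    (circleIntegrable_const_mul (hfi.abs.add hfσ) C) fun S hS => ?_
  have := mul_le_mul_of_nonneg_left (hkC S hS) (abs_nonneg (f S))
  rw [norm_mul, Complex.norm_real, Real.norm_eq_abs]
  refine this.trans (le_of_eq ?_)
  simp only [Pi.add_apply, Pi.abs_apply]
  ring

/-- Combines a density bounded near `Z₀` with a kernel dominated in the angle there; away from `Z`
the kernel grows at most like `1 + |σ'|`, which the density tolerates. Slices omit `Z` because the
diagonal is met when `Z` lies on the circle. -/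
theorem tendsto_circleIntegral_kernel {f : ℂ → ℝ}
    (hf : ContinuousOn f (sphere 0 1 \ range X)) (hfi : CircleIntegrable f 0 1)
    (hfσ : CircleIntegrable (fun S => |f S| * ‖contourDeriv σ S‖) 0 1)
    {Z₀ : ℂ} (hZ₀ : Z₀ ∈ sphere (0 : ℂ) 1 \ range X) {k : ℂ → ℂ → ℂ}
    (hslice : ∀ᶠ Z in 𝓝[closedBall 0 1] Z₀,
      ContinuousOn (fun S => k S Z) (sphere 0 1 \ (range X ∪ {Z})))
    (hfar : ∀ r > 0, ∃ C, ∀ᶠ Z in 𝓝[closedBall 0 1] Z₀, ∀ S ∈ sphere (0 : ℂ) 1 \ range X,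
      r ≤ ‖S - Z‖ → ‖k S Z‖ ≤ C * (1 + ‖contourDeriv σ S‖))
    (hnear : ∃ r > 0, ∃ g : ℝ → ℝ, IntervalIntegrable g volume (-Real.pi) Real.pi ∧
      ∀ᶠ Z in 𝓝[closedBall 0 1] Z₀, ∀ θ ∈ Icc (-Real.pi) Real.pi, θ ≠ 0 → |θ| ≤ r →
        ‖k (radialProj Z * circleMap 0 1 θ) Z‖ ≤ g θ)
    (hcont : ∀ S₀ ∈ sphere (0 : ℂ) 1 \ range X, S₀ ≠ Z₀ →
      Tendsto (fun p : ℂ × ℂ => k p.1 p.2) (𝓝[sphere 0 1] S₀ ×ˢ 𝓝[closedBall 0 1] Z₀)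
        (𝓝 (k S₀ Z₀))) :
    (∀ᶠ Z in 𝓝[closedBall 0 1] Z₀, CircleIntegrable (fun S => (f S : ℂ) * k S Z) 0 1) ∧
      Tendsto (fun Z => ∮ S in C(0, 1), (f S : ℂ) * k S Z) (𝓝[closedBall 0 1] Z₀)
        (𝓝 (∮ S in C(0, 1), (f S : ℂ) * k S Z₀)) := by
  have hn : ‖Z₀‖ = 1 := by simpa using hZ₀.1
  have h0 : Z₀ ≠ 0 := by rintro rfl; simp at hn
  have hfC : ContinuousOn (fun S => (f S : ℂ)) (sphere 0 1 \ range X) :=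
    Complex.continuous_ofReal.comp_continuousOn hf
  have hrp : Tendsto radialProj (𝓝[closedBall 0 1] Z₀) (𝓝 Z₀) := by
    have := (continuousAt_radialProj h0).tendsto.mono_left
      (nhdsWithin_le_nhds (s := closedBall (0 : ℂ) 1))
    rwa [radialProj_of_norm_eq_one hn] at this
  have hid : Tendsto (fun Z : ℂ => Z) (𝓝[closedBall 0 1] Z₀) (𝓝 Z₀) :=
    tendsto_id'.2 nhdsWithin_le_nhds
  refine tendsto_circleIntegral_of_near_far hn (finite_range X).countable ?_ ?_ ?_ ?_
  · filter_upwards [hslice] with Z hZ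
    refine aestronglyMeasurable_comp_circleMap (B := range X ∪ {Z})
      ((finite_range X).union (finite_singleton Z))
      (f := fun S => (f S : ℂ) * k S Z) ((hfC.mono ?_).mul hZ)
    exact sdiff_subset_sdiff_right subset_union_left
  · intro r hr
    obtain ⟨C, hC⟩ := hfar (r / 2) (by positivity)
    refine ⟨fun S => C * (|f S| + |f S| * ‖contourDeriv σ S‖),
      circleIntegrable_const_mul (hfi.abs.add hfσ) C, ?_⟩
    have hclose : ∀ᶠ Z in 𝓝[closedBall 0 1] Z₀, ‖radialProj Z - Z‖ < r / 2 := by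
      have := (hrp.sub hid).norm
      rw [sub_self, norm_zero] at this
      exact this.eventually_lt_const (by positivity)
    filter_upwards [hC, hclose] with Z hZ hZr S hS hSr
    have h1 : r / 2 ≤ ‖S - Z‖ := by
      have := norm_sub_le_norm_sub_add_norm_sub S Z (radialProj Z)
      rw [norm_sub_rev Z] at this
      linarith
    have := mul_le_mul_of_nonneg_left (hZ S hS h1) (abs_nonneg (f S))
    rw [norm_mul, Complex.norm_real, Real.norm_eq_abs]
    refine this.trans (le_of_eq ?_)
    ring
  · obtain ⟨r, hr, g, hg, hgk⟩ := hnear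
    have h1 : ∀ᶠ S in 𝓝[sphere 0 1] Z₀, |f S| < |f Z₀| + 1 := by
      have := (hf Z₀ hZ₀).tendsto.abs
      rw [nhdsWithin_sphere_sdiff hZ₀] at this
      exact this.eventually_lt_const (by linarith)
    obtain ⟨ε, hε, h2⟩ := Metric.mem_nhdsWithin_iff.1 h1
    refine ⟨min r (ε / 2), by positivity, fun θ => (|f Z₀| + 1) * g θ, hg.const_mul _, ?_⟩
    have hclose : ∀ᶠ Z in 𝓝[closedBall 0 1] Z₀, ‖radialProj Z - Z₀‖ < ε / 2 := by
      have := (hrp.sub_const Z₀).norm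
      rw [sub_self, norm_zero] at this
      exact this.eventually_lt_const (by positivity)
    have hne : ∀ᶠ Z in 𝓝[closedBall 0 1] Z₀, Z ≠ 0 :=
      Eventually.filter_mono nhdsWithin_le_nhds (isOpen_ne.mem_nhds h0)
    filter_upwards [hgk, hclose, hne] with Z hZ hZε hZ0 θ hθ hθ0 hθr
    have hT := norm_radialProj hZ0
    have h3 := hZ θ hθ hθ0 (hθr.trans (min_le_left _ _))
    have h4 : |f (radialProj Z * circleMap 0 1 θ)| ≤ |f Z₀| + 1 := by
      refine le_of_lt (h2 ⟨?_, by simp [hT]⟩)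
      rw [mem_ball, dist_eq_norm]
      have e1 := norm_sub_le_norm_sub_add_norm_sub (radialProj Z * circleMap 0 1 θ)
        (radialProj Z) Z₀
      have e2 := norm_circleMap_sub_one_le θ
      rw [← norm_mul_circleMap_sub hT] at e2
      have e3 := hθr.trans (min_le_right _ _)
      linarith
    rw [norm_mul, Complex.norm_real, Real.norm_eq_abs]
    exact mul_le_mul h4 h3 (norm_nonneg _) (by positivity)
  · intro S₀ hS₀ hne
    exact (tendsto_comp_fst hfC hS₀).mul (hcont S₀ hS₀ hne)

end kernels

/-! ### Boundary limits of the kernel integrals. -/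

section boundary

variable {σ : ℂ → ℂ} {D : Set ℂ} {m : ℕ} {X : Fin m → ℂ} {β : Fin m → ℝ} {f g : ℂ → ℝ} {Z₀ : ℂ}

theorem norm_kerN_le {S Z : ℂ} (hS : ‖S‖ = 1) (hZ : ‖Z‖ ≤ 1) {r : ℝ} (hr : 0 < r)
    (h : r ≤ ‖S - Z‖) : ‖kerN σ S Z‖ ≤ 1 / r ^ 2 := by
  have h1 : ‖starRingEnd ℂ (contourDeriv σ (radialProj Z)) /
      (Complex.I * contourDeriv σ (radialProj Z))‖ ≤ 1 := by
    rw [norm_div, norm_mul, Complex.norm_I, one_mul, Complex.norm_conj]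
    exact div_self_le_one _
  have h2 : ‖((1 - ‖Z‖ : ℝ) : ℂ) / (S * (S - Z) ^ 2)‖ ≤ 1 / r ^ 2 := by
    rw [norm_div, norm_mul, norm_pow, hS, one_mul, Complex.norm_real, Real.norm_eq_abs,
      abs_of_nonneg (by linarith)]
    have := norm_nonneg Z
    gcongr
    linarith
  rw [kerN, norm_mul]
  calc _ ≤ 1 * (1 / r ^ 2) := mul_le_mul h1 h2 (norm_nonneg _) zero_le_one
    _ = _ := one_mul _

theorem eventually_mem_closedBall_norm_sub_le {ρ : ℝ} (hρ : 0 < ρ) :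
    ∀ᶠ Z in 𝓝[closedBall (0 : ℂ) 1] Z₀, Z ∈ closedBall (0 : ℂ) 1 ∧ ‖Z - Z₀‖ ≤ ρ := by
  refine eventually_mem_nhdsWithin.and (Eventually.filter_mono nhdsWithin_le_nhds ?_)
  filter_upwards [Metric.closedBall_mem_nhds Z₀ hρ] with Z hZ
  simpa [dist_eq_norm] using hZ

theorem kerN_eq_zero {S Z : ℂ} (hZ : ‖Z‖ = 1) : kerN σ S Z = 0 := by simp [kerN, hZ]

theorem tendsto_circleIntegral_kerK (hσ : IsConformalOnto σ D) (hD : IsOpen D) (hm : 0 < m)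
    (hXΓ : ∀ j, ‖X j‖ = 1) (hA : DerivCondition σ X β) (hB : LocalCondition σ X β)
    (hf : ContinuousOn f (sphere 0 1 \ range X)) (hfi : CircleIntegrable f 0 1)
    (hfσ : CircleIntegrable (fun S => |f S| * ‖contourDeriv σ S‖) 0 1)
    (hZ₀ : Z₀ ∈ sphere (0 : ℂ) 1 \ range X) :
    (∀ᶠ Z in 𝓝[closedBall 0 1] Z₀, CircleIntegrable (fun S => (f S : ℂ) * kerK σ S Z) 0 1) ∧
      Tendsto (fun Z => ∮ S in C(0, 1), (f S : ℂ) * kerK σ S Z) (𝓝[closedBall 0 1] Z₀)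
        (𝓝 (∮ S in C(0, 1), (f S : ℂ) * kerK σ S Z₀)) := by
  refine tendsto_circleIntegral_kernel hf hfi hfσ hZ₀ ?_ ?_ ?_ ?_
  · filter_upwards [eventually_mem_nhdsWithin] with Z hZ
    refine continuousOn_slice (sdiff_subset) hZ fun S hS => ?_
    rw [Set.mem_sdiff, mem_union, not_or] at hS
    exact tendsto_kerK hσ hD hA ⟨hS.1, hS.2.1⟩ hZ hS.2.2
  · intro r hr
    obtain ⟨C, hC⟩ := exists_kernel_bound hσ hD hA hr
    refine ⟨C, ?_⟩
    filter_upwards [eventually_mem_nhdsWithin] with Z hZ S hS h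
    exact (hC Z hZ S hS h).1
  · obtain ⟨ρ, hρ, c, hc, g, hg, hest⟩ := exists_chord_estimate hσ hm hXΓ hA hB hZ₀
    refine ⟨ρ, hρ, fun θ => 4 * g θ / c, (hg.const_mul 4).div_const c, ?_⟩
    filter_upwards [eventually_mem_closedBall_norm_sub_le hρ] with Z hZ θ hθ hθ0 hθρ
    obtain ⟨-, hpc, h⟩ := hest Z hZ.1 hZ.2
    obtain ⟨-, hw, hg0, h1, h2, h3⟩ := h θ hθ hθ0 hθρ _ rfl
    have hp : contourDeriv σ (radialProj Z) ≠ 0 := norm_pos_iff.1 (hc.trans_le hpc)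
    refine (norm_div_sub_inv_le hp hw h1 h2 h3).trans ?_
    gcongr
  · exact fun S₀ hS₀ hne => tendsto_kerK hσ hD hA hS₀ (sphere_subset_closedBall hZ₀.1) hne

theorem sigma₂_sub_eq (S Z : ℂ) : sigma₂ σ S - sigma₂ σ Z =
    (σ S - σ Z - starRingEnd ℂ (σ S - σ Z)) / (2 * Complex.I) := by
  rw [Complex.sub_conj]
  simp only [sigma₂, Complex.sub_im]
  push_cast
  field_simp

theorem tendsto_circleIntegral_kerL_sub_kerN (hσ : IsConformalOnto σ D) (hD : IsOpen D)
    (hm : 0 < m) (hXΓ : ∀ j, ‖X j‖ = 1) (hA : DerivCondition σ X β) (hB : LocalCondition σ X β)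
    (hf : ContinuousOn f (sphere 0 1 \ range X)) (hfi : CircleIntegrable f 0 1)
    (hfσ : CircleIntegrable (fun S => |f S| * ‖contourDeriv σ S‖) 0 1)
    (hZ₀ : Z₀ ∈ sphere (0 : ℂ) 1 \ range X) :
    (∀ᶠ Z in 𝓝[closedBall 0 1] Z₀,
      CircleIntegrable (fun S => (f S : ℂ) * (kerL σ S Z - kerN σ S Z)) 0 1) ∧
      Tendsto (fun Z => ∮ S in C(0, 1), (f S : ℂ) * (kerL σ S Z - kerN σ S Z))
        (𝓝[closedBall 0 1] Z₀)
        (𝓝 (∮ S in C(0, 1), (f S : ℂ) * (kerL σ S Z₀ - kerN σ S Z₀))) := by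
  refine tendsto_circleIntegral_kernel (k := fun S Z => kerL σ S Z - kerN σ S Z)
    hf hfi hfσ hZ₀ ?_ ?_ ?_ ?_
  · filter_upwards [eventually_mem_nhdsWithin] with Z hZ
    refine ContinuousOn.sub (continuousOn_slice (sdiff_subset) hZ fun S hS => ?_) ?_
    · rw [Set.mem_sdiff, mem_union, not_or] at hS
      exact tendsto_kerL hσ hD hA ⟨hS.1, hS.2.1⟩ hZ hS.2.2
    · refine continuousOn_const.mul (continuousOn_const.div (by fun_prop) fun S hS => ?_)
      rw [Set.mem_sdiff, mem_union, not_or] at hS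
      have hS0 : S ≠ 0 := by rintro rfl; simp at hS
      exact mul_ne_zero hS0 (pow_ne_zero 2 (sub_ne_zero.2 hS.2.2))
  · intro r hr
    obtain ⟨C, hC⟩ := exists_kernel_bound hσ hD hA hr
    refine ⟨C + 1 / r ^ 2, ?_⟩
    filter_upwards [eventually_mem_nhdsWithin] with Z hZ S hS h
    have h1 := (hC Z hZ S hS h).2
    have h2 := norm_kerN_le (σ := σ) (by simpa using hS.1) (by simpa using hZ) hr h
    have h3 : 0 ≤ 1 / r ^ 2 * ‖contourDeriv σ S‖ := by positivity
    refine (norm_sub_le _ _).trans ?_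
    rw [add_mul]
    linarith
  · obtain ⟨ρ, hρ, c, hc, g, hg, hest⟩ := exists_chord_estimate hσ hm hXΓ hA hB hZ₀
    refine ⟨ρ, hρ, fun θ => 6 * g θ / c + 2,
      ((hg.const_mul 6).div_const c).add intervalIntegrable_const, ?_⟩
    filter_upwards [eventually_mem_closedBall_norm_sub_le hρ] with Z hZ θ hθ hθ0 hθρ
    obtain ⟨hZ0, hpc, h⟩ := hest Z hZ.1 hZ.2
    obtain ⟨hSX, hw, hg0, h1, h2, h3⟩ := h θ hθ hθ0 hθρ _ rfl
    have hp : contourDeriv σ (radialProj Z) ≠ 0 := norm_pos_iff.1 (hc.trans_le hpc)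
    have hT := norm_radialProj hZ0
    have hS := norm_mul_circleMap hT θ
    have hZn : ‖Z‖ ≤ 1 := by simpa using hZ.1
    have key := norm_kernel_sub_le (r := ‖Z‖) (T := radialProj Z)
      (S := radialProj Z * circleMap 0 1 θ) (q := σ (radialProj Z * circleMap 0 1 θ) - σ Z)
      (a := contourDeriv σ (radialProj Z * circleMap 0 1 θ)) (G := g θ)
      hp hS hT (norm_nonneg Z) hZn
    simp only [norm_mul_radialProj] at key
    have := key hw h1 h2 h3
    rw [kerL, kerN, contourDeriv_sigma₂ hA ⟨by simpa using hS, hSX⟩, sigma₂_sub_eq]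
    refine this.trans ?_
    gcongr
  · exact fun S₀ hS₀ hne => (tendsto_kerL hσ hD hA hS₀ (sphere_subset_closedBall hZ₀.1) hne).sub
      (tendsto_kerN hA hS₀ hZ₀ hne)

/-- The unimodular coefficient of `kerN` has a limit at `Z₀` as `σ'(Z₀) ≠ 0`; the remaining
integral, with density `f(S)/S`, tends to zero. -/
theorem tendsto_circleIntegral_kerN (hA : DerivCondition σ X β)
    (hf : ContinuousOn f (sphere 0 1 \ range X)) (hfi : CircleIntegrable f 0 1)
    (hZ₀ : Z₀ ∈ sphere (0 : ℂ) 1 \ range X) :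
    Tendsto (fun Z => ∮ S in C(0, 1), (f S : ℂ) * kerN σ S Z) (𝓝[ball 0 1] Z₀) (𝓝 0) := by
  have hn : ‖Z₀‖ = 1 := by simpa using hZ₀.1
  have h0 : Z₀ ≠ 0 := by rintro rfl; simp at hn
  have hinv : ContinuousOn (fun S : ℂ => S⁻¹) (sphere 0 |1|) := by
    refine continuousOn_inv₀.mono fun S hS => ?_
    rintro rfl; simp at hS
  have hg : CircleIntegrable (fun S => (f S : ℂ) * S⁻¹) 0 1 :=
    (circleIntegrable_ofReal hfi).mul_continuousOn hinv
  have hgc : ContinuousWithinAt (fun S => (f S : ℂ) * S⁻¹) (sphere 0 1) Z₀ := by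
    rw [ContinuousWithinAt, ← nhdsWithin_sphere_sdiff hZ₀]
    exact ((Complex.continuous_ofReal.tendsto _).comp (hf Z₀ hZ₀)).mul
      ((continuousAt_inv₀ h0).tendsto.mono_left nhdsWithin_le_nhds)
  have h1 := tendsto_circleIntegral_mul_sq_sub hg hn hgc
  have hp := (tendsto_contourDeriv_radialProj hA hZ₀).mono_left
    (nhdsWithin_le_nhds (s := ball (0 : ℂ) 1))
  have h2 : Tendsto (fun Z => starRingEnd ℂ (contourDeriv σ (radialProj Z)) /
      (Complex.I * contourDeriv σ (radialProj Z))) (𝓝[ball 0 1] Z₀)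
      (𝓝 (starRingEnd ℂ (contourDeriv σ Z₀) / (Complex.I * contourDeriv σ Z₀))) :=
    ((Complex.continuous_conj.tendsto _).comp hp).div (hp.const_mul _)
      (mul_ne_zero Complex.I_ne_zero (hA.ne_zero Z₀ hZ₀))
  have h3 := h2.mul h1
  rw [mul_zero] at h3
  refine h3.congr fun Z => ?_
  rw [← circleIntegral.integral_const_mul]
  congr 1; ext S
  rw [kerN, div_mul_eq_div_div _ S, div_eq_mul_inv _ S, div_eq_mul_inv, div_eq_mul_inv _ ((S - Z) ^ 2)]
  ring

theorem circleIntegrable_kernels (hσ : IsConformalOnto σ D) (hD : IsOpen D)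
    (hA : DerivCondition σ X β)
    (hf : ContinuousOn f (sphere 0 1 \ range X)) (hfi : CircleIntegrable f 0 1)
    (hfσ : CircleIntegrable (fun S => |f S| * ‖contourDeriv σ S‖) 0 1)
    {Z : ℂ} (hZ : Z ∈ ball (0 : ℂ) 1) :
    CircleIntegrable (fun S => (f S : ℂ) * kerK σ S Z) 0 1 ∧
      CircleIntegrable (fun S => (f S : ℂ) * kerL σ S Z) 0 1 := by
  have hZn : ‖Z‖ < 1 := by simpa using hZ
  have hZc := ball_subset_closedBall hZ
  obtain ⟨C, hC⟩ := exists_kernel_bound hσ hD hA (show 0 < 1 - ‖Z‖ by linarith)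
  have hr : ∀ S ∈ sphere (0 : ℂ) 1 \ range X, 1 - ‖Z‖ ≤ ‖S - Z‖ := fun S hS => by
    have := norm_sub_norm_le S Z
    rwa [show ‖S‖ = 1 by simpa using hS.1] at this
  have hne : ∀ S ∈ sphere (0 : ℂ) 1 \ range X, S ≠ Z := fun S hS => by
    have := hr S hS
    rintro rfl
    rw [sub_self, norm_zero] at this
    linarith
  exact ⟨circleIntegrable_mul_of_le (finite_range X) hf hfi hfσ
      (continuousOn_slice sdiff_subset hZc fun S hS => tendsto_kerK hσ hD hA hS hZc (hne S hS))
      fun S hS => (hC Z hZc S hS (hr S hS)).1,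
    circleIntegrable_mul_of_le (finite_range X) hf hfi hfσ
      (continuousOn_slice sdiff_subset hZc fun S hS => tendsto_kerL hσ hD hA hS hZc (hne S hS))
      fun S hS => (hC Z hZc S hS (hr S hS)).2⟩

/-- `L = (L - N) + N`, where `N` is zero at `Z₀` and contributes nothing in the limit from inside.
-/
theorem tendsto_circleIntegral_kerL (hσ : IsConformalOnto σ D) (hD : IsOpen D)
    (hm : 0 < m) (hXΓ : ∀ j, ‖X j‖ = 1) (hA : DerivCondition σ X β) (hB : LocalCondition σ X β)
    (hf : ContinuousOn f (sphere 0 1 \ range X)) (hfi : CircleIntegrable f 0 1)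
    (hfσ : CircleIntegrable (fun S => |f S| * ‖contourDeriv σ S‖) 0 1)
    (hZ₀ : Z₀ ∈ sphere (0 : ℂ) 1 \ range X) :
    CircleIntegrable (fun S => (f S : ℂ) * kerL σ S Z₀) 0 1 ∧
      Tendsto (fun Z => ∮ S in C(0, 1), (f S : ℂ) * kerL σ S Z) (𝓝[ball 0 1] Z₀)
        (𝓝 (∮ S in C(0, 1), (f S : ℂ) * kerL σ S Z₀)) := by
  have hn : ‖Z₀‖ = 1 := by simpa using hZ₀.1
  obtain ⟨h1, h2⟩ := tendsto_circleIntegral_kerL_sub_kerN hσ hD hm hXΓ hA hB hf hfi hfσ hZ₀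
  have h3 := h1.self_of_nhdsWithin (sphere_subset_closedBall hZ₀.1)
  simp only [kerN_eq_zero hn, sub_zero] at h2 h3
  refine ⟨h3, ?_⟩
  have h4 := (h2.mono_left (nhdsWithin_mono Z₀ ball_subset_closedBall)).add
    (tendsto_circleIntegral_kerN hA hf hfi hZ₀)
  rw [add_zero] at h4
  refine h4.congr' ?_
  filter_upwards [self_mem_nhdsWithin,
    h1.filter_mono (nhdsWithin_mono Z₀ ball_subset_closedBall)] with Z hZ hi
  have hiL := (circleIntegrable_kernels hσ hD hA hf hfi hfσ hZ).2
  have hiN : CircleIntegrable (fun S => (f S : ℂ) * kerN σ S Z) 0 1 := by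
    have := hiL.sub hi
    refine this.congr fun θ _ => ?_
    simp only [Pi.sub_apply]
    ring
  rw [← circleIntegral.integral_add hi hiN]
  congr 1; ext S
  ring

/-- The density `(f K + s f L + g L)(S, Z)`, whose Cauchy integral is the difference of a component
of the biharmonic Cauchy type integral and the classical one. -/
def starKernel (σ : ℂ → ℂ) (s : ℂ) (f g : ℂ → ℝ) (S Z : ℂ) : ℂ :=
  (f S : ℂ) * kerK σ S Z + s * ((f S : ℂ) * kerL σ S Z) + (g S : ℂ) * kerL σ S Z

theorem circleIntegrable_starKernel {Z : ℂ} (s : ℂ)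
    (h1 : CircleIntegrable (fun S => (f S : ℂ) * kerK σ S Z) 0 1)
    (h2 : CircleIntegrable (fun S => (f S : ℂ) * kerL σ S Z) 0 1)
    (h3 : CircleIntegrable (fun S => (g S : ℂ) * kerL σ S Z) 0 1) :
    CircleIntegrable (fun S => starKernel σ s f g S Z) 0 1 ∧
      ∮ S in C(0, 1), starKernel σ s f g S Z = (∮ S in C(0, 1), (f S : ℂ) * kerK σ S Z) +
        s * (∮ S in C(0, 1), (f S : ℂ) * kerL σ S Z) +
        ∮ S in C(0, 1), (g S : ℂ) * kerL σ S Z := by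
  have h2' : CircleIntegrable (fun S => s * ((f S : ℂ) * kerL σ S Z)) 0 1 :=
    IntervalIntegrable.const_mul h2 s
  have h12 : CircleIntegrable
      (fun S => (f S : ℂ) * kerK σ S Z + s * ((f S : ℂ) * kerL σ S Z)) 0 1 := h1.add h2'
  refine ⟨h12.add h3, ?_⟩
  simp only [starKernel]
  rw [circleIntegral.integral_add h12 h3, circleIntegral.integral_add h1 h2',
    circleIntegral.integral_const_mul]

theorem circleIntegrable_mul_inv_sub (hfi : CircleIntegrable f 0 1) {Z : ℂ}
    (hZ : Z ∈ ball (0 : ℂ) 1) : CircleIntegrable (fun S => (f S : ℂ) * (1 / (S - Z))) 0 1 := by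
  refine (circleIntegrable_ofReal hfi).mul_continuousOn
    (continuousOn_const.div (by fun_prop) fun S hS => ?_)
  rw [sub_ne_zero]
  rintro rfl
  rw [abs_one, mem_sphere_zero_iff_norm] at hS
  rw [mem_ball_zero_iff] at hZ
  linarith

/-- The whole jump comes from `f(S)/(S - Z)`, where `f` is real; the coefficient `s` is `-i` for the
first component and `i` for the third. -/
theorem tendsto_re_starKernel (hσ : IsConformalOnto σ D) (hD : IsOpen D)
    (hm : 0 < m) (hXΓ : ∀ j, ‖X j‖ = 1) (hA : DerivCondition σ X β) (hB : LocalCondition σ X β)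
    (hf : ContinuousOn f (sphere 0 1 \ range X)) (hfi : CircleIntegrable f 0 1)
    (hfσ : CircleIntegrable (fun S => |f S| * ‖contourDeriv σ S‖) 0 1)
    (hg : ContinuousOn g (sphere 0 1 \ range X)) (hgi : CircleIntegrable g 0 1)
    (hgσ : CircleIntegrable (fun S => |g S| * ‖contourDeriv σ S‖) 0 1)
    (hZ₀ : Z₀ ∈ sphere (0 : ℂ) 1 \ range X) (s : ℂ) :
    CircleIntegrable (fun S => starKernel σ s f g S Z₀) 0 1 ∧
      Tendsto (fun Z => (1 / (2 * (Real.pi : ℂ) * Complex.I) *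
          ∮ S in C(0, 1), (starKernel σ s f g S Z + (f S : ℂ) * (1 / (S - Z)))).re)
        (𝓝[ball 0 1] Z₀)
        (𝓝 (1 / 2 * f Z₀ + (1 / (2 * (Real.pi : ℂ) * Complex.I) *
          ∮ S in C(0, 1), starKernel σ s f g S Z₀).re + (constC f).re)) := by
  have hn : ‖Z₀‖ = 1 := by simpa using hZ₀.1
  obtain ⟨k1, k2⟩ := tendsto_circleIntegral_kerK hσ hD hm hXΓ hA hB hf hfi hfσ hZ₀
  obtain ⟨l1, l2⟩ := tendsto_circleIntegral_kerL hσ hD hm hXΓ hA hB hf hfi hfσ hZ₀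
  obtain ⟨l1', l2'⟩ := tendsto_circleIntegral_kerL hσ hD hm hXΓ hA hB hg hgi hgσ hZ₀
  obtain ⟨i1, i2⟩ := circleIntegrable_starKernel s
    (k1.self_of_nhdsWithin (sphere_subset_closedBall hZ₀.1)) l1 l1'
  refine ⟨i1, ?_⟩
  have hc : ContinuousWithinAt f (sphere 0 1) Z₀ := by
    rw [ContinuousWithinAt, ← nhdsWithin_sphere_sdiff hZ₀]
    exact hf Z₀ hZ₀
  have t1 := ((k2.mono_left (nhdsWithin_mono Z₀ ball_subset_closedBall)).add
    (l2.const_mul s)).add l2'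
  rw [← i2] at t1
  have t2 := (Complex.continuous_re.tendsto _).comp
    (t1.const_mul (1 / (2 * (Real.pi : ℂ) * Complex.I)))
  have t3 := t2.add (tendsto_re_cauchy hfi hn hc)
  rw [show ∀ a b c : ℝ, a + (b + c) = b + a + c by intros; ring] at t3
  refine t3.congr' ?_
  filter_upwards [self_mem_nhdsWithin] with Z hZ
  have hkf := circleIntegrable_kernels hσ hD hA hf hfi hfσ hZ
  have hkg := circleIntegrable_kernels hσ hD hA hg hgi hgσ hZ
  obtain ⟨j1, j2⟩ := circleIntegrable_starKernel s hkf.1 hkf.2 hkg.2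
  rw [circleIntegral.integral_add j1 (circleIntegrable_mul_inv_sub hfi hZ), j2, mul_add,
    Complex.add_re]
  rfl

/-! ### Principal values and the densities `Ω_*`, `Ω_**`. -/

theorem hasPVCauchyIntegral_of_circleIntegrable {Ω : ℂ → ℂ → ℂ} {T : ℂ} {h : ℂ → ℂ}
    (hi : CircleIntegrable h 0 1) (hΩ : ∀ S ∈ sphere (0 : ℂ) 1, Ω S T / (S - T) = h S) :
    HasPVCauchyIntegral Ω T (1 / (2 * (Real.pi : ℂ) * Complex.I) * ∮ S in C(0, 1), h S) := by
  have htr : ∀ δ : ℝ, ∀ S ∈ sphere (0 : ℂ) 1, truncated (fun S => Ω S T / (S - T)) T δ S =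
      {S | δ < ‖S - T‖}.indicator h S := by
    intro δ S hS
    by_cases hδ : δ < ‖S - T‖
    · rw [indicator_of_mem (show S ∈ {S | δ < ‖S - T‖} from hδ), truncated, if_pos hδ, hΩ S hS]
    · rw [indicator_of_notMem (show S ∉ {S | δ < ‖S - T‖} from hδ), truncated, if_neg hδ]
  have hind : ∀ δ : ℝ, CircleIntegrable ({S | δ < ‖S - T‖}.indicator h) 0 1 := by
    intro δ
    have hm : MeasurableSet {θ : ℝ | δ < ‖circleMap 0 1 θ - T‖} :=
      (isOpen_lt continuous_const (by fun_prop)).measurableSet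
    rw [CircleIntegrable, intervalIntegrable_iff] at hi ⊢
    exact hi.indicator hm
  have hsp : ∀ θ : ℝ, circleMap 0 1 θ ∈ sphere (0 : ℂ) 1 := fun θ => by simp
  refine ⟨fun δ _ => ?_, ?_⟩
  · exact (hind δ).congr fun θ _ => (htr δ _ (hsp θ)).symm
  · refine Tendsto.const_mul _ ?_
    have e : ∀ δ : ℝ, (∮ S in C(0, 1), truncated (fun S => Ω S T / (S - T)) T δ S) =
        ∮ S in C(0, 1), {S | δ < ‖S - T‖}.indicator h S := fun δ =>
      circleIntegral.integral_congr zero_le_one (htr δ)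
    simp only [e]
    simp only [circleIntegral]
    refine intervalIntegral.tendsto_integral_filter_of_dominated_convergence
      (fun θ => ‖h (circleMap 0 1 θ)‖) ?_ ?_ hi.norm ?_
    · refine Eventually.of_forall fun δ => ?_
      rw [uIoc_of_le Real.two_pi_pos.le]
      exact (hind δ).out.aestronglyMeasurable
    · refine Eventually.of_forall fun δ => Eventually.of_forall fun θ _ => ?_
      rw [norm_smul, deriv_circleMap, norm_mul, Complex.norm_I, norm_circleMap_zero, abs_one,
        one_mul, one_mul]
      exact norm_indicator_le_norm_self _ _
    · filter_upwards [ae_circleMap_notMem' (countable_singleton T)] with θ hθ _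
      refine tendsto_const_nhds.congr' ?_
      have : 0 < ‖circleMap 0 1 θ - T‖ := norm_pos_iff.2 (sub_ne_zero.2 hθ)
      filter_upwards [Ioo_mem_nhdsGT this] with δ hδ
      rw [indicator_of_mem (show circleMap 0 1 θ ∈ {S | δ < ‖S - T‖} from hδ.2)]

/-- Off the diagonal `Ω₁[f]/(S - Z) = f K` and `2 Ω₂[f]/(S - Z) = -f L`. -/
theorem OmegaStar_div (hσ : IsConformalOnto σ D) (hD : IsOpen D) {S Z : ℂ}
    (hS : S ∈ closedBall (0 : ℂ) 1) (hZ : Z ∈ closedBall (0 : ℂ) 1) :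
    OmegaStar σ f g S Z / (S - Z) = starKernel σ (-Complex.I) f g S Z := by
  by_cases h : S = Z
  -- On the diagonal every quotient is a division by zero, hence `0` on both sides.
  · subst h; simp [starKernel, kerK, kerL]
  · have hq := sub_ne_zero_of_ne hσ hD hS hZ h
    have hw := sub_ne_zero.2 h
    simp only [OmegaStar, Omega₁, Omega₂, if_neg h, starKernel, kerK, kerL, d]
    field_simp
    ring

theorem OmegaStarStar_div (hσ : IsConformalOnto σ D) (hD : IsOpen D) {S Z : ℂ}
    (hS : S ∈ closedBall (0 : ℂ) 1) (hZ : Z ∈ closedBall (0 : ℂ) 1) :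
    OmegaStarStar σ f g S Z / (S - Z) = starKernel σ Complex.I g f S Z := by
  by_cases h : S = Z
  · subst h; simp [starKernel, kerK, kerL]
  · have hq := sub_ne_zero_of_ne hσ hD hS hZ h
    have hw := sub_ne_zero.2 h
    simp only [OmegaStarStar, Omega₁, Omega₂, if_neg h, starKernel, kerK, kerL, d]
    field_simp
    ring

/-! ### Reduction of the biharmonic Cauchy integral to complex kernels. -/

/-- With `ρ = e₂ - i e₁` and `ρ² = 0`, the inverse of `q + (Im q) ρ` is `1/q - (Im q/q²) ρ`. -/
theorem ringInverse_ofPlane {q : ℂ} (hq : q ≠ 0) : Ring.inverse (Biharm.ofPlane q) =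
    Biharm.mk (1 / q + Complex.I * (q.im / q ^ 2)) (-(q.im / q ^ 2)) := by
  have hre : (q.re : ℂ) = q - Complex.I * q.im := by
    nth_rewrite 2 [← Complex.re_add_im q]; ring
  have h : Biharm.ofPlane q *
      Biharm.mk (1 / q + Complex.I * (q.im / q ^ 2)) (-(q.im / q ^ 2)) = 1 := by
    have e1 : q * (1 / q) = 1 := by field_simp
    have e2 : q * (q.im / q ^ 2) = q.im * (1 / q) := by field_simp
    generalize 1 / q = u at *
    generalize (q.im : ℂ) / q ^ 2 = v at *
    apply Biharm.ext_coeff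
    · simp only [Biharm.ofPlane, Biharm.c₁_mul, Biharm.c₁_mk, Biharm.c₂_mk, Biharm.c₁_one, hre]
      linear_combination e1 + Complex.I * e2 - (q.im : ℂ) * v * Complex.I_sq
    · simp only [Biharm.ofPlane, Biharm.c₂_mul, Biharm.c₁_mk, Biharm.c₂_mk, Biharm.c₂_one, hre]
      linear_combination -e2
  exact Ring.inverse_unit ⟨_, _, h, by rw [mul_comm]; exact h⟩

/-- In terms of `ρ` the kernel is `(K + 1/(S - Z)) + L ρ` and the density `(φ₁ + i φ₃) + φ₃ ρ`;
multiplying and returning to `e₁, e₂` moves the nilpotent part into both components. -/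
theorem cauchyIntegrand_eq (hσ : IsConformalOnto σ D) (hD : IsOpen D) (hA : DerivCondition σ X β)
    (φ₁ φ₃ : Biharm → ℝ) {S Z : ℂ} (hS : S ∈ sphere (0 : ℂ) 1 \ range X)
    (hZ : Z ∈ ball (0 : ℂ) 1) :
    cauchyIntegrand σ φ₁ φ₃ (sigmaTilde σ Z) S = Biharm.mk
      (starKernel σ (-Complex.I) (fun S => φ₁ (sigmaTilde σ S)) (fun S => φ₃ (sigmaTilde σ S)) S Z +
        (φ₁ (sigmaTilde σ S) : ℂ) * (1 / (S - Z)))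
      (starKernel σ Complex.I (fun S => φ₃ (sigmaTilde σ S)) (fun S => φ₁ (sigmaTilde σ S)) S Z +
        (φ₃ (sigmaTilde σ S) : ℂ) * (1 / (S - Z))) := by
  have hne : S ≠ Z := by
    rintro rfl
    have h1 := hS.1
    rw [mem_sphere_zero_iff_norm] at h1
    rw [mem_ball_zero_iff] at hZ
    linarith
  have hq := sub_ne_zero_of_ne hσ hD (sphere_subset_closedBall hS.1) (ball_subset_closedBall hZ) hne
  have e : sigmaTilde σ S - sigmaTilde σ Z = Biharm.ofPlane (σ S - σ Z) := (ofPlane_sub _ _).symm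
  have e2 : sigma₂ σ S - sigma₂ σ Z = ((σ S - σ Z).im : ℂ) := by simp [sigma₂]
  rw [cauchyIntegrand, e, ringInverse_ofPlane hq, contourDeriv_sigmaTilde hA hS]
  simp only [starKernel, kerK, kerL, e2]
  generalize contourDeriv (sigma₂ σ) S = b
  generalize contourDeriv σ S = a
  generalize σ S - σ Z = q
  simp only [mul_div_assoc, div_eq_mul_one_div b q, div_eq_mul_one_div a q]
  generalize 1 / q = u
  generalize (q.im : ℂ) / q ^ 2 = v
  apply Biharm.ext_coeff
  · simp only [Biharm.c₁_mul, Biharm.c₁_mk, Biharm.c₂_mk, Biharm.c₂_mul]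
    linear_combination (-((φ₁ (sigmaTilde σ S) : ℂ) * v * b)) * Complex.I_sq
  · simp only [Biharm.c₁_mul, Biharm.c₁_mk, Biharm.c₂_mk, Biharm.c₂_mul]
    linear_combination (-((φ₃ (sigmaTilde σ S) : ℂ) * v * b)) * Complex.I_sq

theorem mk_eq_smul_add_smul (a b : ℂ) :
    Biharm.mk a b = a • Biharm.mk 1 0 + b • Biharm.mk 0 1 := by
  apply Biharm.ext_coeff <;> simp

theorem circleIntegral_mk {F G : ℂ → ℂ} (hF : CircleIntegrable F 0 1)
    (hG : CircleIntegrable G 0 1) :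
    CircleIntegrable (fun S => Biharm.mk (F S) (G S)) 0 1 ∧
      ∮ S in C(0, 1), Biharm.mk (F S) (G S) =
        Biharm.mk (∮ S in C(0, 1), F S) (∮ S in C(0, 1), G S) := by
  have : CompleteSpace Biharm := inferInstanceAs (CompleteSpace (EuclideanSpace ℂ (Fin 2)))
  have h1 : CircleIntegrable (fun S => F S • Biharm.mk 1 0) 0 1 :=
    ⟨hF.1.smul_const _, hF.2.smul_const _⟩
  have h2 : CircleIntegrable (fun S => G S • Biharm.mk 0 1) 0 1 :=
    ⟨hG.1.smul_const _, hG.2.smul_const _⟩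
  have e : (fun S => Biharm.mk (F S) (G S)) =
      fun S => F S • Biharm.mk 1 0 + G S • Biharm.mk 0 1 :=
    funext fun S => mk_eq_smul_add_smul _ _
  rw [e, mk_eq_smul_add_smul (circleIntegral F 0 1)]
  refine ⟨h1.add h2, ?_⟩
  rw [circleIntegral.integral_add h1 h2, circleIntegral.integral_smul_const,
    circleIntegral.integral_smul_const]

end boundary

theorem circleIntegral_cauchyIntegrand {σ : ℂ → ℂ} {D : Set ℂ} {m : ℕ} {X : Fin m → ℂ}
    {β : Fin m → ℝ} (hσ : IsConformalOnto σ D) (hD : IsOpen D) (hA : DerivCondition σ X β)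
    {φ₁ φ₃ : Biharm → ℝ} {ψ₁ ψ₃ : ℂ → ℝ} (hψ₁ : ψ₁ = fun S => φ₁ (sigmaTilde σ S))
    (hψ₃ : ψ₃ = fun S => φ₃ (sigmaTilde σ S))
    (hf : ContinuousOn ψ₁ (sphere 0 1 \ range X)) (hfi : CircleIntegrable ψ₁ 0 1)
    (hfσ : CircleIntegrable (fun S => |ψ₁ S| * ‖contourDeriv σ S‖) 0 1)
    (hg : ContinuousOn ψ₃ (sphere 0 1 \ range X)) (hgi : CircleIntegrable ψ₃ 0 1)
    (hgσ : CircleIntegrable (fun S => |ψ₃ S| * ‖contourDeriv σ S‖) 0 1)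
    {Z : ℂ} (hZ : Z ∈ ball (0 : ℂ) 1) :
    CircleIntegrable (cauchyIntegrand σ φ₁ φ₃ (sigmaTilde σ Z)) 0 1 ∧
      cauchyTypeIntegral σ φ₁ φ₃ (sigmaTilde σ Z) = Biharm.mk
        (1 / (2 * (Real.pi : ℂ) * Complex.I) * ∮ S in C(0, 1),
          (starKernel σ (-Complex.I) ψ₁ ψ₃ S Z + (ψ₁ S : ℂ) * (1 / (S - Z))))
        (1 / (2 * (Real.pi : ℂ) * Complex.I) * ∮ S in C(0, 1),
          (starKernel σ Complex.I ψ₃ ψ₁ S Z + (ψ₃ S : ℂ) * (1 / (S - Z)))) := by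
  have hkf := circleIntegrable_kernels hσ hD hA hf hfi hfσ hZ
  have hkg := circleIntegrable_kernels hσ hD hA hg hgi hgσ hZ
  have i₁ := (circleIntegrable_starKernel (-Complex.I) hkf.1 hkf.2 hkg.2).1.add
    (circleIntegrable_mul_inv_sub hfi hZ)
  have i₃ := (circleIntegrable_starKernel Complex.I hkg.1 hkg.2 hkf.2).1.add
    (circleIntegrable_mul_inv_sub hgi hZ)
  obtain ⟨j1, j2⟩ := circleIntegral_mk i₁ i₃
  have hae : ∀ᵐ θ : ℝ, cauchyIntegrand σ φ₁ φ₃ (sigmaTilde σ Z) (circleMap 0 1 θ) =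
      Biharm.mk
        (starKernel σ (-Complex.I) ψ₁ ψ₃ (circleMap 0 1 θ) Z +
          (ψ₁ (circleMap 0 1 θ) : ℂ) * (1 / (circleMap 0 1 θ - Z)))
        (starKernel σ Complex.I ψ₃ ψ₁ (circleMap 0 1 θ) Z +
          (ψ₃ (circleMap 0 1 θ) : ℂ) * (1 / (circleMap 0 1 θ - Z))) := by
    -- At the corners the contour derivatives may fail to exist; finitely many points do not affect
    -- the integral.
    filter_upwards [ae_circleMap_notMem' (finite_range X).countable] with θ hθ
    rw [cauchyIntegrand_eq hσ hD hA φ₁ φ₃ ⟨by simp, hθ⟩ hZ, hψ₁, hψ₃]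
  constructor
  · refine IntervalIntegrable.congr_ae j1 ?_
    refine ae_restrict_of_ae ?_
    filter_upwards [hae] with θ hθ
    exact hθ.symm
  · rw [cauchyTypeIntegral]
    have e : (∮ S in C(0, 1), cauchyIntegrand σ φ₁ φ₃ (sigmaTilde σ Z) S) =
        ∮ S in C(0, 1), Biharm.mk
          (starKernel σ (-Complex.I) ψ₁ ψ₃ S Z + (ψ₁ S : ℂ) * (1 / (S - Z)))
          (starKernel σ Complex.I ψ₃ ψ₁ S Z + (ψ₃ S : ℂ) * (1 / (S - Z))) := by
      refine intervalIntegral.integral_congr_ae ?_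
      filter_upwards [hae] with θ hθ _
      rw [hθ]
    rw [e]
    refine (congrArg _ j2).trans ?_
    apply Biharm.ext_coeff <;> rfl

end BiharmCauchy

end

/-! ### The main theorem. -/

theorem mainTheorem2
    (D : Set ℂ) (hDo : IsOpen D) (hDc : IsConnected D) (hDb : Bornology.IsBounded D)
    (σ : ℂ → ℂ) (hσ : BiharmCauchy.IsConformalOnto σ D)
    (m : ℕ) (hm : 0 < m) (X : Fin m → ℂ) (hX : Function.Injective X)
    (hXΓ : ∀ j, X j ∈ sphere (0 : ℂ) 1)
    (β : Fin m → ℝ) (hβ : ∀ j, β j ∈ Ioc (-1 : ℝ) 1)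
    (hA : BiharmCauchy.DerivCondition σ X β)
    (hB : BiharmCauchy.LocalCondition σ X β)
    (α : Fin m → ℝ) (hα_neg : ∀ j, β j < 0 → α j < 1)
    (hα_nonneg : ∀ j, 0 ≤ β j → α j < 1 / (β j + 1))
    (φ₁ φ₃ : Biharm → ℝ)
    (hφ₁ : BiharmCauchy.DensityCondition σ D X α φ₁)
    (hφ₃ : BiharmCauchy.DensityCondition σ D X α φ₃)
    (ψ₁ ψ₃ : ℂ → ℝ)
    (hψ₁ : ψ₁ = fun S => φ₁ (BiharmCauchy.sigmaTilde σ S))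
    (hψ₃ : ψ₃ = fun S => φ₃ (BiharmCauchy.sigmaTilde σ S)) :
    (∀ ζ ∈ Biharm.ofPlane '' D,
      CircleIntegrable (BiharmCauchy.cauchyIntegrand σ φ₁ φ₃ ζ) 0 1) ∧
    CircleIntegrable (fun S => (ψ₁ S : ℂ) / S) 0 1 ∧
    CircleIntegrable (fun S => (ψ₃ S : ℂ) / S) 0 1 ∧
    ∀ Z₀ ∈ sphere (0 : ℂ) 1 \ range X, ∃ J₁ J₃ : ℂ,
      BiharmCauchy.HasPVCauchyIntegral (BiharmCauchy.OmegaStar σ ψ₁ ψ₃) Z₀ J₁ ∧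
      BiharmCauchy.HasPVCauchyIntegral (BiharmCauchy.OmegaStarStar σ ψ₁ ψ₃) Z₀ J₃ ∧
      Tendsto
        (fun Z => (((BiharmCauchy.cauchyTypeIntegral σ φ₁ φ₃
          (BiharmCauchy.sigmaTilde σ Z)).U₁ : ℝ) : ℂ))
        (𝓝[ball 0 1] Z₀)
        (𝓝 (1 / 2 * (ψ₁ Z₀ : ℂ) + (J₁.re : ℂ) + BiharmCauchy.constC ψ₁)) ∧
      Tendsto
        (fun Z => (((BiharmCauchy.cauchyTypeIntegral σ φ₁ φ₃
          (BiharmCauchy.sigmaTilde σ Z)).U₃ : ℝ) : ℂ))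
        (𝓝[ball 0 1] Z₀)
        (𝓝 (1 / 2 * (ψ₃ Z₀ : ℂ) + (J₃.re : ℂ) + BiharmCauchy.constC ψ₃)) := by
  have hXn : ∀ j, ‖X j‖ = 1 := fun j => by simpa using hXΓ j
  have hβ' : ∀ j, -1 < β j := fun j => (hβ j).1
  obtain ⟨hf, hfi, hfσ⟩ := hφ₁.pullback hσ hDo hm hX hXn hβ' hA hB hα_neg hα_nonneg
  obtain ⟨hg, hgi, hgσ⟩ := hφ₃.pullback hσ hDo hm hX hXn hβ' hA hB hα_neg hα_nonneg
  simp only [← congrFun hψ₁] at hf hfi hfσ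
  simp only [← congrFun hψ₃] at hg hgi hgσ
  have hinv : ContinuousOn (fun S : ℂ => S⁻¹) (sphere 0 |1|) := by
    refine continuousOn_inv₀.mono fun S hS => ?_
    rintro rfl; simp at hS
  have key := fun {Z : ℂ} (hZ : Z ∈ ball (0 : ℂ) 1) =>
    BiharmCauchy.circleIntegral_cauchyIntegrand hσ hDo hA hψ₁ hψ₃ hf hfi hfσ hg hgi hgσ hZ
  refine ⟨?_, ?_, ?_, fun Z₀ hZ₀ => ?_⟩
  · rintro _ ⟨w, hw, rfl⟩
    obtain ⟨Z, hZ, rfl⟩ := hσ.bijOn.surjOn hw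
    exact (key hZ).1
  · simp only [div_eq_mul_inv]
    exact (BiharmCauchy.circleIntegrable_ofReal hfi).mul_continuousOn hinv
  · simp only [div_eq_mul_inv]
    exact (BiharmCauchy.circleIntegrable_ofReal hgi).mul_continuousOn hinv
  have hZ₀c := sphere_subset_closedBall hZ₀.1
  obtain ⟨i₁, t₁⟩ := BiharmCauchy.tendsto_re_starKernel hσ hDo hm hXn hA hB hf hfi hfσ hg hgi hgσ
    hZ₀ (-Complex.I)
  obtain ⟨i₃, t₃⟩ := BiharmCauchy.tendsto_re_starKernel hσ hDo hm hXn hA hB hg hgi hgσ hf hfi hfσ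
    hZ₀ Complex.I
  -- `C` is half the mean of a real function, hence real, so it may appear in the limit without
  -- taking its real part.
  have hC : ∀ {ψ : ℂ → ℝ}, CircleIntegrable ψ 0 1 →
      ((BiharmCauchy.constC ψ).re : ℂ) = BiharmCauchy.constC ψ := fun h => by
    rw [BiharmCauchy.constC_eq_circleAverage h, Complex.ofReal_re]
  refine ⟨_, _, BiharmCauchy.hasPVCauchyIntegral_of_circleIntegrable i₁ fun S hS =>
      BiharmCauchy.OmegaStar_div hσ hDo (sphere_subset_closedBall hS) hZ₀c,
    BiharmCauchy.hasPVCauchyIntegral_of_circleIntegrable i₃ fun S hS =>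
      BiharmCauchy.OmegaStarStar_div hσ hDo (sphere_subset_closedBall hS) hZ₀c, ?_, ?_⟩
  · have t := (Complex.continuous_ofReal.tendsto _).comp t₁
    push_cast at t
    rw [hC hfi] at t
    refine t.congr' ?_
    filter_upwards [self_mem_nhdsWithin] with Z hZ
    rw [(key hZ).2]
    rfl
  · have t := (Complex.continuous_ofReal.tendsto _).comp t₃
    push_cast at t
    rw [hC hgi] at t
    refine t.congr' ?_
    filter_upwards [self_mem_nhdsWithin] with Z hZ
    rw [(key hZ).2]
    rfl
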